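/- Let $F_n$ be the free group on $n$ generators. For a group $G$, let $G[1]=G$ and $G[k+1]=[G[k],G]$ for $k\ge 1$ denote the terms of its lower central series. For $k\ge 1$, let $\mathrm{JIA}_n(k)$ denote the $k$-th term of the Andreadakis–Johnson filtration of $\mathrm{Aut}(F_n)$, i.e. the kernel of the natural homomorphism $\mathrm{Aut}(F_n)\to\mathrm{Aut}(F_n/F_n[k+1])$. Then for every $k\ge 2$, the group $\mathrm{JIA}_n(k)$ is finitely generated for all $n\ge 6k-4$. -/

import Mathlib

/-- The `k`-th term `G[k]` of the lower central series of a group `G`, indexed so that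
`G[1] = G` and `G[k+1] = [G[k], G]` for `k ≥ 1`. (Mathlib's series starts at index `0`;
the value at `k = 0` is the convention `G[0] = G`.) -/
def lcsTerm (G : Type*) [Group G] (k : ℕ) : Subgroup G :=
  (⊤ : Subgroup G).lowerCentralSeries (k - 1)

theorem lcsTerm_one (G : Type*) [Group G] : lcsTerm G 1 = ⊤ := rfl

theorem lcsTerm_succ (G : Type*) [Group G] (k : ℕ) (hk : 1 ≤ k) :
    lcsTerm G (k + 1) = ⁅lcsTerm G k, (⊤ : Subgroup G)⁆ := by
  obtain ⟨m, rfl⟩ := Nat.exists_eq_add_of_le' hk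
  rfl

instance lcsTerm_characteristic (G : Type*) [Group G] (k : ℕ) :
    (lcsTerm G k).Characteristic :=
  Subgroup.lowerCentralSeries_characteristic ⊤ (k - 1)

/-- The natural homomorphism `Aut(G) → Aut(G / G[k])`: an automorphism `f` of `G` preserves
the characteristic subgroup `G[k]`, and is sent to `x G[k] ↦ f(x) G[k]`. -/
def autQuotientLcs (G : Type*) [Group G] (k : ℕ) :
    MulAut G →* MulAut (G ⧸ lcsTerm G k) where
  toFun f := QuotientGroup.congr (lcsTerm G k) (lcsTerm G k) f
    (Subgroup.characteristic_iff_map_eq.1 inferInstance f)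
  map_one' := by
    ext x
    induction x using QuotientGroup.induction_on
    rfl
  map_mul' f g := by
    ext x
    induction x using QuotientGroup.induction_on
    rfl

theorem autQuotientLcs_apply_mk (G : Type*) [Group G] (k : ℕ) (f : MulAut G) (x : G) :
    autQuotientLcs G k f (x : G ⧸ lcsTerm G k) = ((f x : G) : G ⧸ lcsTerm G k) := rfl

/-- The `k`-th term `JIA_n(k)` of the Andreadakis–Johnson filtration of `Aut(F_n)`: the kernel
of the natural homomorphism `Aut(F_n) → Aut(F_n / F_n[k+1])`, where `F_n` is the free group on
`n` generators. -/
def JIA (n k : ℕ) : Subgroup (MulAut (FreeGroup (Fin n))) :=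
  (autQuotientLcs (FreeGroup (Fin n)) (k + 1)).ker

/-! Write M for the kernel of Aut(F_n) → GL_n(ℤ) and M[i] for its lower central series, which the
code indexes from 0. Elements of M[i] shift the lower central series of F_n by i steps
(`lowerCentralSeries_magnusSubgroup_le`), so M[k] ≤ JIA_n(k) ≤ M. If M[1], …, M[k] are finitely
generated, then each M[i]/M[i+1] is a finitely generated abelian group; climbing from JIA_n(k) ∩
M[k] = M[k] to JIA_n(k) ∩ M[1] = JIA_n(k) adds finitely many generators at each stage. So everything
rests on finite generation of the M[i].

For i = 1 this is Magnus' theorem (`ker_abHom`). Nielsen reduction shows that Aut(F_n) is generated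
by transvections and signed permutations; the conjugation formulas show that Magnus' automorphisms
generate a normal subgroup; and a Euclidean-algorithm argument (`IsElementarySystem`) shows that the
quotient by it acts faithfully on ℤ^n.

The step from M[i] to M[i+1] uses a criterion in the spirit of Bieri–Neumann–Strebel
(`Subgroup.fg_of_commuting_chains`). Let N contain the commutator subgroup of a finitely generated
group G. Then N is finitely generated if for every nonzero real character χ of G killing N some b
with χ(b) ≠ 0 is linked to each of its conjugates by a chain of elements in which neighbours commute
and χ never vanishes. Such a chain lets paths in the Cayley graph be pushed in the direction of χ;
compactness of the sphere of directions makes this uniform, and Schreier's rewriting finishes.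

The chains come from `exists_commuting_chain`. A character χ of M[i] is nonzero on some i-fold
commutator c of Magnus generators, which involves at most 3i letters. Along conjugation by powers of
a transvection χ varies polynomially, and a nonzero polynomial has finitely many zeros, so a single
g makes χ nonzero on the g-conjugates of all the copies of c obtained by permuting letters. Copies
with disjoint letters commute, and if n ≥ 6i + 1 any two copies are linked through disjoint ones.
Each generator of M, conjugated by g, commutes with some copy, which links a copy to all its
M-conjugates. -/

/-! ### Paths in Cayley graphs -/

/-- `g` and `h` are joined by a path in the Cayley graph of `G` with respect to `X`, all of whose
edges have both ends in `P`. -/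
def CayleyJoined {G : Type*} [Group G] (X P : Set G) : G → G → Prop :=
  Relation.ReflTransGen fun a b => a ∈ P ∧ b ∈ P ∧ a⁻¹ * b ∈ X

namespace CayleyJoined

variable {G : Type*} [Group G] {X P Q : Set G}

theorem refl (g : G) : CayleyJoined X P g g := Relation.ReflTransGen.refl

theorem trans {g h k : G} (H : CayleyJoined X P g h) (H' : CayleyJoined X P h k) :
    CayleyJoined X P g k := Relation.ReflTransGen.trans H H'

theorem mono (hPQ : P ⊆ Q) {g h : G} (H : CayleyJoined X P g h) : CayleyJoined X Q g h :=
  Relation.ReflTransGen.mono (fun _ _ h => ⟨hPQ h.1, hPQ h.2.1, h.2.2⟩) _ _ H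

theorem symm (hX : ∀ x ∈ X, x⁻¹ ∈ X) {g h : G} (H : CayleyJoined X P g h) :
    CayleyJoined X P h g := by
  refine Relation.reflTransGen_swap.1 (Relation.ReflTransGen.mono ?_ _ _ H)
  rintro a b ⟨ha, hb, hab⟩
  exact ⟨hb, ha, by simpa using hX _ hab⟩

theorem translate (k : G) {g h : G} (H : CayleyJoined X P g h)
    (hPQ : ∀ p ∈ P, k * p ∈ Q) : CayleyJoined X Q (k * g) (k * h) := by
  refine Relation.ReflTransGen.lift (fun a => k * a) ?_ _ _ H
  rintro a b ⟨ha, hb, hab⟩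
  exact ⟨hPQ _ ha, hPQ _ hb, by simpa [mul_assoc] using hab⟩

theorem exists_finite {g h : G} (H : CayleyJoined X P g h) :
    ∃ Q : Set G, Q.Finite ∧ Q ⊆ P ∧ CayleyJoined X Q g h := by
  induction H with
  | refl => exact ⟨∅, Set.finite_empty, Set.empty_subset _, Relation.ReflTransGen.refl⟩
  | @tail b c _ hbc ih =>
    obtain ⟨Q, hQ, hQP, H⟩ := ih
    refine ⟨insert b (insert c Q), (hQ.insert _).insert _, ?_, ?_⟩
    · rintro q (rfl | rfl | hq)
      exacts [hbc.1, hbc.2.1, hQP hq]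
    · exact Relation.ReflTransGen.tail (H.mono (by intro q hq; simp [hq]))
        ⟨by simp, by simp, hbc.2.2⟩

end CayleyJoined

/-! ### Half-spaces of a character and chains of commuting elements -/

section HalfSpace

variable {G : Type*} [Group G] {X : Set G} {χ : G → ℝ}

theorem map_one_of_additive (hχ : ∀ a b, χ (a * b) = χ a + χ b) : χ 1 = 0 := by
  have := hχ 1 1; simp at this; exact this

theorem map_inv_of_additive (hχ : ∀ a b, χ (a * b) = χ a + χ b) (a : G) : χ a⁻¹ = -χ a := by
  have := hχ a a⁻¹
  rw [mul_inv_cancel, map_one_of_additive hχ] at this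
  linarith

theorem map_pow_of_additive (hχ : ∀ a b, χ (a * b) = χ a + χ b) (a : G) (m : ℕ) :
    χ (a ^ m) = m * χ a := by
  induction m with
  | zero => simp [map_one_of_additive hχ]
  | succ m ih => rw [pow_succ, hχ, ih]; push_cast; ring

/-- A word for `c` traces the same path from every starting point up to translation, so the depth
`D` to which χ dips does not depend on `g`. -/
theorem exists_joined_mul (hχ : ∀ a b, χ (a * b) = χ a + χ b) (hX : ∀ x ∈ X, x⁻¹ ∈ X)
    (hgen : Subgroup.closure X = ⊤) (c : G) :
    ∃ D : ℝ, ∀ g, CayleyJoined X {h | χ g - D ≤ χ h} g (g * c) := by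
  have hc : c ∈ Subgroup.closure X := hgen ▸ Subgroup.mem_top c
  induction hc using Subgroup.closure_induction with
  | mem x hx =>
    refine ⟨|χ x|, fun g => Relation.ReflTransGen.single ⟨?_, ?_, by simpa using hx⟩⟩
    · simp
    · simp only [Set.mem_ofPred_eq, hχ]
      linarith [neg_abs_le (χ x)]
  | one => exact ⟨0, fun g => by rw [mul_one]; exact .refl g⟩
  | mul x y _ _ hx hy =>
    obtain ⟨D, hD⟩ := hx
    obtain ⟨D', hD'⟩ := hy
    refine ⟨|D| + |D'| + |χ x|, fun g => ?_⟩
    rw [← mul_assoc]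
    refine ((hD g).mono ?_).trans ((hD' (g * x)).mono ?_)
    · intro h hh
      simp only [Set.mem_ofPred_eq] at *
      linarith [le_abs_self D, abs_nonneg D', abs_nonneg (χ x)]
    · intro h hh
      simp only [Set.mem_ofPred_eq, hχ] at *
      linarith [le_abs_self D', abs_nonneg D, neg_abs_le (χ x)]
  | inv x _ hx =>
    obtain ⟨D, hD⟩ := hx
    refine ⟨D + χ x, fun g => ?_⟩
    have := (hD (g * x⁻¹)).symm hX
    rw [inv_mul_cancel_right] at this
    refine this.mono fun h hh => ?_
    simp only [Set.mem_ofPred_eq, hχ, map_inv_of_additive hχ] at *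
    linarith

/-- Each new copy of `c` starts no lower than the previous one because `0 ≤ χ c`, so the dip of a
single copy bounds that of all powers. -/
theorem joined_mul_pow (hχ : ∀ a b, χ (a * b) = χ a + χ b) {c : G} {D : ℝ}
    (hD : ∀ g, CayleyJoined X {h | χ g - D ≤ χ h} g (g * c)) (hc : 0 ≤ χ c) (g : G) (m : ℕ) :
    CayleyJoined X {h | χ g - D ≤ χ h} g (g * c ^ m) := by
  induction m with
  | zero => rw [pow_zero, mul_one]; exact .refl g
  | succ m ih =>
    refine ih.trans ?_
    rw [pow_succ, ← mul_assoc]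
    refine (hD _).mono fun h hh => ?_
    simp only [Set.mem_ofPred_eq, hχ, map_pow_of_additive hχ] at *
    have : 0 ≤ (m : ℝ) * χ c := by positivity
    linarith

theorem eventually_lt_nat_mul {a : ℝ} (ha : 0 < a) (D : ℝ) :
    ∀ᶠ m : ℕ in Filter.atTop, D < m * a :=
  (tendsto_natCast_atTop_atTop.atTop_mul_const ha).eventually_gt_atTop D

/-- Go from `c ^ m` to `c ^ m * d ^ m = d ^ m * c ^ m` and back down to `d ^ m`. The dips are
bounded while the starting heights grow with `m`, so the path stays positive for large `m`. -/
theorem eventually_joined_pow_of_commute (hχ : ∀ a b, χ (a * b) = χ a + χ b)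
    (hX : ∀ x ∈ X, x⁻¹ ∈ X) (hgen : Subgroup.closure X = ⊤) {c d : G} (hc : 0 < χ c)
    (hd : 0 < χ d) (hcd : Commute c d) :
    ∀ᶠ m : ℕ in Filter.atTop, CayleyJoined X {h | 0 < χ h} (c ^ m) (d ^ m) := by
  obtain ⟨D, hD⟩ := exists_joined_mul hχ hX hgen c
  obtain ⟨D', hD'⟩ := exists_joined_mul hχ hX hgen d
  filter_upwards [eventually_lt_nat_mul hc D', eventually_lt_nat_mul hd D] with m hm hm'
  have h1 := joined_mul_pow hχ hD' hd.le (c ^ m) m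
  have h2 := joined_mul_pow hχ hD hc.le (d ^ m) m
  rw [← (hcd.pow_pow m m).eq] at h2
  refine (h1.mono fun h hh => ?_).trans ((h2.mono fun h hh => ?_).symm hX)
  all_goals
    simp only [Set.mem_ofPred_eq, map_pow_of_additive hχ] at *
    linarith

/-- The relation "`c` and `d` commute and `χ` vanishes at neither of them". -/
def CommutesOffKer (χ : G → ℝ) (c d : G) : Prop := Commute c d ∧ χ c ≠ 0 ∧ χ d ≠ 0

/-- Inverting an element preserves commutation, so every member of the chain can be replaced by
whichever of itself and its inverse is positive. -/
theorem eventually_joined_pow_of_chain (hχ : ∀ a b, χ (a * b) = χ a + χ b)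
    (hX : ∀ x ∈ X, x⁻¹ ∈ X) (hgen : Subgroup.closure X = ⊤) {b c : G} (hb : 0 < χ b)
    (H : Relation.ReflTransGen (CommutesOffKer χ) b c) :
    ∀ᶠ m : ℕ in Filter.atTop,
      CayleyJoined X {h | 0 < χ h} (b ^ m) ((if 0 < χ c then c else c⁻¹) ^ m) := by
  induction H with
  | refl => exact Filter.Eventually.of_forall fun m => by rw [if_pos hb]; exact .refl _
  | @tail c d _ hcd ih =>
    obtain ⟨hcom, hc, hd⟩ := hcd
    have key : ∀ᶠ m : ℕ in Filter.atTop, CayleyJoined X {h | 0 < χ h}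
        ((if 0 < χ c then c else c⁻¹) ^ m) ((if 0 < χ d then d else d⁻¹) ^ m) := by
      apply eventually_joined_pow_of_commute hχ hX hgen
      · split_ifs with h
        · exact h
        · rw [map_inv_of_additive hχ]
          have := lt_of_le_of_ne (not_lt.1 h) hc
          linarith
      · split_ifs with h
        · exact h
        · rw [map_inv_of_additive hχ]
          have := lt_of_le_of_ne (not_lt.1 h) hd
          linarith
      · split_ifs
        exacts [hcom, hcom.inv_right, hcom.inv_left, hcom.inv_inv]
    filter_upwards [ih, key] with m h1 h2 using h1.trans h2

/-- The element `g * b ^ m = (g * b * g⁻¹) ^ m * g` is near both `g`, through powers of `b`, and `(g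
* b * g⁻¹) ^ m`, which the chain joins to `b ^ m`. Thus every sufficiently high point reaches one
common ray. -/
theorem eventually_joined_pow (hχ : ∀ a b, χ (a * b) = χ a + χ b)
    (hX : ∀ x ∈ X, x⁻¹ ∈ X) (hgen : Subgroup.closure X = ⊤) {b : G} (hb : 0 < χ b)
    (H : ∀ g, Relation.ReflTransGen (CommutesOffKer χ) b (g * b * g⁻¹)) :
    ∃ D : ℝ, ∀ g, D < χ g →
      ∀ᶠ m : ℕ in Filter.atTop, CayleyJoined X {h | 0 < χ h} g (b ^ m) := by
  obtain ⟨D, hD⟩ := exists_joined_mul hχ hX hgen b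
  refine ⟨D, fun g hg => ?_⟩
  obtain ⟨D', hD'⟩ := exists_joined_mul hχ hX hgen g
  have hcg : χ (g * b * g⁻¹) = χ b := by
    rw [hχ, hχ, map_inv_of_additive hχ]; ring
  have h3 := eventually_joined_pow_of_chain hχ hX hgen hb (H g)
  filter_upwards [eventually_lt_nat_mul hb D', h3] with m hm h3
  rw [if_pos (hcg ▸ hb)] at h3
  have h1 := joined_mul_pow hχ hD hb.le g m
  have h2 := hD' ((g * b * g⁻¹) ^ m)
  have e : (g * b * g⁻¹) ^ m * g = g * b ^ m := by rw [conj_pow]; group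
  rw [e] at h2
  refine (h1.mono fun h hh => ?_).trans (((h2.mono fun h hh => ?_).symm hX).trans (h3.symm hX))
  all_goals
    simp only [Set.mem_ofPred_eq, map_pow_of_additive hχ, hcg] at *
    linarith

/-- This packages connectivity into finitely many strict inequalities: after `K` steps along a
positive generator `z`, all neighbours of 1 are joined inside a finite positive set `Q`. Finiteness
is what will make the condition open in χ. -/
theorem exists_pushing_data (hχ : ∀ a b, χ (a * b) = χ a + χ b) (hXf : X.Finite)
    (hX : ∀ x ∈ X, x⁻¹ ∈ X) (hgen : Subgroup.closure X = ⊤) {b : G} (hb : χ b ≠ 0)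
    (H : ∀ g, Relation.ReflTransGen (CommutesOffKer χ) b (g * b * g⁻¹)) :
    ∃ z ∈ X, ∃ K : ℕ, ∃ Q : Set G, 0 < K ∧ 0 < χ z ∧ Q.Finite ∧ (∀ q ∈ Q, 0 < χ q) ∧
      ∀ x ∈ X, ∀ x' ∈ X, CayleyJoined X Q (x * z ^ K) (x' * z ^ K) := by
  wlog hb0 : 0 < χ b generalizing b
  · refine this (b := b⁻¹) ?_ (fun g => ?_) ?_
    · rw [map_inv_of_additive hχ]; simpa using hb
    · have := Relation.ReflTransGen.lift (p := CommutesOffKer χ) (fun a : G => a⁻¹) ?_ _ _ (H g)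
      · simpa [Function.onFun, mul_assoc] using this
      · rintro c d ⟨h1, h2, h3⟩
        refine ⟨h1.inv_inv, ?_, ?_⟩ <;> rw [map_inv_of_additive hχ] <;> simpa
    · rw [map_inv_of_additive hχ]
      have := lt_of_le_of_ne (not_lt.1 hb0) hb
      linarith
  -- A character that is nonpositive on the symmetric set `X` vanishes on it, hence everywhere.
  obtain ⟨z, hz, hz0⟩ : ∃ z ∈ X, 0 < χ z := by
    by_contra! hcon
    have hzero : ∀ g, χ g = 0 := by
      intro g
      have hg : g ∈ Subgroup.closure X := hgen ▸ Subgroup.mem_top g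
      induction hg using Subgroup.closure_induction with
      | mem x hx =>
        refine le_antisymm (hcon x hx) ?_
        have := hcon _ (hX x hx)
        rw [map_inv_of_additive hχ] at this
        linarith
      | one => exact map_one_of_additive hχ
      | mul x y _ _ hx hy => rw [hχ, hx, hy, add_zero]
      | inv x _ hx => rw [map_inv_of_additive hχ, hx, neg_zero]
    exact hb (hzero b)
  obtain ⟨D, hD⟩ := eventually_joined_pow hχ hX hgen hb0 H
  have hev : ∀ᶠ K : ℕ in Filter.atTop, ∀ x ∈ X, D < χ (x * z ^ K) := by
    rw [Filter.eventually_all_finite hXf]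
    intro x _
    filter_upwards [eventually_lt_nat_mul hz0 (D - χ x)] with K hK
    rw [hχ, map_pow_of_additive hχ]; linarith
  obtain ⟨K, hK, hK0⟩ := (hev.and (Filter.eventually_gt_atTop 0)).exists
  have hjoin : ∀ x ∈ X, ∀ x' ∈ X, ∃ Q : Set G, Q.Finite ∧ Q ⊆ {h | 0 < χ h} ∧
      CayleyJoined X Q (x * z ^ K) (x' * z ^ K) := by
    intro x hx x' hx'
    obtain ⟨m, h1, h2⟩ := ((hD _ (hK x hx)).and (hD _ (hK x' hx'))).exists
    exact CayleyJoined.exists_finite (h1.trans (h2.symm hX))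
  choose! Q hQf hQpos hQj using hjoin
  refine ⟨z, hz, K, ⋃ x ∈ X, ⋃ x' ∈ X, Q x x', hK0, hz0, ?_, ?_, ?_⟩
  · exact hXf.biUnion fun x hx => hXf.biUnion fun x' hx' => hQf x hx x' hx'
  · intro q hq
    simp only [Set.mem_iUnion] at hq
    obtain ⟨x, hx, x', hx', hq⟩ := hq
    exact hQpos x hx x' hx' hq
  · intro x hx x' hx'
    refine (hQj x hx x' hx').mono fun q hq => ?_
    simp only [Set.mem_iUnion]
    exact ⟨x, hx, x', hx', hq⟩

end HalfSpace

/-! ### Connected level sets and Schreier generators -/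

section LevelSets

variable {G : Type*} [Group G] {X : Set G} {q : G → ℕ}

/-- Paths through a vertex `p` of the level set `{q ≤ q p}` can be pushed below `q p`. -/
def PushableAt (X : Set G) (q : G → ℕ) (p : G) : Prop :=
  ∀ x ∈ X, ∀ x' ∈ X, q (p * x) < q p → q (p * x') ≤ q p →
    ∃ r, q r < q p ∧ CayleyJoined X {g | q g < q p} (p * x) r ∧ r⁻¹ * (p * x') ∈ X

/-- Visits of the path to the top level `B + 1` are removed one after another, each by a local
detour. -/
theorem CayleyJoined.descend (hX : ∀ x ∈ X, x⁻¹ ∈ X) {B : ℕ}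
    (hB : ∀ p, q p = B + 1 → PushableAt X q p) {g h : G} (hg : q g ≤ B) (hh : q h ≤ B)
    (H : CayleyJoined X {k | q k ≤ B + 1} g h) : CayleyJoined X {k | q k ≤ B} g h := by
  -- The induction along the path must also handle an endpoint on the top level: it is then adjacent
  -- to a point `r` already reached from below.
  have key : (q h ≤ B → CayleyJoined X {k | q k ≤ B} g h) ∧ (q h = B + 1 →
      ∃ r, q r ≤ B ∧ CayleyJoined X {k | q k ≤ B} g r ∧ r⁻¹ * h ∈ X) := by
    clear hh
    induction H with
    | refl => exact ⟨fun _ => .refl g, fun h => by omega⟩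
    | @tail a b _ hab ih =>
      obtain ⟨ha, hb, hx⟩ := hab
      simp only [Set.mem_ofPred_eq] at ha hb
      by_cases haB : q a ≤ B
      · have hga := ih.1 haB
        exact ⟨fun hbB => hga.trans (Relation.ReflTransGen.single ⟨haB, hbB, hx⟩),
          fun _ => ⟨a, haB, hga, hx⟩⟩
      · have haB' : q a = B + 1 := by omega
        obtain ⟨r, hr, hgr, hra⟩ := ih.2 haB'
        have hlt : {k | q k < q a} = {k | q k ≤ B} := by
          ext k; simp only [Set.mem_ofPred_eq]; omega
        obtain ⟨r', hr', hj, hx'⟩ := hB a haB' (a⁻¹ * r) (by simpa using hX _ hra) (a⁻¹ * b) hx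
          (by rw [mul_inv_cancel_left]; omega) (by rw [mul_inv_cancel_left]; omega)
        rw [mul_inv_cancel_left] at hj hx'
        rw [hlt] at hj
        have hrB : q r' ≤ B := by omega
        exact ⟨fun hbB => (hgr.trans hj).trans (Relation.ReflTransGen.single ⟨hrB, hbB, hx'⟩),
          fun _ => ⟨r', hrB, hgr.trans hj, hx'⟩⟩
  exact key.1 hh

theorem joined_of_pushable (hX : ∀ x ∈ X, x⁻¹ ∈ X) (hgen : Subgroup.closure X = ⊤) {R : ℕ}
    (hR : ∀ p, R < q p → PushableAt X q p) {g h : G} (hg : q g ≤ R) (hh : q h ≤ R) :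
    CayleyJoined X {k | q k ≤ R} g h := by
  have h0 : ∃ B, CayleyJoined X {k | q k ≤ R + B} g h := by
    -- The zero character imposes no height condition, so this is just connectedness of the Cayley
    -- graph.
    have hall : CayleyJoined X Set.univ g h := by
      obtain ⟨D, hD⟩ := exists_joined_mul (χ := fun _ => (0 : ℝ)) (by simp) hX hgen (g⁻¹ * h)
      have := hD g
      rw [mul_inv_cancel_left] at this
      exact this.mono (Set.subset_univ _)
    obtain ⟨Q, hQ, -, hj⟩ := hall.exists_finite
    obtain ⟨B, hB⟩ := (hQ.image q).bddAbove
    exact ⟨B, hj.mono fun k hk => (hB (Set.mem_image_of_mem q hk)).trans (Nat.le_add_left _ _)⟩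
  obtain ⟨B, hB⟩ := h0
  induction B with
  | zero => exact hB
  | succ B ih =>
    refine ih (CayleyJoined.descend hX (fun p hp => hR p (by omega)) (by omega) (by omega) ?_)
    exact hB.mono fun k hk => hk

/-- Schreier's rewriting along a path from 1 to an element of the kernel only uses coset
representatives of the values of φ on the path, and those lie in the finite set `P ∩ φ.range`. -/
theorem Subgroup.fg_of_joined {A : Type*} [Group A] (φ : G →* A) (hXf : X.Finite) (P : Set A)
    (hP : (P ∩ φ.range).Finite)
    (hj : ∀ g ∈ φ.ker, CayleyJoined X (φ ⁻¹' P) 1 g) : φ.ker.FG := by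
  have ht : ∀ a : A, ∃ t : G, a ∈ φ.range → φ t = a := by
    intro a
    by_cases ha : a ∈ φ.range
    · obtain ⟨t, ht⟩ := ha
      exact ⟨t, fun _ => ht⟩
    · exact ⟨1, fun h => absurd h ha⟩
  choose t ht using ht
  have ht' : ∀ g, φ (t (φ g)) = φ g := fun g => ht _ ⟨g, rfl⟩
  -- The chosen representative `t 1` need not be the identity, so it is added as a generator.
  let Y : Set G := insert (t 1)
    (Set.image2 (fun a x => t a * x * (t (a * φ x))⁻¹) (P ∩ φ.range) X)
  have hYf : Y.Finite := (hP.image2 _ hXf).insert _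
  refine (Subgroup.fg_iff _).2 ⟨Y, le_antisymm ?_ ?_, hYf⟩
  · rw [Subgroup.closure_le]
    rintro y (rfl | ⟨a, ⟨-, g, rfl⟩, x, -, rfl⟩)
    · have := ht' 1
      rw [map_one] at this
      exact this
    · simp only [SetLike.mem_coe, MonoidHom.mem_ker, map_mul, map_inv, ht']
      rw [← map_mul, ht', mul_inv_cancel]
  · intro g hg
    have key : ∀ g, CayleyJoined X (φ ⁻¹' P) 1 g →
        g * (t (φ g))⁻¹ ∈ Subgroup.closure Y := by
      intro g hg
      induction hg with
      | refl =>
        rw [map_one, one_mul]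
        exact inv_mem (Subgroup.subset_closure (Set.mem_insert _ _))
      | @tail a b _ hab ih =>
        obtain ⟨ha, -, hx⟩ := hab
        have hy : t (φ a) * (a⁻¹ * b) * (t (φ a * φ (a⁻¹ * b)))⁻¹ ∈ Subgroup.closure Y :=
          Subgroup.subset_closure (Set.mem_insert_of_mem _
            ⟨φ a, ⟨ha, a, rfl⟩, a⁻¹ * b, hx, rfl⟩)
        have := mul_mem ih hy
        rw [← map_mul, mul_inv_cancel_left] at this
        convert this using 1
        group
    have h2 := key g (hj g hg)
    rw [MonoidHom.mem_ker.1 hg] at h2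
    have h3 := mul_mem h2 (Subgroup.subset_closure (Set.mem_insert (t 1) _) :
      t 1 ∈ Subgroup.closure Y)
    rwa [inv_mul_cancel_right] at h3

end LevelSets

/-! ### Pushing towards the origin, uniformly over directions -/

section Euclidean

open scoped RealInnerProductSpace

variable {G E : Type*} [Group G] [NormedAddCommGroup E] [InnerProductSpace ℝ E]
  {X : Set G} {φ : G → E} {q : G → ℕ}

/-- Expand ‖φ p + φ w‖²: the cross term is less than −2‖φ p‖ε, which outweighs ‖φ w‖² ≤ C² once ‖φ
p‖ is large. -/
theorem lt_of_inner_direction (hφ : ∀ a b, φ (a * b) = φ a + φ b)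
    (hq : ∀ g, (q g : ℝ) = ‖φ g‖ ^ 2) {p w : G} {ε C : ℝ} (hp : 0 < ‖φ p‖)
    (hw : ε < ⟪-(‖φ p‖⁻¹ • φ p), φ w⟫) (hC : ‖φ w‖ ≤ C) (hpC : C ^ 2 ≤ 2 * ‖φ p‖ * ε) :
    q (p * w) < q p := by
  have h1 : (q (p * w) : ℝ) < q p := by
    rw [hq, hq, hφ, norm_add_sq_real]
    rw [inner_neg_left, real_inner_smul_left] at hw
    have h2 : ⟪φ p, φ w⟫ < -(‖φ p‖ * ε) := by
      have := mul_lt_mul_of_pos_left hw hp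
      rw [mul_neg, mul_inv_cancel_left₀ hp.ne'] at this
      linarith
    have h3 : ‖φ w‖ ^ 2 ≤ C ^ 2 := by gcongr
    linarith
  exact_mod_cast h1

theorem inner_direction_nonneg (hφ : ∀ a b, φ (a * b) = φ a + φ b)
    (hq : ∀ g, (q g : ℝ) = ‖φ g‖ ^ 2) {p x : G} (hx : q (p * x) ≤ q p) :
    0 ≤ ⟪-(‖φ p‖⁻¹ • φ p), φ x⟫ := by
  have h1 : (q (p * x) : ℝ) ≤ q p := by exact_mod_cast hx
  rw [hq, hq, hφ, norm_add_sq_real] at h1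
  rw [inner_neg_left, real_inner_smul_left]
  have : ⟪φ p, φ x⟫ ≤ 0 := by nlinarith [sq_nonneg ‖φ x‖]
  exact neg_nonneg.2 (mul_nonpos_of_nonneg_of_nonpos (inv_nonneg.2 (norm_nonneg _)) this)

/-- The finite data found for the character ⟪y, φ ·⟫ also work for every direction close to `y`. If
`p` is far out and the direction from φ p to the origin is close to `y`, multiplying by the elements
of the data lowers the norm. -/
theorem exists_pushable_nhds (hφ : ∀ a b, φ (a * b) = φ a + φ b)
    (hq : ∀ g, (q g : ℝ) = ‖φ g‖ ^ 2) (hXf : X.Finite)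
    (hX : ∀ x ∈ X, x⁻¹ ∈ X) (hgen : Subgroup.closure X = ⊤) (y : E) {b : G} (hb : ⟪y, φ b⟫ ≠ 0)
    (H : ∀ g, Relation.ReflTransGen (CommutesOffKer fun g => ⟪y, φ g⟫) b (g * b * g⁻¹)) :
    ∃ t ∈ nhds y, ∃ R : ℕ, ∀ p, R < q p → -(‖φ p‖⁻¹ • φ p) ∈ t → PushableAt X q p := by
  obtain ⟨z, hz, K, Q, hK, hz0, hQf, hQpos, hQj⟩ := exists_pushing_data
    (χ := fun g => ⟪y, φ g⟫) (by intro a b; simp only [hφ, inner_add_right]) hXf hX hgen hb H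
  -- `W` collects all the group elements used to push a path
  let W : Set G := Q ∪ Set.image2 (fun x j => x * z ^ j) X (Set.Iic K)
  have hWf : W.Finite := hQf.union (hXf.image2 _ (Set.finite_Iic K))
  -- A common margin for finitely many strict inequalities; it defines the neighbourhood of `y`.
  obtain ⟨ε, hε, hεQ⟩ : ∃ ε > 0, ∀ g ∈ insert z Q, ε < ⟪y, φ g⟫ := by
    have hev : ∀ᶠ ε : ℝ in nhdsWithin 0 (Set.Ioi 0), ∀ g ∈ insert z Q, ε < ⟪y, φ g⟫ := by
      rw [Filter.eventually_all_finite (hQf.insert z)]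
      rintro g hg
      have : 0 < ⟪y, φ g⟫ := by
        rcases hg with rfl | hg
        exacts [hz0, hQpos g hg]
      exact nhdsWithin_le_nhds (eventually_lt_nhds this)
    obtain ⟨ε, h1, h2⟩ := (hev.and self_mem_nhdsWithin).exists
    exact ⟨ε, h2, h1⟩
  obtain ⟨C, hC⟩ := (hWf.image fun g => ‖φ g‖).bddAbove
  have hCW : ∀ w ∈ W, ‖φ w‖ ≤ C := fun w hw => hC (Set.mem_image_of_mem _ hw)
  obtain ⟨S, hS⟩ := exists_nat_gt (C ^ 2 / (2 * ε))
  refine ⟨{y' | ∀ g ∈ insert z Q, ε < ⟪y', φ g⟫}, ?_, S ^ 2, ?_⟩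
  · refine (Filter.eventually_all_finite (hQf.insert z)).2 fun g hg => ?_
    exact (continuous_id.inner continuous_const).continuousAt.eventually_const_lt (hεQ g hg)
  intro p hp hdir x hx x' hx' hlt hle
  have hnp : (S : ℝ) < ‖φ p‖ := by
    have h1 : ((S ^ 2 : ℕ) : ℝ) < q p := by exact_mod_cast hp
    rw [hq] at h1
    push_cast at h1
    exact lt_of_pow_lt_pow_left₀ 2 (norm_nonneg _) h1
  have hp0 : 0 < ‖φ p‖ := lt_of_le_of_lt (Nat.cast_nonneg S) hnp
  have hpC : C ^ 2 ≤ 2 * ‖φ p‖ * ε := by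
    have : C ^ 2 / (2 * ε) ≤ ‖φ p‖ := (hS.trans hnp).le
    rw [div_le_iff₀ (by positivity)] at this
    linarith
  have hpow : ∀ (v : G) (j : ℕ), φ (v * z ^ j) = φ v + (j : ℝ) • φ z := by
    intro v j
    induction j with
    | zero => simp
    | succ j ih => rw [pow_succ, ← mul_assoc, hφ, ih]; push_cast; module
  have hpos : ∀ v ∈ X, q (p * v) ≤ q p → ∀ j, 0 < j → j ≤ K → q (p * (v * z ^ j)) < q p := by
    intro v hv hvp j hj hjK
    have hvz : v * z ^ j ∈ W := Or.inr ⟨v, hv, j, hjK, rfl⟩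
    refine lt_of_inner_direction hφ hq hp0 ?_ (hCW _ hvz) hpC
    rw [hpow, inner_add_right, real_inner_smul_right]
    have h1 := inner_direction_nonneg hφ hq hvp
    have h2 := hdir z (Set.mem_insert _ _)
    have h3 : (1 : ℝ) ≤ j := by exact_mod_cast hj
    nlinarith
  have hup : ∀ v ∈ X, q (p * v) ≤ q p → ∀ i, ∀ j, i ≤ j → j ≤ K → q (p * (v * z ^ i)) < q p →
      CayleyJoined X {g | q g < q p} (p * (v * z ^ i)) (p * (v * z ^ j)) := by
    intro v hv hvp i j hij
    induction j, hij using Nat.le_induction with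
    | base => exact fun _ _ => .refl _
    | succ j hij ih =>
      intro hjK hi
      refine (ih (by omega) hi).trans (Relation.ReflTransGen.single ⟨?_, ?_, ?_⟩)
      · rcases hij.eq_or_lt with rfl | hlt
        · exact hi
        · exact hpos v hv hvp j (by omega) (by omega)
      · exact hpos v hv hvp (j + 1) (by omega) hjK
      · rw [pow_succ]
        convert hz using 1
        group
  -- The point `p * x'` itself may be at the height of `p`, but its neighbour `p * x' * z` is
  -- strictly lower. The detour climbs by powers of `z`, crosses inside `Q`, and comes back to this
  -- neighbour.
  refine ⟨p * (x' * z ^ 1), hpos x' hx' hle 1 one_pos hK, ?_, ?_⟩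
  · have h1 := hup x hx hlt.le 0 K (Nat.zero_le _) le_rfl (by simpa using hlt)
    rw [pow_zero, mul_one] at h1
    have h2 := hup x' hx' hle 1 K hK le_rfl (hpos x' hx' hle 1 one_pos hK)
    refine (h1.trans ((hQj x hx x' hx').translate p fun g hg => ?_)).trans (h2.symm hX)
    exact lt_of_inner_direction hφ hq hp0 (hdir g (Set.mem_insert_of_mem _ hg))
      (hCW g (Or.inl hg)) hpC
  · convert hX z hz using 1
    group

/-- Finitely many of the neighbourhoods above cover the unit sphere, and the largest of their radii
serves all directions. -/
theorem exists_forall_pushable [FiniteDimensional ℝ E] (hφ : ∀ a b, φ (a * b) = φ a + φ b)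
    (hq : ∀ g, (q g : ℝ) = ‖φ g‖ ^ 2) (hXf : X.Finite)
    (hX : ∀ x ∈ X, x⁻¹ ∈ X) (hgen : Subgroup.closure X = ⊤)
    (H : ∀ y : E, y ≠ 0 → ∃ b, ⟪y, φ b⟫ ≠ 0 ∧
      ∀ g, Relation.ReflTransGen (CommutesOffKer fun g => ⟪y, φ g⟫) b (g * b * g⁻¹)) :
    ∃ R : ℕ, ∀ p, R < q p → PushableAt X q p := by
  have hcomp : IsCompact (Metric.sphere (0 : E) 1) :=
    have := FiniteDimensional.proper ℝ E
    isCompact_sphere 0 1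
  have key : ∃ R : ℕ, ∀ p, R < q p →
      -(‖φ p‖⁻¹ • φ p) ∈ Metric.sphere (0 : E) 1 → PushableAt X q p := by
    refine hcomp.induction_on (p := fun t => ∃ R : ℕ, ∀ p, R < q p →
      -(‖φ p‖⁻¹ • φ p) ∈ t → PushableAt X q p) ⟨0, by simp⟩ ?_ ?_ ?_
    · rintro s t hst ⟨R, hR⟩
      exact ⟨R, fun p hp hps => hR p hp (hst hps)⟩
    · rintro s t ⟨R, hR⟩ ⟨R', hR'⟩
      refine ⟨max R R', fun p hp hps => ?_⟩
      rcases hps with h | h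
      · exact hR p (lt_of_le_of_lt (le_max_left _ _) hp) h
      · exact hR' p (lt_of_le_of_lt (le_max_right _ _) hp) h
    · intro y hy
      have hy0 : y ≠ 0 := by
        rintro rfl; simp at hy
      obtain ⟨b, hb, hH⟩ := H y hy0
      obtain ⟨t, ht, R, hR⟩ := exists_pushable_nhds hφ hq hXf hX hgen y hb hH
      exact ⟨t, mem_nhdsWithin_of_mem_nhds ht, R, hR⟩
  obtain ⟨R, hR⟩ := key
  refine ⟨R, fun p hp => hR p hp ?_⟩
  have hp0 : ‖φ p‖ ≠ 0 := by
    intro h0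
    have := hq p
    rw [h0] at this
    have h1 : q p = 0 := by
      rw [zero_pow two_ne_zero] at this
      exact_mod_cast this
    omega
  rw [mem_sphere_zero_iff_norm, norm_neg, norm_smul, norm_inv, norm_norm, inv_mul_cancel₀ hp0]

end Euclidean

/-! ### The finite generation criterion -/

/-- The quotient by `N` is ℤ^J times a finite group. The geometric argument handles the kernel of
the map `φ₀` to ℤ^J, in which `N` has finite index. -/
theorem Subgroup.fg_of_commuting_chains {G : Type*} [Group G] [Group.FG G] (N : Subgroup G)
    [N.Normal] (hN : _root_.commutator G ≤ N)
    (H : ∀ χ : G → ℝ, (∀ a b, χ (a * b) = χ a + χ b) → (∀ n ∈ N, χ n = 0) → (∃ g, χ g ≠ 0) →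
      ∃ b, χ b ≠ 0 ∧ ∀ g, Relation.ReflTransGen (CommutesOffKer χ) b (g * b * g⁻¹)) :
    N.FG := by
  classical
  let : CommGroup (G ⧸ N) :=
    { (inferInstance : Group (G ⧸ N)) with
      mul_comm := ((Subgroup.Normal.quotient_commutative_iff_commutator_le).2 hN).is_comm.comm }
  obtain ⟨ι, J, _, _, p, hp, e, ⟨f⟩⟩ := CommGroup.equiv_free_prod_prod_multiplicative_zmod (G ⧸ N)
  have hne : ∀ i, NeZero (p i ^ e i) := fun i => ⟨pow_ne_zero _ (hp i).ne_zero⟩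
  have hfin : Finite ((i : ι) → Multiplicative (ZMod (p i ^ e i))) :=
    have : ∀ i, Finite (Multiplicative (ZMod (p i ^ e i))) := fun i =>
      inferInstanceAs (Finite (ZMod (p i ^ e i)))
    inferInstance
  let ψ : G →* (J → Multiplicative ℤ) × ((i : ι) → Multiplicative (ZMod (p i ^ e i))) :=
    f.toMonoidHom.comp (QuotientGroup.mk' N)
  have hψN : ψ.ker = N := by
    ext g
    rw [MonoidHom.mem_ker, ← QuotientGroup.eq_one_iff (N := N)]
    exact map_eq_one_iff f f.injective
  let φ₀ : G →* (J → Multiplicative ℤ) := (MonoidHom.fst _ _).comp ψ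
  let φ₁ : φ₀.ker →* ((i : ι) → Multiplicative (ZMod (p i ^ e i))) :=
    ((MonoidHom.snd _ _).comp ψ).comp φ₀.ker.subtype
  have hφ₁ : N.subgroupOf φ₀.ker = φ₁.ker := by
    ext ⟨g, hg⟩
    rw [Subgroup.mem_subgroupOf, ← hψN, MonoidHom.mem_ker, MonoidHom.mem_ker, Prod.ext_iff]
    exact ⟨fun h => h.2, fun h => ⟨hg, h⟩⟩
  have hle : N ≤ φ₀.ker := by
    rw [← hψN]
    intro g hg
    rw [MonoidHom.mem_ker] at hg ⊢
    exact congrArg Prod.fst hg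
  -- it suffices to show that the kernel of the map to the free part is finitely generated
  suffices hker : φ₀.ker.FG by
    have : Group.FG φ₀.ker := (Group.fg_iff_subgroup_fg _).2 hker
    have : Group.FG (N.subgroupOf φ₀.ker) := by
      rw [hφ₁]; infer_instance
    rw [← Subgroup.map_subgroupOf_eq_of_le hle, ← Group.fg_iff_subgroup_fg]
    exact Group.fg_of_surjective (φ₀.ker.subtype.subgroupMap_surjective (N.subgroupOf φ₀.ker))
  let φ : G → EuclideanSpace ℝ J := fun g => WithLp.toLp 2 fun j => ((φ₀ g j).toAdd : ℝ)
  have hφ : ∀ a b, φ (a * b) = φ a + φ b := by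
    intro a b
    ext j
    simp [φ]
  -- The squared norm is integer valued on lattice points, which permits induction on the level.
  let q : G → ℕ := fun g => ∑ j, (φ₀ g j).toAdd.natAbs ^ 2
  have hq : ∀ g, (q g : ℝ) = ‖φ g‖ ^ 2 := by
    intro g
    rw [EuclideanSpace.norm_sq_eq]
    simp only [q, φ, Real.norm_eq_abs, sq_abs]
    push_cast
    refine Finset.sum_congr rfl fun j _ => ?_
    rw [Nat.cast_natAbs, Int.cast_abs, sq_abs]
  obtain ⟨S, hS, hSf⟩ := Group.fg_iff.1 (inferInstance : Group.FG G)
  let X : Set G := S ∪ S⁻¹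
  have hXf : X.Finite := hSf.union hSf.inv
  have hX : ∀ x ∈ X, x⁻¹ ∈ X := by
    rintro x (hx | hx)
    · exact Or.inr (by simpa using hx)
    · exact Or.inl hx
  have hgen : Subgroup.closure X = ⊤ :=
    top_le_iff.1 (hS ▸ Subgroup.closure_mono Set.subset_union_left)
  obtain ⟨R, hR⟩ := exists_forall_pushable hφ hq hXf hX hgen (by
    intro y hy
    refine H _ (by intro a b; simp only [hφ, inner_add_right]) ?_ ?_
    · intro n hn
      have h0 : φ₀ n = 1 := hle hn
      have : φ n = 0 := by
        ext j; simp [φ, h0]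
      rw [this, inner_zero_right]
    · by_contra! hcon
      apply hy
      ext j
      -- Every basis vector is a value of φ, so ⟪y, φ ·⟫ = 0 would force `y = 0`.
      obtain ⟨x, hx⟩ := f.surjective (Pi.mulSingle j (Multiplicative.ofAdd (1 : ℤ)), 1)
      obtain ⟨g, rfl⟩ := QuotientGroup.mk_surjective x
      have h0 : φ₀ g = Pi.mulSingle j (Multiplicative.ofAdd (1 : ℤ)) := congrArg Prod.fst hx
      have h1 : φ g = EuclideanSpace.single j 1 := by
        ext i
        by_cases hij : i = j
        · subst hij; simp [φ, h0]
        · simp [φ, h0, hij]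
      have := hcon g
      rw [h1, EuclideanSpace.inner_single_right] at this
      simpa using this)
  refine Subgroup.fg_of_joined (X := X) φ₀ hXf {a | ∑ j, (a j).toAdd.natAbs ^ 2 ≤ R} ?_ ?_
  · refine Set.Finite.subset ?_ Set.inter_subset_left
    have hbox : (Set.univ.pi fun _ : J => Set.Icc (-(R : ℤ)) R).Finite :=
      Set.Finite.pi fun _ => Set.finite_Icc _ _
    refine (hbox.image fun (v : J → ℤ) j => Multiplicative.ofAdd (v j)).subset ?_
    intro a ha
    refine ⟨fun j => (a j).toAdd, ?_, rfl⟩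
    intro j _
    have h1 : (a j).toAdd.natAbs ^ 2 ≤ R :=
      (Finset.single_le_sum (f := fun j => (a j).toAdd.natAbs ^ 2) (fun _ _ => Nat.zero_le _)
        (Finset.mem_univ j)).trans ha
    have h2 : (a j).toAdd.natAbs ≤ R := (Nat.le_self_pow two_ne_zero _).trans h1
    rw [Set.mem_Icc, ← abs_le, Int.abs_eq_natAbs]
    exact Nat.cast_le.2 h2
  · intro g hg
    have h0 : φ₀ g = 1 := hg
    exact joined_of_pushable (q := q) hX hgen hR (by simp [q]) (by simp [q, h0])

/-! ### Discrete antiderivatives of polynomials -/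

open Polynomial in
theorem Polynomial.exists_discrete_antiderivative (p : ℝ[X]) :
    ∃ P : ℝ[X], P.eval 0 = 0 ∧ ∀ t : ℤ, P.eval ((t : ℝ) + 1) = P.eval (t : ℝ) + p.eval (t : ℝ) := by
  suffices h : ∃ P : ℝ[X], ∀ t : ℤ, P.eval ((t : ℝ) + 1) = P.eval (t : ℝ) + p.eval (t : ℝ) by
    obtain ⟨P, hP⟩ := h
    exact ⟨P - C (P.eval 0), by simp, fun t => by simp only [eval_sub, eval_C, hP]; ring⟩
  induction p using Polynomial.induction_on' with
  | add p q hp hq =>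
    obtain ⟨P, hP⟩ := hp
    obtain ⟨Q, hQ⟩ := hq
    exact ⟨P + Q, fun t => by simp only [eval_add, hP, hQ]; ring⟩
  | monomial n a =>
    -- Bernoulli polynomials satisfy B_{n+1}(t+1) − B_{n+1}(t) = (n+1)tⁿ.
    refine ⟨C (a / (n + 1)) * (Polynomial.bernoulli (n + 1)).map (algebraMap ℚ ℝ), fun t => ?_⟩
    have h := Polynomial.bernoulli_eval_one_add (n + 1) (t : ℚ)
    have h1 : ((Polynomial.bernoulli (n + 1)).map (algebraMap ℚ ℝ)).eval ((t : ℝ) + 1) =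
        (((Polynomial.bernoulli (n + 1)).eval (1 + (t : ℚ)) : ℚ) : ℝ) := by
      rw [show (t : ℝ) + 1 = algebraMap ℚ ℝ (1 + (t : ℚ)) by simp [add_comm],
        Polynomial.eval_map_apply]
      rfl
    have h2 : ((Polynomial.bernoulli (n + 1)).map (algebraMap ℚ ℝ)).eval (t : ℝ) =
        (((Polynomial.bernoulli (n + 1)).eval (t : ℚ) : ℚ) : ℝ) := by
      rw [show (t : ℝ) = algebraMap ℚ ℝ (t : ℚ) by simp, Polynomial.eval_map_apply]
      rfl
    rw [eval_mul, eval_mul, eval_C, h1, h2, h, eval_monomial]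
    push_cast
    have : (n : ℝ) + 1 ≠ 0 := by positivity
    rw [eval_C]
    field_simp

/-! ### Characters of lower central series terms and polynomial curves -/

section LcsCharacters

open scoped commutatorElement

variable {Γ : Type*} [Group Γ] {M : Subgroup Γ} {k : ℕ} {χ : Γ → ℝ}

/-- `χ` restricts to a real character of the `k`-th term of the lower central series of `M`
(indexed from `0`) that vanishes on the next term. -/
structure IsLcsCharacter (M : Subgroup Γ) (k : ℕ) (χ : Γ → ℝ) : Prop where
  map_mul : ∀ x ∈ M.lowerCentralSeries k, ∀ y ∈ M.lowerCentralSeries k, χ (x * y) = χ x + χ y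
  map_eq_zero : ∀ x ∈ M.lowerCentralSeries (k + 1), χ x = 0

namespace IsLcsCharacter

theorem map_one (h : IsLcsCharacter M k χ) : χ 1 = 0 := h.map_eq_zero 1 (one_mem _)

theorem map_inv (h : IsLcsCharacter M k χ) {x : Γ} (hx : x ∈ M.lowerCentralSeries k) :
    χ x⁻¹ = -χ x := by
  have := h.map_mul x hx x⁻¹ (inv_mem hx)
  rw [mul_inv_cancel, h.map_one] at this
  linarith

/-- Conjugation by `M` changes `x` by a commutator lying in the next term, where χ vanishes. -/
theorem map_conj [M.Normal] (h : IsLcsCharacter M k χ) {x g : Γ}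
    (hx : x ∈ M.lowerCentralSeries k) (hg : g ∈ M) : χ (g * x * g⁻¹) = χ x := by
  have hc : ⁅g, x⁆ ∈ M.lowerCentralSeries (k + 1) := by
    rw [Subgroup.lowerCentralSeries_succ, Subgroup.commutator_comm]
    exact Subgroup.commutator_mem_commutator hg hx
  have e : g * x * g⁻¹ = ⁅g, x⁆ * x := by rw [commutatorElement_def]; group
  rw [e, h.map_mul _ (M.lowerCentralSeries_antitone (Nat.le_succ k) hc) x hx, h.map_eq_zero _ hc,
    zero_add]

theorem comp_conj [M.Normal] (h : IsLcsCharacter M k χ) (g : Γ) :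
    IsLcsCharacter M k fun x => χ (g * x * g⁻¹) where
  map_mul x hx y hy := by
    rw [← h.map_mul _ (Subgroup.Normal.conj_mem inferInstance x hx g) _
      (Subgroup.Normal.conj_mem inferInstance y hy g)]
    congr 1
    group
  map_eq_zero x hx := h.map_eq_zero _ (Subgroup.Normal.conj_mem inferInstance x hx g)

/-- With `commutator_right`, this says that χ turns the commutator into a bilinear pairing between
the `k`-th term and `M`: the conjugations in the commutator identities are invisible to χ. -/
theorem commutator_left [M.Normal] (h : IsLcsCharacter M (k + 1) χ) {m : Γ} (hm : m ∈ M) :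
    IsLcsCharacter M k fun x => χ ⁅x, m⁆ where
  map_mul x hx y hy := by
    have hxm : ⁅x, m⁆ ∈ M.lowerCentralSeries (k + 1) := Subgroup.commutator_mem_commutator hx hm
    have hym : ⁅y, m⁆ ∈ M.lowerCentralSeries (k + 1) := Subgroup.commutator_mem_commutator hy hm
    have e : ⁅x * y, m⁆ = (x * ⁅y, m⁆ * x⁻¹) * ⁅x, m⁆ := by
      simp only [commutatorElement_def]; group
    rw [e, h.map_mul _ (Subgroup.Normal.conj_mem inferInstance _ hym x) _ hxm,
      h.map_conj hym (M.lowerCentralSeries_le_self k hx), add_comm]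
  map_eq_zero x hx := h.map_eq_zero _ (Subgroup.commutator_mem_commutator hx hm)

theorem commutator_right [M.Normal] (h : IsLcsCharacter M (k + 1) χ) {x : Γ}
    (hx : x ∈ M.lowerCentralSeries k) : IsLcsCharacter M 0 fun m => χ ⁅x, m⁆ := by
  have hmul : ∀ m ∈ M, ∀ m' ∈ M, χ ⁅x, m * m'⁆ = χ ⁅x, m⁆ + χ ⁅x, m'⁆ := by
    intro m hm m' hm'
    have h1 : ⁅x, m⁆ ∈ M.lowerCentralSeries (k + 1) := Subgroup.commutator_mem_commutator hx hm
    have h2 : ⁅x, m'⁆ ∈ M.lowerCentralSeries (k + 1) := Subgroup.commutator_mem_commutator hx hm'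
    have e : ⁅x, m * m'⁆ = ⁅x, m⁆ * (m * ⁅x, m'⁆ * m⁻¹) := by
      simp only [commutatorElement_def]; group
    rw [e, h.map_mul _ h1 _ (Subgroup.Normal.conj_mem inferInstance _ h2 m), h.map_conj h2 hm]
  have hone : χ ⁅x, 1⁆ = 0 := by rw [commutatorElement_one_right, h.map_one]
  have hinv : ∀ m ∈ M, χ ⁅x, m⁻¹⁆ = -χ ⁅x, m⁆ := by
    intro m hm
    have := hmul m hm m⁻¹ (inv_mem hm)
    rw [mul_inv_cancel, hone] at this
    linarith
  refine ⟨hmul, fun y hy => ?_⟩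
  rw [Subgroup.lowerCentralSeries_succ, Subgroup.lowerCentralSeries_zero] at hy
  have hle : ⁅M, M⁆ ≤ M := Subgroup.commutator_le_left M M
  rw [Subgroup.commutator_def] at hy hle
  induction hy using Subgroup.closure_induction with
  | mem y hy =>
    obtain ⟨a, ha, b, hb, rfl⟩ := hy
    rw [commutatorElement_def a b, hmul _ (mul_mem (mul_mem ha hb) (inv_mem ha)) _ (inv_mem hb),
      hmul _ (mul_mem ha hb) _ (inv_mem ha), hmul _ ha _ hb, hinv a ha, hinv b hb]
    ring
  | one => exact hone
  | mul y z hy hz ihy ihz => rw [hmul _ (hle hy) _ (hle hz), ihy, ihz, add_zero]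
  | inv y hy ih => rw [hinv _ (hle hy), ih, neg_zero]

theorem eq_zero_of_closure (h : IsLcsCharacter M k χ) {S : Set Γ}
    (hS : Subgroup.closure S = M.lowerCentralSeries k) (h0 : ∀ s ∈ S, χ s = 0) :
    ∀ x ∈ M.lowerCentralSeries k, χ x = 0 := by
  intro x hx
  rw [← hS] at hx
  induction hx using Subgroup.closure_induction with
  | mem x hx => exact h0 x hx
  | one => exact h.map_one
  | mul y z hy hz ihy ihz => rw [h.map_mul _ (hS ▸ hy) _ (hS ▸ hz), ihy, ihz, add_zero]
  | inv y hy ih => rw [h.map_inv (hS ▸ hy), ih, neg_zero]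

end IsLcsCharacter

/-- The set of `(k + 1)`-fold left-normed commutators of elements of `S`. -/
def iteratedCommutators (S : Set Γ) : ℕ → Set Γ
  | 0 => S
  | k + 1 => {x | ∃ c ∈ iteratedCommutators S k, ∃ s ∈ S, ⁅c, s⁆ = x}

theorem iteratedCommutators_subset {S : Set Γ} (hS : S ⊆ M) (k : ℕ) :
    iteratedCommutators S k ⊆ M.lowerCentralSeries k := by
  induction k with
  | zero => exact hS
  | succ k ih =>
    rintro x ⟨c, hc, s, hs, rfl⟩
    exact Subgroup.commutator_mem_commutator (ih hc) (hS hs)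

/-- By bilinearity one entry at a time is reduced to generators: first the last entry, through the
character χ⁅x, ·⁆ of `M`, then the others by induction applied to χ⁅·, s⁆. -/
theorem IsLcsCharacter.eq_zero_of_iteratedCommutators [M.Normal] {S : Set Γ}
    (hS : Subgroup.closure S = M) (h : IsLcsCharacter M k χ)
    (h0 : ∀ c ∈ iteratedCommutators S k, χ c = 0) : ∀ x ∈ M.lowerCentralSeries k, χ x = 0 := by
  induction k generalizing χ with
  | zero => exact h.eq_zero_of_closure hS h0
  | succ k ih =>
    refine h.eq_zero_of_closure (Subgroup.commutator_def _ _).symm ?_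
    rintro _ ⟨x, hx, m, hm, rfl⟩
    refine (h.commutator_right hx).eq_zero_of_closure hS (fun s hs => ?_) m hm
    have hsM : s ∈ M := hS ▸ Subgroup.subset_closure hs
    exact ih (h.commutator_left hsM) (fun c hc => h0 _ ⟨c, hc, s, hs, rfl⟩) x hx

open Polynomial in
/-- A curve in the `k`-th term of the lower central series of `M` whose composition with every
character of that term is polynomial. -/
def IsPolyCurve (M : Subgroup Γ) (k : ℕ) (x : ℤ → Γ) : Prop :=
  (∀ t, x t ∈ M.lowerCentralSeries k) ∧
    ∃ (J : Type) (_ : Fintype J) (a : J → Γ) (p : J → ℝ[X]),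
      (∀ j, a j ∈ M.lowerCentralSeries k) ∧
        ∀ χ, IsLcsCharacter M k χ → ∀ t, χ (x t) = ∑ j, (p j).eval (t : ℝ) * χ (a j)

namespace IsPolyCurve

variable {x y : ℤ → Γ}

theorem const {a : Γ} (ha : a ∈ M.lowerCentralSeries k) : IsPolyCurve M k fun _ => a :=
  ⟨fun _ => ha, Unit, inferInstance, fun _ => a, fun _ => 1, fun _ => ha, by simp⟩

theorem congr (hx : IsPolyCurve M k x) (hy : ∀ t, y t ∈ M.lowerCentralSeries k)
    (h : ∀ χ, IsLcsCharacter M k χ → ∀ t, χ (y t) = χ (x t)) : IsPolyCurve M k y := by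
  obtain ⟨-, J, _, a, p, ha, hp⟩ := hx
  exact ⟨hy, J, inferInstance, a, p, ha, fun χ hχ t => (h χ hχ t).trans (hp χ hχ t)⟩

theorem mul (hx : IsPolyCurve M k x) (hy : IsPolyCurve M k y) :
    IsPolyCurve M k fun t => x t * y t := by
  obtain ⟨hx, J, _, a, p, ha, hp⟩ := hx
  obtain ⟨hy, J', _, b, q, hb, hq⟩ := hy
  refine ⟨fun t => mul_mem (hx t) (hy t), J ⊕ J', inferInstance, Sum.elim a b, Sum.elim p q,
    ?_, fun χ hχ t => ?_⟩
  · rintro (j | j)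
    exacts [ha j, hb j]
  · rw [hχ.map_mul _ (hx t) _ (hy t), hp χ hχ, hq χ hχ, Fintype.sum_sum_type]
    rfl

theorem inv (hx : IsPolyCurve M k x) : IsPolyCurve M k fun t => (x t)⁻¹ := by
  obtain ⟨hx, J, _, a, p, ha, hp⟩ := hx
  refine ⟨fun t => inv_mem (hx t), J, inferInstance, a, fun j => -p j, ha, fun χ hχ t => ?_⟩
  rw [hχ.map_inv (hx t), hp χ hχ]
  simp

/-- Bilinearity expands χ⁅x t, y t⁆ into products of the two families of polynomials. -/
theorem commutator [M.Normal] (hx : IsPolyCurve M k x) (hy : IsPolyCurve M 0 y) :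
    IsPolyCurve M (k + 1) fun t => ⁅x t, y t⁆ := by
  obtain ⟨hx, J, _, a, p, ha, hp⟩ := hx
  obtain ⟨hy, J', _, b, q, hb, hq⟩ := hy
  refine ⟨fun t => Subgroup.commutator_mem_commutator (hx t) (hy t), J × J', inferInstance,
    fun j => ⁅a j.1, b j.2⁆, fun j => p j.1 * q j.2,
    fun j => Subgroup.commutator_mem_commutator (ha _) (hb _), fun χ hχ t => ?_⟩
  rw [hp _ (hχ.commutator_left (hy t)), Fintype.sum_prod_type]
  refine Finset.sum_congr rfl fun j _ => ?_
  rw [hq _ (hχ.commutator_right (ha j)), Finset.mul_sum]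
  refine Finset.sum_congr rfl fun j' _ => ?_
  rw [Polynomial.eval_mul, mul_assoc]

/-- Summing a polynomial over consecutive integers gives a polynomial; the extra index of `Option J`
carries the initial value `x 0`. -/
theorem of_difference (hx : ∀ t, x t ∈ M.lowerCentralSeries k) (hy : IsPolyCurve M k y)
    (h : ∀ χ, IsLcsCharacter M k χ → ∀ t, χ (x (t + 1)) = χ (x t) + χ (y t)) :
    IsPolyCurve M k x := by
  obtain ⟨hy, J, _, a, p, ha, hp⟩ := hy
  choose P hP0 hP using fun j => Polynomial.exists_discrete_antiderivative (p j)
  refine ⟨hx, Option J, inferInstance, fun j => j.elim (x 0) a, fun j => j.elim 1 P, ?_, ?_⟩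
  · rintro (_ | j)
    exacts [hx 0, ha j]
  · intro χ hχ t
    simp only [Fintype.sum_option, Option.elim, Polynomial.eval_one, one_mul]
    have step : ∀ t : ℤ, ∑ j, (P j).eval ((t + 1 : ℤ) : ℝ) * χ (a j) =
        ∑ j, (P j).eval (t : ℝ) * χ (a j) + χ (y t) := by
      intro t
      rw [hp χ hχ, ← Finset.sum_add_distrib]
      refine Finset.sum_congr rfl fun j _ => ?_
      push_cast
      rw [hP]
      ring
    induction t using Int.induction_on with
    | zero => simp [hP0]
    | succ t ih => rw [h χ hχ, ih, step]; ring
    | pred t ih =>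
      have h1 := h χ hχ (-(t : ℤ) - 1)
      have h2 := step (-(t : ℤ) - 1)
      rw [sub_add_cancel] at h1 h2
      rw [ih, h2] at h1
      linarith

end IsPolyCurve

/-- Conjugation by powers of `u` moves every element of `M` along a polynomial curve. -/
def IsUnipotentOn (M : Subgroup Γ) (u : Γ) : Prop :=
  ∀ m ∈ M, IsPolyCurve M 0 fun t => u ^ t * m * (u ^ t)⁻¹

/-- Polynomiality on `M` propagates to the deeper terms because these are generated by commutators.
-/
theorem IsUnipotentOn.isPolyCurve [M.Normal] {u : Γ} (hu : IsUnipotentOn M u) {x : Γ}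
    (hx : x ∈ M.lowerCentralSeries k) : IsPolyCurve M k fun t => u ^ t * x * (u ^ t)⁻¹ := by
  induction k generalizing x with
  | zero => exact hu x hx
  | succ k ih =>
    rw [Subgroup.lowerCentralSeries_succ, Subgroup.commutator_def] at hx
    induction hx using Subgroup.closure_induction with
    | mem x hx =>
      obtain ⟨a, ha, b, hb, rfl⟩ := hx
      convert (ih ha).commutator (hu b hb) using 2
      simp only [commutatorElement_def]
      group
    | one => simpa using IsPolyCurve.const (one_mem (M.lowerCentralSeries (k + 1)))
    | mul y z _ _ hy hz =>
      convert hy.mul hz using 2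
      group
    | inv y _ hy =>
      convert hy.inv using 2
      group

/-- The elements of `M` that conjugation by powers of `u` moves along a polynomial curve. -/
def polyCurveSubgroup (M : Subgroup Γ) (u : Γ) : Subgroup Γ where
  carrier := {m | IsPolyCurve M 0 fun t => u ^ t * m * (u ^ t)⁻¹}
  one_mem' := by simpa using IsPolyCurve.const (one_mem (M.lowerCentralSeries 0))
  mul_mem' {a b} ha hb := by
    simp only [Set.mem_ofPred_eq] at *
    convert ha.mul hb using 2
    group
  inv_mem' {a} ha := by
    simp only [Set.mem_ofPred_eq] at *
    convert ha.inv using 2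
    group

/-- Characters of `M` kill ⁅M, M⁆, so they see the curve as constant. -/
theorem mem_polyCurveSubgroup_of_mem_commutator [M.Normal] {u m : Γ} (hm : m ∈ ⁅M, M⁆) :
    m ∈ polyCurveSubgroup M u := by
  have hmem : ∀ t : ℤ, u ^ t * m * (u ^ t)⁻¹ ∈ ⁅M, M⁆ := fun t =>
    Subgroup.Normal.conj_mem inferInstance m hm _
  refine (IsPolyCurve.const (one_mem (M.lowerCentralSeries 0))).congr
    (fun t => Subgroup.commutator_le_left M M (hmem t)) fun χ hχ t => ?_
  rw [hχ.map_one]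
  exact hχ.map_eq_zero _ (hmem t)

theorem conj_mem_polyCurveSubgroup [M.Normal] {u m g : Γ} (hm : m ∈ M) (hg : g ∈ M)
    (h : m ∈ polyCurveSubgroup M u) : g * m * g⁻¹ ∈ polyCurveSubgroup M u := by
  have e : g * m * g⁻¹ = ⁅g, m⁆ * m := by rw [commutatorElement_def]; group
  rw [e]
  exact mul_mem (mem_polyCurveSubgroup_of_mem_commutator
    (Subgroup.commutator_mem_commutator hg hm)) h

/-- The discrete derivative of the orbit of `m` is the orbit of `u * m * u⁻¹ * m⁻¹`. This is how
unipotence is verified, one step of a filtration at a time. -/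
theorem mem_polyCurveSubgroup_of_commutator [M.Normal] {u m : Γ} (hm : m ∈ M)
    (h : u * m * u⁻¹ * m⁻¹ ∈ polyCurveSubgroup M u) : m ∈ polyCurveSubgroup M u := by
  have hc : ∀ g x, x ∈ M → g * x * g⁻¹ ∈ M := fun g x hx =>
    Subgroup.Normal.conj_mem inferInstance x hx g
  refine IsPolyCurve.of_difference (fun t => hc _ _ hm) h fun χ hχ t => ?_
  have h1 := (hχ.comp_conj (u ^ t)).map_mul (u * m * u⁻¹ * m⁻¹)
    (mul_mem (hc _ _ hm) (inv_mem hm)) m hm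
  rw [add_comm (χ _)]
  refine Eq.trans ?_ h1
  congr 1
  rw [zpow_add, zpow_one]
  group

theorem IsUnipotentOn.of_closure [M.Normal] {u : Γ} {S : Set Γ} (hS : Subgroup.closure S = M)
    (h : ∀ s ∈ S, s ∈ polyCurveSubgroup M u) : IsUnipotentOn M u := by
  intro m hm
  have : Subgroup.closure S ≤ polyCurveSubgroup M u := (Subgroup.closure_le _).2 h
  exact this (hS ▸ hm)

/-- Each condition excludes only the integer roots of a nonzero polynomial, so finitely many
conditions leave some integer. -/
theorem IsLcsCharacter.exists_forall_ne_zero [M.Normal] {u : Γ} (hu : IsUnipotentOn M u)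
    (hχ : IsLcsCharacter M k χ) {J : Type*} [Finite J] (x : J → Γ)
    (hx : ∀ j, x j ∈ M.lowerCentralSeries k)
    (h : ∀ j, ∃ t : ℤ, χ (u ^ t * x j * (u ^ t)⁻¹) ≠ 0) :
    ∃ t : ℤ, ∀ j, χ (u ^ t * x j * (u ^ t)⁻¹) ≠ 0 := by
  have hp : ∀ j, ∃ p : Polynomial ℝ, ∀ t : ℤ, χ (u ^ t * x j * (u ^ t)⁻¹) = p.eval (t : ℝ) := by
    intro j
    obtain ⟨-, J', _, a, p, -, hp⟩ := hu.isPolyCurve (hx j)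
    refine ⟨∑ j, p j * Polynomial.C (χ (a j)), fun t => ?_⟩
    rw [hp χ hχ, Polynomial.eval_finsetSum]
    simp
  choose p hp using hp
  have hfin : (⋃ j, {t : ℤ | (p j).eval (t : ℝ) = 0}).Finite := by
    refine Set.finite_iUnion fun j => ?_
    obtain ⟨t, ht⟩ := h j
    rw [hp] at ht
    have hpj : p j ≠ 0 := by
      rintro h0
      rw [h0] at ht
      simp at ht
    exact (Polynomial.finite_setOfPred_isRoot hpj).preimage Int.cast_injective.injOn
  obtain ⟨t, ht⟩ := hfin.infinite_compl.nonempty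
  refine ⟨t, fun j h0 => ht ?_⟩
  rw [hp] at h0
  exact Set.mem_iUnion.2 ⟨j, h0⟩

/-- Induct on a word for `g`. A suitable power of its first letter `u` keeps the old values nonzero
(they are so at exponent 0) and the new one nonzero (it is so at exponent 1 or −1); χ is then
replaced by its twist by that power. -/
theorem IsLcsCharacter.exists_conj_forall_ne_zero_of_mem_closure [M.Normal] {U : Set Γ}
    (hU : ∀ u ∈ U, IsUnipotentOn M u) (hχ : IsLcsCharacter M k χ) {J : Type*} [Finite J]
    (x : J → Γ) (hx : ∀ j, x j ∈ M.lowerCentralSeries k) (h : ∀ j, χ (x j) ≠ 0) {y g : Γ}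
    (hy : y ∈ M.lowerCentralSeries k) (hg : g ∈ Subgroup.closure U) (hyg : χ (g * y * g⁻¹) ≠ 0) :
    ∃ g' ∈ Subgroup.closure U, (∀ j, χ (g' * x j * g'⁻¹) ≠ 0) ∧ χ (g' * y * g'⁻¹) ≠ 0 := by
  induction hg using Subgroup.closure_induction_left generalizing χ with
  | one => exact ⟨1, one_mem _, by simpa using h, by simpa using hyg⟩
  | mul_left u hu g _ ih =>
    obtain ⟨t, ht⟩ := hχ.exists_forall_ne_zero (hU u hu)
      (fun j : Option J => j.elim (g * y * g⁻¹) x)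
      (by rintro (_ | j); exacts [Subgroup.Normal.conj_mem inferInstance y hy g, hx j])
      (by
        rintro (_ | j)
        · exact ⟨1, by simpa [mul_assoc] using hyg⟩
        · exact ⟨0, by simpa using h j⟩)
    obtain ⟨g', hg', h1, h2⟩ := ih (hχ.comp_conj (u ^ t)) (fun j => ht (some j)) (ht none)
    exact ⟨u ^ t * g', mul_mem (zpow_mem (Subgroup.subset_closure hu) t) hg', fun j => by
      simpa [mul_assoc] using h1 j, by simpa [mul_assoc] using h2⟩
  | inv_mul_cancel u hu g _ ih =>
    obtain ⟨t, ht⟩ := hχ.exists_forall_ne_zero (hU u hu)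
      (fun j : Option J => j.elim (g * y * g⁻¹) x)
      (by rintro (_ | j); exacts [Subgroup.Normal.conj_mem inferInstance y hy g, hx j])
      (by
        rintro (_ | j)
        · exact ⟨-1, by simpa [mul_assoc] using hyg⟩
        · exact ⟨0, by simpa using h j⟩)
    obtain ⟨g', hg', h1, h2⟩ := ih (hχ.comp_conj (u ^ t)) (fun j => ht (some j)) (ht none)
    exact ⟨u ^ t * g', mul_mem (zpow_mem (Subgroup.subset_closure hu) t) hg', fun j => by
      simpa [mul_assoc] using h1 j, by simpa [mul_assoc] using h2⟩

theorem IsLcsCharacter.exists_conj_forall_ne_zero [M.Normal] {U : Set Γ}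
    (hU : ∀ u ∈ U, IsUnipotentOn M u) (hχ : IsLcsCharacter M k χ) {J : Type*} [Finite J]
    (x : J → Γ) (hx : ∀ j, x j ∈ M.lowerCentralSeries k)
    (h : ∀ j, ∃ g ∈ Subgroup.closure U, χ (g * x j * g⁻¹) ≠ 0) :
    ∃ g ∈ Subgroup.closure U, ∀ j, χ (g * x j * g⁻¹) ≠ 0 := by
  classical
  have := Fintype.ofFinite J
  suffices hs : ∀ s : Finset J, ∃ g ∈ Subgroup.closure U, ∀ j ∈ s, χ (g * x j * g⁻¹) ≠ 0 by
    obtain ⟨g, hg, h⟩ := hs Finset.univ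
    exact ⟨g, hg, fun j => h j (Finset.mem_univ j)⟩
  intro s
  induction s using Finset.induction_on with
  | empty => exact ⟨1, one_mem _, by simp⟩
  | insert i s _ ih =>
    obtain ⟨g, hg, hgs⟩ := ih
    obtain ⟨g₁, hg₁, hgi⟩ := h i
    have hc : ∀ g y, y ∈ M.lowerCentralSeries k → g * y * g⁻¹ ∈ M.lowerCentralSeries k :=
      fun g y hy => Subgroup.Normal.conj_mem inferInstance y hy g
    obtain ⟨g', hg', h1, h2⟩ := hχ.exists_conj_forall_ne_zero_of_mem_closure hU
      (fun j : s => g * x j * g⁻¹) (fun j => hc g _ (hx j)) (fun j => hgs j j.2)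
      (y := g * x i * g⁻¹) (g := g₁ * g⁻¹) (hc g _ (hx i)) (mul_mem hg₁ (inv_mem hg))
      (by simpa [mul_assoc] using hgi)
    refine ⟨g' * g, mul_mem hg' hg, fun j hj => ?_⟩
    rcases Finset.mem_insert.1 hj with rfl | hj
    · simpa [mul_assoc] using h2
    · simpa [mul_assoc] using h1 ⟨j, hj⟩

end LcsCharacters

/-! ### Nielsen automorphisms and Magnus' generators -/

namespace FreeAut

open FreeGroup (of lift)

open scoped commutatorElement

variable {ι : Type*}

theorem mulAut_ext {f g : MulAut (FreeGroup ι)} (h : ∀ i, f (of i) = g (of i)) : f = g :=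
  MulEquiv.toMonoidHom_injective (FreeGroup.ext_hom _ _ h)

/-- The automorphism given by mutually inverse substitutions. -/
def substAut (f g : ι → FreeGroup ι) (hfg : ∀ i, lift f (g i) = of i)
    (hgf : ∀ i, lift g (f i) = of i) : MulAut (FreeGroup ι) :=
  MonoidHom.toMulEquiv (lift f) (lift g) (FreeGroup.ext_hom _ _ fun i => by simp [hgf])
    (FreeGroup.ext_hom _ _ fun i => by simp [hfg])

theorem substAut_of (f g : ι → FreeGroup ι) (hfg hgf) (i : ι) :
    substAut f g hfg hgf (of i) = f i := by
  simp [substAut]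

theorem inv_apply_eq_of {f : MulAut (FreeGroup ι)} {x y : FreeGroup ι} (h : f y = x) :
    f⁻¹ x = y := by
  rw [← h, MulAut.inv_apply_self]

/-- The words not involving the generator `a`. -/
def avoiding (a : ι) : Subgroup (FreeGroup ι) := Subgroup.closure (of '' {a}ᶜ)

theorem of_mem_avoiding {a i : ι} (h : i ≠ a) : of i ∈ avoiding a :=
  Subgroup.subset_closure ⟨i, h, rfl⟩

theorem apply_eq_self_of_mem_avoiding {f : MulAut (FreeGroup ι)} {a : ι}
    (hf : ∀ j, j ≠ a → f (of j) = of j) {w : FreeGroup ι} (hw : w ∈ avoiding a) : f w = w := by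
  have : avoiding a ≤ MonoidHom.eqLocus f.toMonoidHom (MonoidHom.id _) := by
    rw [avoiding, Subgroup.closure_le]
    rintro _ ⟨j, hj, rfl⟩
    exact hf j hj
  exact this hw

theorem apply_mem_avoiding {f : MulAut (FreeGroup ι)} {a : ι}
    (hf : ∀ j, j ≠ a → f (of j) ∈ avoiding a) {w : FreeGroup ι} (hw : w ∈ avoiding a) :
    f w ∈ avoiding a := by
  have : avoiding a ≤ (avoiding a).comap f.toMonoidHom := by
    conv_lhs => rw [avoiding]
    rw [Subgroup.closure_le]
    rintro _ ⟨j, hj, rfl⟩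
    exact hf j hj
  exact this hw

variable [DecidableEq ι]

/-- The Nielsen automorphism `x_a ↦ x_a x_i` (trivial if `i = a`). -/
def rightMul (a i : ι) : MulAut (FreeGroup ι) :=
  if h : i = a then 1 else
    substAut (Function.update of a (of a * of i)) (Function.update of a (of a * (of i)⁻¹))
      (fun j => by by_cases hj : j = a <;> simp [hj, h])
      (fun j => by by_cases hj : j = a <;> simp [hj, h])

/-- The Nielsen automorphism `x_a ↦ x_i⁻¹ x_a` (trivial if `i = a`). -/
def leftMul (a i : ι) : MulAut (FreeGroup ι) :=
  if h : i = a then 1 else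
    substAut (Function.update of a ((of i)⁻¹ * of a)) (Function.update of a (of i * of a))
      (fun j => by by_cases hj : j = a <;> simp [hj, h])
      (fun j => by by_cases hj : j = a <;> simp [hj, h])

@[simp] theorem rightMul_self (a : ι) : rightMul a a = 1 := by simp [rightMul]

@[simp] theorem leftMul_self (a : ι) : leftMul a a = 1 := by simp [leftMul]

theorem rightMul_of_self {a i : ι} (h : i ≠ a) : rightMul a i (of a) = of a * of i := by
  rw [rightMul, dif_neg h, substAut_of, Function.update_self]

theorem rightMul_of_ne {a j : ι} (i : ι) (h : j ≠ a) : rightMul a i (of j) = of j := by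
  rw [rightMul]
  split_ifs
  · rfl
  · rw [substAut_of, Function.update_of_ne h]

theorem leftMul_of_self {a i : ι} (h : i ≠ a) : leftMul a i (of a) = (of i)⁻¹ * of a := by
  rw [leftMul, dif_neg h, substAut_of, Function.update_self]

theorem leftMul_of_ne {a j : ι} (i : ι) (h : j ≠ a) : leftMul a i (of j) = of j := by
  rw [leftMul]
  split_ifs
  · rfl
  · rw [substAut_of, Function.update_of_ne h]

/-- The homomorphism sending a word `w` avoiding `a` to the automorphism `x_a ↦ x_a w`. -/
def rightHom (a : ι) : FreeGroup ι →* MulAut (FreeGroup ι) := lift (rightMul a)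

/-- The homomorphism sending a word `w` avoiding `a` to the automorphism `x_a ↦ w⁻¹ x_a`. -/
def leftHom (a : ι) : FreeGroup ι →* MulAut (FreeGroup ι) := lift (leftMul a)

@[simp] theorem rightHom_of (a i : ι) : rightHom a (of i) = rightMul a i := by simp [rightHom]

@[simp] theorem leftHom_of (a i : ι) : leftHom a (of i) = leftMul a i := by simp [leftHom]

theorem rightHom_of_ne {a j : ι} (w : FreeGroup ι) (h : j ≠ a) : rightHom a w (of j) = of j := by
  induction w using FreeGroup.induction_on with
  | C1 => simp
  | of i => rw [rightHom_of, rightMul_of_ne i h]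
  | inv_of i ih => rw [map_inv]; exact inv_apply_eq_of ih
  | mul x y hx hy => rw [map_mul, MulAut.mul_apply, hy, hx]

theorem leftHom_of_ne {a j : ι} (w : FreeGroup ι) (h : j ≠ a) : leftHom a w (of j) = of j := by
  induction w using FreeGroup.induction_on with
  | C1 => simp
  | of i => rw [leftHom_of, leftMul_of_ne i h]
  | inv_of i ih => rw [map_inv]; exact inv_apply_eq_of ih
  | mul x y hx hy => rw [map_mul, MulAut.mul_apply, hy, hx]

theorem rightHom_of_self {a : ι} {w : FreeGroup ι} (hw : w ∈ avoiding a) :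
    rightHom a w (of a) = of a * w := by
  rw [avoiding] at hw
  induction hw using Subgroup.closure_induction with
  | mem x hx =>
    obtain ⟨i, hi, rfl⟩ := hx
    rw [rightHom_of, rightMul_of_self hi]
  | one => simp
  | mul x y hx hy ihx ihy =>
    rw [map_mul, MulAut.mul_apply, ihy, map_mul, ihx,
      apply_eq_self_of_mem_avoiding (fun j => rightHom_of_ne x) hy, mul_assoc]
  | inv x hx ih =>
    rw [map_inv]
    refine inv_apply_eq_of ?_
    rw [map_mul, map_inv, ih, apply_eq_self_of_mem_avoiding (fun j => rightHom_of_ne x) hx]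
    group

theorem leftHom_of_self {a : ι} {w : FreeGroup ι} (hw : w ∈ avoiding a) :
    leftHom a w (of a) = w⁻¹ * of a := by
  rw [avoiding] at hw
  induction hw using Subgroup.closure_induction with
  | mem x hx =>
    obtain ⟨i, hi, rfl⟩ := hx
    rw [leftHom_of, leftMul_of_self hi]
  | one => simp
  | mul x y hx hy ihx ihy =>
    rw [map_mul, MulAut.mul_apply, ihy, map_mul, ihx,
      apply_eq_self_of_mem_avoiding (fun j => leftHom_of_ne x) (inv_mem hy), mul_inv_rev, mul_assoc]
  | inv x hx ih =>
    rw [map_inv]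
    refine inv_apply_eq_of ?_
    rw [map_mul, map_inv, map_inv, ih,
      apply_eq_self_of_mem_avoiding (fun j => leftHom_of_ne x) hx]
    group

theorem rightHom_apply_avoiding {a : ι} (w : FreeGroup ι) {v : FreeGroup ι} (hv : v ∈ avoiding a) :
    rightHom a w v = v :=
  apply_eq_self_of_mem_avoiding (fun _ => rightHom_of_ne w) hv

theorem leftHom_apply_avoiding {a : ι} (w : FreeGroup ι) {v : FreeGroup ι} (hv : v ∈ avoiding a) :
    leftHom a w v = v :=
  apply_eq_self_of_mem_avoiding (fun _ => leftHom_of_ne w) hv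

theorem commute_leftMul_rightMul (a i j : ι) : Commute (leftMul a i) (rightMul a j) := by
  by_cases hi : i = a
  · subst hi; simp
  by_cases hj : j = a
  · subst hj; simp
  refine mulAut_ext fun k => ?_
  rw [MulAut.mul_apply, MulAut.mul_apply]
  by_cases hk : k = a
  · subst hk
    rw [rightMul_of_self hj, leftMul_of_self hi, map_mul, map_mul, map_inv, leftMul_of_self hi,
      rightMul_of_self hj, leftMul_of_ne _ hj, rightMul_of_ne _ hi, mul_assoc]
  · rw [rightMul_of_ne _ hk, leftMul_of_ne _ hk, rightMul_of_ne _ hk]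

theorem commute_leftHom_rightHom (a : ι) (v w : FreeGroup ι) :
    Commute (leftHom a v) (rightHom a w) := by
  induction v using FreeGroup.induction_on with
  | C1 => simp
  | inv_of i ih => rw [map_inv]; exact ih.inv_left
  | mul x y hx hy => rw [map_mul]; exact hx.mul_left hy
  | of i =>
    induction w using FreeGroup.induction_on with
    | C1 => simp
    | inv_of i ih => rw [map_inv]; exact ih.inv_right
    | mul x y hx hy => rw [map_mul]; exact hx.mul_right hy
    | of j => simpa using commute_leftMul_rightMul a i j

/-- The homomorphism sending a word `w` avoiding `a` to the automorphism `x_a ↦ w⁻¹ x_a w`. -/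
def conjHom (a : ι) : FreeGroup ι →* MulAut (FreeGroup ι) where
  toFun w := leftHom a w * rightHom a w
  map_one' := by simp
  map_mul' x y := by
    rw [map_mul, map_mul, mul_assoc, ← mul_assoc (leftHom a y), (commute_leftHom_rightHom a y x).eq]
    simp only [mul_assoc]

theorem conjHom_apply (a : ι) (w : FreeGroup ι) : conjHom a w = leftHom a w * rightHom a w := rfl

theorem conjHom_of_ne {a j : ι} (w : FreeGroup ι) (h : j ≠ a) : conjHom a w (of j) = of j := by
  rw [conjHom_apply, MulAut.mul_apply, rightHom_of_ne w h, leftHom_of_ne w h]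

theorem conjHom_of_self {a : ι} {w : FreeGroup ι} (hw : w ∈ avoiding a) :
    conjHom a w (of a) = w⁻¹ * of a * w := by
  rw [conjHom_apply, MulAut.mul_apply, rightHom_of_self hw, map_mul, leftHom_of_self hw,
    leftHom_apply_avoiding _ hw]

theorem conjHom_apply_avoiding {a : ι} (w : FreeGroup ι) {v : FreeGroup ι} (hv : v ∈ avoiding a) :
    conjHom a w v = v :=
  apply_eq_self_of_mem_avoiding (fun _ => conjHom_of_ne w) hv

/-- Left multiplications of x_a commute with right ones, so only the right factor of `conjHom a v`
acts. -/
theorem conjHom_conj_rightHom (a : ι) (v w : FreeGroup ι) :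
    conjHom a v * rightHom a w * (conjHom a v)⁻¹ = rightHom a (v * w * v⁻¹) := by
  rw [conjHom_apply, map_mul, map_mul, map_inv, mul_inv_rev]
  have h := (commute_leftHom_rightHom a v (v * w * v⁻¹)).eq
  rw [map_mul, map_mul, map_inv] at h
  calc _ = leftHom a v * (rightHom a v * rightHom a w * (rightHom a v)⁻¹) * (leftHom a v)⁻¹ := by
        group
    _ = _ := by rw [h]; group

/-- Magnus' generators of `IA_n`: the automorphisms `x_a ↦ x_b⁻¹ x_a x_b` and
`x_a ↦ x_a [x_b, x_c]`. -/
def magnusGenerators (ι : Type*) [DecidableEq ι] : Set (MulAut (FreeGroup ι)) :=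
  {f | (∃ a b, a ≠ b ∧ f = conjHom a (of b)) ∨
    ∃ a b c, a ≠ b ∧ a ≠ c ∧ f = rightHom a ⁅of b, of c⁆}

theorem finite_magnusGenerators [Finite ι] : (magnusGenerators ι).Finite := by
  refine ((Set.finite_range fun p : ι × ι => conjHom p.1 (of p.2)).union
    (Set.finite_range fun p : ι × ι × ι => rightHom p.1 ⁅of p.2.1, of p.2.2⁆)).subset ?_
  rintro f (⟨a, b, -, rfl⟩ | ⟨a, b, c, -, -, rfl⟩)
  · exact Or.inl ⟨(a, b), rfl⟩
  · exact Or.inr ⟨(a, b, c), rfl⟩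

/-- The subgroup generated by Magnus' generators. -/
def magnusSubgroup (ι : Type*) [DecidableEq ι] : Subgroup (MulAut (FreeGroup ι)) :=
  Subgroup.closure (magnusGenerators ι)

theorem conjHom_mem (a : ι) (w : FreeGroup ι) : conjHom a w ∈ magnusSubgroup ι := by
  induction w using FreeGroup.induction_on with
  | C1 => rw [map_one]; exact one_mem _
  | of i =>
    by_cases h : a = i
    · subst h
      simp only [conjHom_apply, leftHom_of, rightHom_of, leftMul_self, rightMul_self, mul_one]
      exact one_mem _
    · exact Subgroup.subset_closure (Or.inl ⟨a, i, h, rfl⟩)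
  | inv_of i ih => rw [map_inv]; exact inv_mem ih
  | mul x y hx hy => rw [map_mul]; exact mul_mem hx hy

/-- Conjugation by `conjHom a g` conjugates the word by `g`. Hence the admissible words form a
normal subgroup containing the commutators of generators. -/
theorem rightHom_mem {a : ι} {w : FreeGroup ι} (hw : w ∈ _root_.commutator (FreeGroup ι)) :
    rightHom a w ∈ magnusSubgroup ι := by
  -- `A` is the subgroup of words `w` with the desired property; it is normal.
  let A : Subgroup (FreeGroup ι) := (magnusSubgroup ι).comap (rightHom a)
  have hconj : ∀ g x, x ∈ A → g * x * g⁻¹ ∈ A := by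
    intro g x hx
    change rightHom a _ ∈ magnusSubgroup ι
    rw [← conjHom_conj_rightHom]
    exact mul_mem (mul_mem (conjHom_mem a g) hx) (inv_mem (conjHom_mem a g))
  have hgen : ∀ b c, ⁅(of b : FreeGroup ι), of c⁆ ∈ A := by
    intro b c
    change rightHom a _ ∈ magnusSubgroup ι
    by_cases hb : a = b
    · subst hb
      rw [map_commutatorElement, rightHom_of, rightMul_self, commutatorElement_one_left]
      exact one_mem _
    by_cases hc : a = c
    · subst hc
      rw [map_commutatorElement, rightHom_of a a, rightMul_self, commutatorElement_one_right]
      exact one_mem _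
    exact Subgroup.subset_closure (Or.inr ⟨a, b, c, hb, hc, rfl⟩)
  have hmulr : ∀ x y z : FreeGroup ι, ⁅x, y⁆ ∈ A → ⁅x, z⁆ ∈ A → ⁅x, y * z⁆ ∈ A := by
    intro x y z hy hz
    have : ⁅x, y * z⁆ = ⁅x, y⁆ * (y * ⁅x, z⁆ * y⁻¹) := by simp only [commutatorElement_def]; group
    rw [this]
    exact mul_mem hy (hconj _ _ hz)
  have hswap : ∀ x y : FreeGroup ι, ⁅x, y⁆ ∈ A → ⁅y, x⁆ ∈ A := by
    intro x y h
    rw [← commutatorElement_inv]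
    exact inv_mem h
  have hinvr : ∀ x y : FreeGroup ι, ⁅x, y⁆ ∈ A → ⁅x, y⁻¹⁆ ∈ A := by
    intro x y h
    have : ⁅x, y⁻¹⁆ = y⁻¹ * ⁅x, y⁆⁻¹ * y⁻¹⁻¹ := by simp only [commutatorElement_def]; group
    rw [this]
    exact hconj _ _ (inv_mem h)
  have hall : ∀ x y : FreeGroup ι, ⁅x, y⁆ ∈ A := by
    intro x y
    induction x using FreeGroup.induction_on with
    | C1 => rw [commutatorElement_one_left]; exact one_mem _
    | inv_of i ih => exact hswap _ _ (hinvr _ _ (hswap _ _ ih))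
    | mul x z hx hz => exact hswap _ _ (hmulr _ _ _ (hswap _ _ hx) (hswap _ _ hz))
    | of i =>
      induction y using FreeGroup.induction_on with
      | C1 => rw [commutatorElement_one_right]; exact one_mem _
      | of j => exact hgen i j
      | inv_of j ih => exact hinvr _ _ ih
      | mul y z hy hz => exact hmulr _ _ _ hy hz
  have hle : _root_.commutator (FreeGroup ι) ≤ A := by
    rw [_root_.commutator_def, Subgroup.commutator_le]
    intro x _ y _
    exact hall x y
  exact hle hw

/-- The map x_a ↦ u x_a v is a conjugation of x_a combined with right multiplication by a word in
the commutator subgroup. -/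
theorem mem_magnusSubgroup_of_apply {f : MulAut (FreeGroup ι)} {a : ι} {u v : FreeGroup ι}
    (hf : ∀ j, j ≠ a → f (of j) = of j) (hfa : f (of a) = u * of a * v) (hu : u ∈ avoiding a)
    (hv : v ∈ avoiding a) (huv : u * v ∈ _root_.commutator (FreeGroup ι)) :
    f ∈ magnusSubgroup ι := by
  have e : f = conjHom a u⁻¹ * rightHom a (u * v) := by
    refine mulAut_ext fun j => ?_
    rw [MulAut.mul_apply]
    by_cases hj : j = a
    · subst hj
      rw [hfa, rightHom_of_self (mul_mem hu hv), map_mul, conjHom_of_self (inv_mem hu),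
        conjHom_apply_avoiding _ (mul_mem hu hv)]
      group
    · rw [hf j hj, rightHom_of_ne _ hj, conjHom_of_ne _ hj]
  rw [e]
  exact mul_mem (conjHom_mem _ _) (rightHom_mem huv)

end FreeAut

/-! ### Supports and signed permutations -/

namespace FreeAut

open FreeGroup (of lift)
open scoped commutatorElement

section Supports

variable {ι : Type*}

/-- The subgroup of words in the generators indexed by `D`. -/
def wordsIn (D : Set ι) : Subgroup (FreeGroup ι) := Subgroup.closure (of '' D)

theorem of_mem_wordsIn {D : Set ι} {i : ι} (h : i ∈ D) : of i ∈ wordsIn D :=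
  Subgroup.subset_closure ⟨i, h, rfl⟩

/-- The automorphisms that fix the generators outside `D` and preserve the subgroup generated by
those in `D`. -/
def supportedIn (D : Set ι) : Subgroup (MulAut (FreeGroup ι)) where
  carrier := {f | (∀ i ∉ D, f (of i) = of i) ∧ ∀ x, f x ∈ wordsIn D ↔ x ∈ wordsIn D}
  one_mem' := by simp
  mul_mem' {f g} hf hg := by
    refine ⟨fun i hi => ?_, fun x => ?_⟩
    · rw [MulAut.mul_apply, hg.1 i hi, hf.1 i hi]
    · rw [MulAut.mul_apply, hf.2, hg.2]
  inv_mem' {f} hf := by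
    refine ⟨fun i hi => inv_apply_eq_of (hf.1 i hi), fun x => ?_⟩
    rw [← hf.2, MulAut.apply_inv_self]

theorem mem_supportedIn_of_apply_mem {D : Set ι} {f : MulAut (FreeGroup ι)}
    (h : ∀ i ∉ D, f (of i) = of i) (h1 : ∀ i ∈ D, f (of i) ∈ wordsIn D)
    (h2 : ∀ i ∈ D, f⁻¹ (of i) ∈ wordsIn D) : f ∈ supportedIn D := by
  have key : ∀ g : MulAut (FreeGroup ι), (∀ i ∈ D, g (of i) ∈ wordsIn D) →
      ∀ x ∈ wordsIn D, g x ∈ wordsIn D := by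
    intro g hg
    have : wordsIn D ≤ (wordsIn D).comap g.toMonoidHom := by
      conv_lhs => rw [wordsIn]
      rw [Subgroup.closure_le]
      rintro _ ⟨i, hi, rfl⟩
      exact hg i hi
    exact this
  refine ⟨h, fun x => ⟨fun hx => ?_, key f h1 x⟩⟩
  have := key f⁻¹ h2 _ hx
  rwa [MulAut.inv_apply_self] at this

theorem apply_eq_self_of_supportedIn {D E : Set ι} (hDE : Disjoint D E)
    {f : MulAut (FreeGroup ι)} (hf : f ∈ supportedIn D) {x : FreeGroup ι} (hx : x ∈ wordsIn E) :
    f x = x := by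
  have : wordsIn E ≤ MonoidHom.eqLocus f.toMonoidHom (MonoidHom.id _) := by
    rw [wordsIn, Subgroup.closure_le]
    rintro _ ⟨j, hj, rfl⟩
    exact hf.1 j (hDE.notMem_of_mem_right hj)
  exact this hx

/-- The image under `f` of a letter of `D` is a word in `D`, which `g` fixes; this is why
`supportedIn` also demands that the words in `D` be preserved. -/
theorem commute_of_supportedIn {D E : Set ι} (hDE : Disjoint D E) {f g : MulAut (FreeGroup ι)}
    (hf : f ∈ supportedIn D) (hg : g ∈ supportedIn E) : Commute f g := by
  refine mulAut_ext fun i => ?_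
  rw [MulAut.mul_apply, MulAut.mul_apply]
  by_cases hi : i ∈ D
  · rw [hg.1 i (hDE.notMem_of_mem_left hi),
      apply_eq_self_of_supportedIn hDE.symm hg ((hf.2 _).2 (of_mem_wordsIn hi))]
  · by_cases hi' : i ∈ E
    · rw [hf.1 i hi, apply_eq_self_of_supportedIn hDE hf ((hg.2 _).2 (of_mem_wordsIn hi'))]
    · rw [hf.1 i hi, hg.1 i hi', hf.1 i hi]

theorem wordsIn_mono {D E : Set ι} (h : D ⊆ E) : wordsIn D ≤ wordsIn E :=
  Subgroup.closure_mono (Set.image_mono h)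

/-- `f` maps each generator `x_i` to `x_{σ i}` or its inverse. -/
def IsSignedPerm (f : MulAut (FreeGroup ι)) (σ : Equiv.Perm ι) : Prop :=
  ∀ i, f (of i) = of (σ i) ∨ f (of i) = (of (σ i))⁻¹

namespace IsSignedPerm

variable {f g : MulAut (FreeGroup ι)} {σ τ : Equiv.Perm ι}

theorem one : IsSignedPerm (1 : MulAut (FreeGroup ι)) 1 := fun _ => Or.inl rfl

theorem mul (hf : IsSignedPerm f σ) (hg : IsSignedPerm g τ) : IsSignedPerm (f * g) (σ * τ) := by
  intro i
  rw [MulAut.mul_apply, Equiv.Perm.mul_apply]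
  rcases hg i with h | h <;> rcases hf (τ i) with h' | h' <;> simp [h, h']

theorem inv (hf : IsSignedPerm f σ) : IsSignedPerm f⁻¹ σ⁻¹ := by
  intro i
  rcases hf (σ⁻¹ i) with h | h
  · left
    exact inv_apply_eq_of (by simpa using h)
  · right
    exact inv_apply_eq_of (by rw [map_inv, h]; simp)

theorem apply_mem_wordsIn (hf : IsSignedPerm f σ) {D : Set ι} {x : FreeGroup ι}
    (hx : x ∈ wordsIn D) : f x ∈ wordsIn (σ '' D) := by
  have : wordsIn D ≤ (wordsIn (σ '' D)).comap f.toMonoidHom := by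
    conv_lhs => rw [wordsIn]
    rw [Subgroup.closure_le]
    rintro _ ⟨i, hi, rfl⟩
    have hm : of (σ i) ∈ wordsIn (σ '' D) := of_mem_wordsIn ⟨i, hi, rfl⟩
    change f (of i) ∈ wordsIn (σ '' D)
    rcases hf i with h | h <;> rw [h]
    exacts [hm, inv_mem hm]
  exact this hx

theorem conj_mem_supportedIn (hf : IsSignedPerm f σ) {D : Set ι} (hg : g ∈ supportedIn D) :
    f * g * f⁻¹ ∈ supportedIn (σ '' D) := by
  have hmem : ∀ x, f⁻¹ x ∈ wordsIn D ↔ x ∈ wordsIn (σ '' D) := by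
    intro x
    constructor
    · intro h
      simpa using hf.apply_mem_wordsIn h
    · intro h
      have := hf.inv.apply_mem_wordsIn h
      rwa [← Set.image_comp, ← Equiv.Perm.coe_mul, inv_mul_cancel, Equiv.Perm.coe_one,
        Set.image_id] at this
  refine ⟨fun i hi => ?_, fun x => ?_⟩
  · have hi' : σ⁻¹ i ∉ D := fun h => hi ⟨σ⁻¹ i, h, by simp⟩
    rw [MulAut.mul_apply, MulAut.mul_apply]
    have h1 : g (f⁻¹ (of i)) = f⁻¹ (of i) := by
      rcases hf.inv i with h | h <;> rw [h]
      · exact hg.1 _ hi'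
      · rw [map_inv, hg.1 _ hi']
    rw [h1, MulAut.apply_inv_self]
  · rw [← hmem, ← hmem x, MulAut.mul_apply, MulAut.mul_apply, MulAut.inv_apply_self, hg.2]

end IsSignedPerm

end Supports

variable {ι : Type*} [DecidableEq ι]

theorem rightMul_inv_of_self {a i : ι} (h : i ≠ a) :
    (rightMul a i)⁻¹ (of a) = of a * (of i)⁻¹ := by
  refine inv_apply_eq_of ?_
  rw [map_mul, map_inv, rightMul_of_self h, rightMul_of_ne _ h]
  group

theorem rightMul_inv_of_ne {a j : ι} (i : ι) (h : j ≠ a) : (rightMul a i)⁻¹ (of j) = of j :=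
  inv_apply_eq_of (rightMul_of_ne i h)

theorem leftMul_inv_of_self {a i : ι} (h : i ≠ a) : (leftMul a i)⁻¹ (of a) = of i * of a := by
  refine inv_apply_eq_of ?_
  rw [map_mul, leftMul_of_self h, leftMul_of_ne _ h]
  group

theorem leftMul_inv_of_ne {a j : ι} (i : ι) (h : j ≠ a) : (leftMul a i)⁻¹ (of j) = of j :=
  inv_apply_eq_of (leftMul_of_ne i h)

theorem rightMul_mem_supportedIn {D : Set ι} {a i : ι} (ha : a ∈ D) (hi : i ∈ D) :
    rightMul a i ∈ supportedIn D := by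
  by_cases h : i = a
  · subst h; rw [rightMul_self]; exact one_mem _
  refine mem_supportedIn_of_apply_mem (fun j hj => rightMul_of_ne i fun e => hj (e ▸ ha))
    (fun j hj => ?_) (fun j hj => ?_)
  · by_cases hja : j = a
    · subst hja
      rw [rightMul_of_self h]
      exact mul_mem (of_mem_wordsIn ha) (of_mem_wordsIn hi)
    · rw [rightMul_of_ne i hja]
      exact of_mem_wordsIn hj
  · by_cases hja : j = a
    · subst hja
      rw [rightMul_inv_of_self h]
      exact mul_mem (of_mem_wordsIn ha) (inv_mem (of_mem_wordsIn hi))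
    · rw [rightMul_inv_of_ne i hja]
      exact of_mem_wordsIn hj

theorem leftMul_mem_supportedIn {D : Set ι} {a i : ι} (ha : a ∈ D) (hi : i ∈ D) :
    leftMul a i ∈ supportedIn D := by
  by_cases h : i = a
  · subst h; rw [leftMul_self]; exact one_mem _
  refine mem_supportedIn_of_apply_mem (fun j hj => leftMul_of_ne i fun e => hj (e ▸ ha))
    (fun j hj => ?_) (fun j hj => ?_)
  · by_cases hja : j = a
    · subst hja
      rw [leftMul_of_self h]
      exact mul_mem (inv_mem (of_mem_wordsIn hi)) (of_mem_wordsIn ha)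
    · rw [leftMul_of_ne i hja]
      exact of_mem_wordsIn hj
  · by_cases hja : j = a
    · subst hja
      rw [leftMul_inv_of_self h]
      exact mul_mem (of_mem_wordsIn hi) (of_mem_wordsIn ha)
    · rw [leftMul_inv_of_ne i hja]
      exact of_mem_wordsIn hj

theorem exists_supportedIn_of_mem_magnusGenerators {f : MulAut (FreeGroup ι)}
    (hf : f ∈ magnusGenerators ι) : ∃ D : Finset ι, D.card ≤ 3 ∧ f ∈ supportedIn (D : Set ι) := by
  rcases hf with ⟨a, b, -, rfl⟩ | ⟨a, b, c, -, -, rfl⟩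
  · refine ⟨{a, b}, Finset.card_le_two.trans (by norm_num), ?_⟩
    rw [conjHom_apply, leftHom_of, rightHom_of]
    exact mul_mem (leftMul_mem_supportedIn (by simp) (by simp))
      (rightMul_mem_supportedIn (by simp) (by simp))
  · refine ⟨{a, b, c}, Finset.card_le_three, ?_⟩
    rw [map_commutatorElement, rightHom_of, rightHom_of, commutatorElement_def]
    have hb : rightMul a b ∈ supportedIn (({a, b, c} : Finset ι) : Set ι) :=
      rightMul_mem_supportedIn (by simp) (by simp)
    have hc : rightMul a c ∈ supportedIn (({a, b, c} : Finset ι) : Set ι) :=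
      rightMul_mem_supportedIn (by simp) (by simp)
    exact mul_mem (mul_mem (mul_mem hb hc) (inv_mem hb)) (inv_mem hc)

/-- The automorphism inverting the generator `x_a`. -/
def invGen (a : ι) : MulAut (FreeGroup ι) :=
  substAut (Function.update of a (of a)⁻¹) (Function.update of a (of a)⁻¹)
    (fun j => by by_cases hj : j = a <;> simp [hj])
    (fun j => by by_cases hj : j = a <;> simp [hj])

theorem invGen_of_self (a : ι) : invGen a (of a) = (of a)⁻¹ := by
  rw [invGen, substAut_of, Function.update_self]

theorem invGen_of_ne {a j : ι} (h : j ≠ a) : invGen a (of j) = of j := by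
  rw [invGen, substAut_of, Function.update_of_ne h]

theorem invGen_inv (a : ι) : (invGen a)⁻¹ = invGen a := by
  refine mulAut_ext fun j => inv_apply_eq_of ?_
  by_cases h : j = a
  · subst h; rw [invGen_of_self, map_inv, invGen_of_self, inv_inv]
  · rw [invGen_of_ne h, invGen_of_ne h]

theorem isSignedPerm_invGen (a : ι) : IsSignedPerm (invGen a) 1 := by
  intro i
  by_cases h : i = a
  · subst h; exact Or.inr (invGen_of_self i)
  · exact Or.inl (invGen_of_ne h)

theorem invGen_conj_rightMul (a i : ι) :
    invGen a * rightMul a i * (invGen a)⁻¹ = leftMul a i := by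
  rw [invGen_inv]
  by_cases hi : i = a
  · subst hi
    rw [rightMul_self, leftMul_self, mul_one]
    nth_rw 1 [← invGen_inv]
    exact inv_mul_cancel _
  refine mulAut_ext fun j => ?_
  rw [MulAut.mul_apply, MulAut.mul_apply]
  by_cases h : j = a
  · subst h
    rw [invGen_of_self, map_inv, rightMul_of_self hi, leftMul_of_self hi, mul_inv_rev, map_mul,
      map_inv, map_inv, invGen_of_self, invGen_of_ne hi, inv_inv]
  · rw [invGen_of_ne h, rightMul_of_ne _ h, leftMul_of_ne _ h, invGen_of_ne h]

/-- The signed transposition `x_a ↦ x_b`, `x_b ↦ x_a⁻¹`. -/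
def signedSwap (a b : ι) : MulAut (FreeGroup ι) :=
  rightMul a b * (rightMul b a)⁻¹ * (leftMul a b)⁻¹

theorem signedSwap_of_left {a b : ι} (h : a ≠ b) : signedSwap a b (of a) = of b := by
  rw [signedSwap, MulAut.mul_apply, MulAut.mul_apply, leftMul_inv_of_self h.symm, map_mul,
    rightMul_inv_of_self h, rightMul_inv_of_ne _ h, inv_mul_cancel_right, rightMul_of_ne _ h.symm]

theorem signedSwap_of_right {a b : ι} (h : a ≠ b) : signedSwap a b (of b) = (of a)⁻¹ := by
  rw [signedSwap, MulAut.mul_apply, MulAut.mul_apply, leftMul_inv_of_ne _ h.symm,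
    rightMul_inv_of_self h, map_mul, map_inv, rightMul_of_ne _ h.symm, rightMul_of_self h.symm]
  group

theorem signedSwap_of_ne {a b j : ι} (ha : j ≠ a) (hb : j ≠ b) : signedSwap a b (of j) = of j := by
  rw [signedSwap, MulAut.mul_apply, MulAut.mul_apply, leftMul_inv_of_ne _ ha,
    rightMul_inv_of_ne _ hb, rightMul_of_ne _ ha]

theorem isSignedPerm_signedSwap {a b : ι} (h : a ≠ b) :
    IsSignedPerm (signedSwap a b) (Equiv.swap a b) := by
  intro j
  by_cases ha : j = a
  · subst ha; rw [Equiv.swap_apply_left]; exact Or.inl (signedSwap_of_left h)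
  by_cases hb : j = b
  · subst hb; rw [Equiv.swap_apply_right]; exact Or.inr (signedSwap_of_right h)
  rw [Equiv.swap_apply_of_ne_of_ne ha hb]
  exact Or.inl (signedSwap_of_ne ha hb)

/-- The conjugates of Nielsen's automorphisms `x_a ↦ x_a x_i`. -/
def transvections (ι : Type*) [DecidableEq ι] : Set (MulAut (FreeGroup ι)) :=
  {u | ∃ g a i, i ≠ a ∧ u = g * rightMul a i * g⁻¹}

theorem signedSwap_mem {a b : ι} (h : a ≠ b) :
    signedSwap a b ∈ Subgroup.closure (transvections ι) := by
  refine mul_mem (mul_mem ?_ (inv_mem ?_)) (inv_mem ?_) <;> refine Subgroup.subset_closure ?_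
  · exact ⟨1, a, b, h.symm, by simp⟩
  · exact ⟨1, b, a, h, by simp⟩
  · exact ⟨invGen a, a, b, h.symm, (invGen_conj_rightMul a b).symm⟩

/-- Signs are allowed because a transposition of letters becomes a product of transvections only
after one sign change. Membership in the closure of the transvections is needed later, since those
act polynomially. -/
theorem exists_isSignedPerm [Finite ι] (σ : Equiv.Perm ι) :
    ∃ w ∈ Subgroup.closure (transvections ι), IsSignedPerm w σ := by
  induction σ using Equiv.Perm.swap_induction_on with
  | one => exact ⟨1, one_mem _, IsSignedPerm.one⟩
  | swap_mul σ a b hab ih =>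
    obtain ⟨w, hw, hσ⟩ := ih
    exact ⟨signedSwap a b * w, mul_mem (signedSwap_mem hab) hw,
      (isSignedPerm_signedSwap hab).mul hσ⟩

end FreeAut

/-! ### Conjugating Magnus' generators by x_b ↦ x_b x_a -/

namespace FreeAut

open FreeGroup (of lift)
open scoped commutatorElement

variable {ι : Type*} [DecidableEq ι]

theorem map_mem_commutator {G : Type*} [Group G] (f : G →* G) {x : G}
    (hx : x ∈ _root_.commutator G) : f x ∈ _root_.commutator G := by
  have h : (_root_.commutator G).map f ≤ _root_.commutator G := by
    rw [_root_.commutator_def, Subgroup.map_commutator]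
    exact Subgroup.commutator_mono le_top le_top
  exact h ⟨x, hx, rfl⟩

theorem commutatorElement_mem {G : Type*} [Group G] (x y : G) : ⁅x, y⁆ ∈ _root_.commutator G :=
  Subgroup.commutator_mem_commutator (Subgroup.mem_top x) (Subgroup.mem_top y)

theorem conj_mem_commutator {G : Type*} [Group G] {x : G} (g : G)
    (hx : x ∈ _root_.commutator G) : g * x * g⁻¹ ∈ _root_.commutator G :=
  Subgroup.Normal.conj_mem inferInstance x hx g

section ConjugationFormulas

variable {a b : ι}

theorem rightMul_apply_mem_avoiding {e : ι} (ha : e ≠ a) (hb : e ≠ b) {j : ι} (hj : j ≠ e) :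
    rightMul b a (of j) ∈ avoiding e := by
  by_cases hjb : j = b
  · subst hjb
    by_cases haj : a = j
    · subst haj
      simpa using of_mem_avoiding hj
    · rw [rightMul_of_self haj]
      exact mul_mem (of_mem_avoiding hj) (of_mem_avoiding ha.symm)
  · rw [rightMul_of_ne _ hjb]
    exact of_mem_avoiding hj

theorem rightMul_conj_rightHom {e : ι} (ha : e ≠ a) (hb : e ≠ b) {w : FreeGroup ι}
    (hw : w ∈ avoiding e) :
    rightMul b a * rightHom e w * (rightMul b a)⁻¹ = rightHom e (rightMul b a w) := by
  have hw' : rightMul b a w ∈ avoiding e :=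
    apply_mem_avoiding (fun j hj => rightMul_apply_mem_avoiding ha hb hj) hw
  rw [mul_inv_eq_iff_eq_mul]
  refine mulAut_ext fun j => ?_
  rw [MulAut.mul_apply, MulAut.mul_apply]
  by_cases hj : j = e
  · subst hj
    rw [rightHom_of_self hw, map_mul, rightMul_of_ne _ hb, rightHom_of_self hw']
  · rw [rightHom_of_ne _ hj, rightHom_apply_avoiding _ (rightMul_apply_mem_avoiding ha hb hj)]

theorem rightMul_conj_conjHom {e : ι} (ha : e ≠ a) (hb : e ≠ b) {w : FreeGroup ι}
    (hw : w ∈ avoiding e) :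
    rightMul b a * conjHom e w * (rightMul b a)⁻¹ = conjHom e (rightMul b a w) := by
  have hw' : rightMul b a w ∈ avoiding e :=
    apply_mem_avoiding (fun j hj => rightMul_apply_mem_avoiding ha hb hj) hw
  rw [mul_inv_eq_iff_eq_mul]
  refine mulAut_ext fun j => ?_
  rw [MulAut.mul_apply, MulAut.mul_apply]
  by_cases hj : j = e
  · subst hj
    rw [conjHom_of_self hw, map_mul, map_mul, map_inv, rightMul_of_ne _ hb, conjHom_of_self hw']
  · rw [conjHom_of_ne _ hj, conjHom_apply_avoiding _ (rightMul_apply_mem_avoiding ha hb hj)]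

theorem rightMul_conj_rightHom_same (w : FreeGroup ι) :
    rightMul b a * rightHom b w * (rightMul b a)⁻¹ = rightHom b (of a * w * (of a)⁻¹) := by
  rw [map_mul, map_mul, map_inv, rightHom_of]

theorem rightMul_conj_conjHom_same (hab : a ≠ b) {c : ι} (hc : c ≠ b) :
    rightMul b a * conjHom b (of c) * (rightMul b a)⁻¹ =
      conjHom b (of c) * rightHom b ⁅(of c)⁻¹, of a⁆ := by
  have ha := of_mem_avoiding hab
  have hc' := of_mem_avoiding hc
  have hw : ⁅(of c)⁻¹, of a⁆ ∈ avoiding b :=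
    mul_mem (mul_mem (mul_mem (inv_mem hc') ha) (inv_mem (inv_mem hc'))) (inv_mem ha)
  rw [mul_inv_eq_iff_eq_mul]
  refine mulAut_ext fun j => ?_
  simp only [MulAut.mul_apply]
  by_cases hj : j = b
  · subst hj
    rw [conjHom_of_self hc', rightMul_of_self hab, map_mul (rightHom j _), rightHom_of_self hw,
      rightHom_of_ne _ hab, map_mul (conjHom j _), map_mul (conjHom j _), conjHom_of_self hc',
      conjHom_apply_avoiding _ hw, conjHom_of_ne _ hab, map_mul, map_mul, map_inv,
      rightMul_of_self hab, rightMul_of_ne _ hc, commutatorElement_def]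
    group
  · rw [conjHom_of_ne _ hj, rightMul_of_ne _ hj, rightHom_of_ne _ hj, conjHom_of_ne _ hj]

theorem rightMul_conj_conjHom_other (hab : a ≠ b) {c : ι} (hca : c ≠ a) (hcb : c ≠ b) :
    rightMul b a * conjHom a (of c) * (rightMul b a)⁻¹ =
      rightHom b ⁅of a, (of c)⁻¹⁆ * conjHom a (of c) := by
  have hb := of_mem_avoiding hab
  have hc := of_mem_avoiding hcb
  have hc' := of_mem_avoiding hca
  have hw : ⁅of a, (of c)⁻¹⁆ ∈ avoiding b :=
    mul_mem (mul_mem (mul_mem hb (inv_mem hc)) (inv_mem hb)) (inv_mem (inv_mem hc))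
  rw [mul_inv_eq_iff_eq_mul]
  refine mulAut_ext fun j => ?_
  simp only [MulAut.mul_apply]
  by_cases hja : j = a
  · subst hja
    rw [conjHom_of_self hc', rightMul_of_ne _ hab, conjHom_of_self hc']
    simp only [map_mul, map_inv, rightMul_of_ne _ hab, rightMul_of_ne _ hcb, rightHom_of_ne _ hab,
      rightHom_of_ne _ hcb]
  by_cases hjb : j = b
  · subst hjb
    rw [conjHom_of_ne _ hja, rightMul_of_self hab]
    have h1 := rightHom_of_self hw
    have h2 := rightHom_of_ne ⁅of a, (of c)⁻¹⁆ hab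
    have h3 := rightHom_of_ne ⁅of a, (of c)⁻¹⁆ hcb
    -- Naming the automorphism keeps the rewriting by `map_mul` from splitting the word inside it.
    generalize rightHom j _ = f at *
    simp only [map_mul, map_inv, conjHom_of_ne _ hja, conjHom_of_self hc', h1, h2, h3,
      commutatorElement_def]
    group
  · rw [conjHom_of_ne _ hja, rightMul_of_ne _ hjb, conjHom_of_ne _ hja, rightHom_of_ne _ hjb]

theorem rightMul_conj_rightHom_other (hab : a ≠ b) {w : FreeGroup ι} (hwa : w ∈ avoiding a)
    (hwb : w ∈ avoiding b) :
    rightMul b a * rightHom a w * (rightMul b a)⁻¹ =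
      rightHom b (of a * w⁻¹ * (of a)⁻¹) * rightHom a w := by
  have hb := of_mem_avoiding hab
  have hw : of a * w⁻¹ * (of a)⁻¹ ∈ avoiding b := mul_mem (mul_mem hb (inv_mem hwb)) (inv_mem hb)
  have huw : rightMul b a w = w := by
    rw [← rightHom_of]; exact rightHom_apply_avoiding _ hwb
  rw [mul_inv_eq_iff_eq_mul]
  refine mulAut_ext fun j => ?_
  simp only [MulAut.mul_apply]
  by_cases hja : j = a
  · subst hja
    rw [rightHom_of_self hwa, map_mul, huw, rightMul_of_ne _ hab, rightHom_of_self hwa, map_mul,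
      rightHom_of_ne _ hab, rightHom_apply_avoiding _ hwb]
  by_cases hjb : j = b
  · subst hjb
    rw [rightHom_of_ne _ hja, rightMul_of_self hab]
    have h1 := rightHom_of_self hw
    have h2 := rightHom_of_ne (of a * w⁻¹ * (of a)⁻¹) hab
    have h3 := rightHom_apply_avoiding (of a * w⁻¹ * (of a)⁻¹) hwb
    generalize rightHom j _ = f at *
    rw [map_mul (rightHom a w), rightHom_of_ne _ hja, rightHom_of_self hwa, map_mul, map_mul, h1,
      h2, h3]
    group
  · rw [rightHom_of_ne _ hja, rightMul_of_ne _ hjb, rightHom_of_ne _ hja, rightHom_of_ne _ hjb]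

theorem rightMul_conj_conjHom_swap (hab : a ≠ b) :
    rightMul b a * conjHom a (of b) * (rightMul b a)⁻¹ =
      conjHom b (of a) * conjHom a (of b) := by
  have ha := of_mem_avoiding hab
  have hb := of_mem_avoiding hab.symm
  rw [mul_inv_eq_iff_eq_mul]
  refine mulAut_ext fun j => ?_
  simp only [MulAut.mul_apply]
  by_cases hja : j = a
  · subst hja
    rw [conjHom_of_self hb, rightMul_of_ne _ hab, conjHom_of_self hb]
    simp only [map_mul, map_inv, rightMul_of_ne _ hab, rightMul_of_self hab, conjHom_of_ne _ hab,
      conjHom_of_self ha]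
    group
  by_cases hjb : j = b
  · subst hjb
    rw [conjHom_of_ne _ hja, rightMul_of_self hab]
    simp only [map_mul, map_inv, conjHom_of_ne _ hja, conjHom_of_ne _ hab, conjHom_of_self ha,
      conjHom_of_self hb]
    group
  · rw [conjHom_of_ne _ hja, rightMul_of_ne _ hjb, conjHom_of_ne _ hja, conjHom_of_ne _ hjb]

/-- This is the hard case: the source letter x_a is multiplied by a commutator involving the target
x_b. The factor `rightHom a ⁅of b, of c⁆` reappears once on the right, and the other factors are of
types treated by the simpler formulas; the unipotence proof relies on this shape. -/
theorem rightMul_conj_rightHom_swap (hab : a ≠ b) {c : ι} (hca : c ≠ a) (hcb : c ≠ b) :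
    rightMul b a * rightHom a ⁅of b, of c⁆ * (rightMul b a)⁻¹ =
      conjHom b (of a) * conjHom a (of b) * conjHom b (of c)⁻¹ * rightHom b ⁅of a, of c⁆⁻¹ *
        conjHom a (of b)⁻¹ * rightHom a ⁅of b, of c⁆ * conjHom a (of c) * conjHom b (of a)⁻¹ := by
  have hba := hab.symm
  have ha := of_mem_avoiding hab
  have hb := of_mem_avoiding hab.symm
  have hc := of_mem_avoiding hca
  have hc' := of_mem_avoiding hcb
  have hw : ⁅of b, of c⁆ ∈ avoiding a :=
    mul_mem (mul_mem (mul_mem hb hc) (inv_mem hb)) (inv_mem hc)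
  have hw' : ⁅of a, of c⁆⁻¹ ∈ avoiding b :=
    inv_mem (mul_mem (mul_mem (mul_mem ha hc') (inv_mem ha)) (inv_mem hc'))
  rw [mul_inv_eq_iff_eq_mul]
  have hf₁ := rightHom_of_self hw
  have hf₂ := rightHom_of_ne ⁅of b, of c⁆ hba
  have hf₃ := rightHom_of_ne ⁅of b, of c⁆ hca
  have hf₄ := fun j (hj : j ≠ a) => rightHom_of_ne ⁅of b, of c⁆ hj
  have hg₁ := rightHom_of_self hw'
  have hg₂ := rightHom_of_ne ⁅of a, of c⁆⁻¹ hab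
  have hg₃ := rightHom_of_ne ⁅of a, of c⁆⁻¹ hcb
  have hg₄ := fun j (hj : j ≠ b) => rightHom_of_ne ⁅of a, of c⁆⁻¹ hj
  generalize rightHom a ⁅of b, of c⁆ = f at *
  generalize rightHom b ⁅of a, of c⁆⁻¹ = g at *
  have hi₁ := conjHom_of_self (inv_mem ha)
  have hi₂ := conjHom_of_self (inv_mem hb)
  have hi₃ := conjHom_of_self (inv_mem hc')
  have hi₄ := fun j (hj : j ≠ b) => conjHom_of_ne (of a)⁻¹ hj
  have hi₅ := fun j (hj : j ≠ a) => conjHom_of_ne (of b)⁻¹ hj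
  have hi₆ := fun j (hj : j ≠ b) => conjHom_of_ne (of c)⁻¹ hj
  generalize conjHom b (of a)⁻¹ = p at *
  generalize conjHom a (of b)⁻¹ = q at *
  generalize conjHom b (of c)⁻¹ = r at *
  have hvals : ∀ j, j = a ∨ j = b → rightMul b a (f (of j)) = conjHom b (of a) (conjHom a (of b)
      (r (g (q (f (conjHom a (of c) (p (rightMul b a (of j))))))))) := by
    rintro j (rfl | rfl) <;>
    · simp only [map_mul, map_inv, hf₁, hf₂, hf₃, hg₁, hg₂, hg₃, hi₁, hi₂, hi₃, hi₄ _ hab,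
        hi₅ _ hba, hi₅ _ hca, hi₆ _ hab, hi₆ _ hcb,
        rightMul_of_ne _ hab, rightMul_of_ne _ hcb, rightMul_of_self hab, conjHom_of_ne _ hab,
        conjHom_of_ne _ hba, conjHom_of_ne _ hca, conjHom_of_ne _ hcb, conjHom_of_self ha,
        conjHom_of_self hb, conjHom_of_self hc, commutatorElement_def]
      group
  refine mulAut_ext fun j => ?_
  simp only [MulAut.mul_apply]
  by_cases hja : j = a
  · exact hvals j (Or.inl hja)
  by_cases hjb : j = b
  · exact hvals j (Or.inr hjb)
  · simp only [conjHom_of_ne _ hja, rightMul_of_ne _ hjb, conjHom_of_ne _ hjb, hf₄ _ hja,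
      hg₄ _ hjb, hi₄ _ hjb, hi₅ _ hja, hi₆ _ hjb]

end ConjugationFormulas

end FreeAut

/-! ### Normality of Magnus' subgroup under Nielsen's generators -/

namespace FreeAut

open FreeGroup (of lift)
open scoped commutatorElement

variable {ι : Type*} [DecidableEq ι]

theorem commutatorElement_mem_avoiding {ι : Type*} {a b c : ι} (hb : b ≠ a) (hc : c ≠ a) :
    ⁅(of b : FreeGroup ι), of c⁆ ∈ avoiding a :=
  mul_mem (mul_mem (mul_mem (of_mem_avoiding hb) (of_mem_avoiding hc))
    (inv_mem (of_mem_avoiding hb))) (inv_mem (of_mem_avoiding hc))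

theorem rightHom_commutator_inv (a b c : ι) :
    (rightHom a ⁅(of b : FreeGroup ι), of c⁆)⁻¹ = rightHom a ⁅of c, of b⁆ := by
  rw [← map_inv, commutatorElement_inv]

theorem rightMul_conj_mem {a b : ι} (hab : a ≠ b) {f : MulAut (FreeGroup ι)}
    (hf : f ∈ magnusGenerators ι) :
    rightMul b a * f * (rightMul b a)⁻¹ ∈ magnusSubgroup ι := by
  have hswap : ∀ c, c ≠ a → c ≠ b →
      rightMul b a * rightHom a ⁅of b, of c⁆ * (rightMul b a)⁻¹ ∈ magnusSubgroup ι := by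
    intro c hca hcb
    rw [rightMul_conj_rightHom_swap hab hca hcb]
    have h1 := fun i (w : FreeGroup ι) => conjHom_mem i w
    have h2 := fun i (x y : FreeGroup ι) => rightHom_mem (a := i) (commutatorElement_mem x y)
    have h3 := fun i (x y : FreeGroup ι) =>
      rightHom_mem (a := i) (inv_mem (commutatorElement_mem x y))
    exact mul_mem (mul_mem (mul_mem (mul_mem (mul_mem (mul_mem (mul_mem (h1 _ _) (h1 _ _)) (h1 _ _))
      (h3 _ _ _)) (h1 _ _)) (h2 _ _ _)) (h1 _ _)) (h1 _ _)
  rcases hf with ⟨e, c, hec, rfl⟩ | ⟨e, c, d, hec, hed, rfl⟩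
  · by_cases heb : e = b
    · subst heb
      rw [rightMul_conj_conjHom_same hab hec.symm]
      exact mul_mem (conjHom_mem _ _) (rightHom_mem (commutatorElement_mem _ _))
    by_cases hea : e = a
    · subst hea
      by_cases hcb : c = b
      · subst hcb
        rw [rightMul_conj_conjHom_swap hab]
        exact mul_mem (conjHom_mem _ _) (conjHom_mem _ _)
      · rw [rightMul_conj_conjHom_other hab hec.symm hcb]
        exact mul_mem (rightHom_mem (commutatorElement_mem _ _)) (conjHom_mem _ _)
    · rw [rightMul_conj_conjHom hea heb (of_mem_avoiding hec.symm)]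
      exact conjHom_mem _ _
  · by_cases heb : e = b
    · subst heb
      rw [rightMul_conj_rightHom_same]
      exact rightHom_mem (conj_mem_commutator _ (commutatorElement_mem _ _))
    by_cases hea : e = a
    · subst hea
      by_cases hcb : c = b
      · subst hcb
        by_cases hdb : d = c
        · subst hdb
          rw [commutatorElement_self, map_one, mul_one, mul_inv_cancel]
          exact one_mem _
        · exact hswap d hed.symm hdb
      by_cases hdb : d = b
      · subst hdb
        have := inv_mem (hswap c hec.symm hcb)
        rwa [mul_inv_rev, mul_inv_rev, inv_inv, rightHom_commutator_inv, ← mul_assoc] at this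
      · rw [rightMul_conj_rightHom_other hab (commutatorElement_mem_avoiding hec.symm hed.symm)
          (commutatorElement_mem_avoiding hcb hdb)]
        exact mul_mem (rightHom_mem (conj_mem_commutator _ (inv_mem (commutatorElement_mem _ _))))
          (rightHom_mem (commutatorElement_mem _ _))
    · rw [rightMul_conj_rightHom hea heb (commutatorElement_mem_avoiding hec.symm hed.symm)]
      exact rightHom_mem (map_mem_commutator (rightMul b a).toMonoidHom (commutatorElement_mem _ _))

theorem IsSignedPerm.apply_mem_avoiding {ι : Type*} {w : MulAut (FreeGroup ι)} {σ : Equiv.Perm ι}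
    (hw : IsSignedPerm w σ) {a : ι} {x : FreeGroup ι} (hx : x ∈ avoiding a) :
    w x ∈ avoiding (σ a) := by
  have := hw.apply_mem_wordsIn (D := {a}ᶜ) hx
  rwa [Set.image_compl_eq σ.bijective, Set.image_singleton] at this

/-- Both kinds of generators have the form x_e ↦ p x_e q with p q in the commutator subgroup, and
relabelling or inverting letters preserves this form. -/
theorem IsSignedPerm.conj_mem {w : MulAut (FreeGroup ι)} {σ : Equiv.Perm ι}
    (hw : IsSignedPerm w σ) {f : MulAut (FreeGroup ι)} (hf : f ∈ magnusGenerators ι) :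
    w * f * w⁻¹ ∈ magnusSubgroup ι := by
  have key : ∀ e p q, p ∈ avoiding e → q ∈ avoiding e → p * q ∈ _root_.commutator (FreeGroup ι) →
      (∀ j, j ≠ e → f (of j) = of j) → f (of e) = p * of e * q →
      w * f * w⁻¹ ∈ magnusSubgroup ι := by
    intro e p q hp hq hpq h1 h2
    have hfix : ∀ j, j ≠ σ e → (w * f * w⁻¹) (of j) = of j := by
      intro j hj
      have hj' : σ⁻¹ j ≠ e := fun h => hj (by rw [← h]; simp)
      have h3 : f (w⁻¹ (of j)) = w⁻¹ (of j) := by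
        rcases hw.inv j with h | h <;> rw [h]
        · exact h1 _ hj'
        · rw [map_inv, h1 _ hj']
      rw [MulAut.mul_apply, MulAut.mul_apply, h3, MulAut.apply_inv_self]
    have hcomm : w (p * q) ∈ _root_.commutator (FreeGroup ι) :=
      map_mem_commutator w.toMonoidHom hpq
    rcases hw e with h | h
    · refine mem_magnusSubgroup_of_apply (u := w p) (v := w q) hfix ?_ (hw.apply_mem_avoiding hp)
        (hw.apply_mem_avoiding hq) (by rwa [← map_mul])
      rw [MulAut.mul_apply, MulAut.mul_apply, inv_apply_eq_of h, h2, map_mul, map_mul, h]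
    · refine mem_magnusSubgroup_of_apply (u := (w q)⁻¹) (v := (w p)⁻¹) hfix ?_
        (inv_mem (hw.apply_mem_avoiding hq)) (inv_mem (hw.apply_mem_avoiding hp))
        (by rw [← mul_inv_rev, ← map_mul]; exact inv_mem hcomm)
      have h' : w⁻¹ (of (σ e)) = (of e)⁻¹ := inv_apply_eq_of (by rw [map_inv, h, inv_inv])
      rw [MulAut.mul_apply, MulAut.mul_apply, h', map_inv, h2, map_inv, map_mul, map_mul, h]
      group
  rcases hf with ⟨e, c, hec, rfl⟩ | ⟨e, c, d, hec, hed, rfl⟩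
  · have hc := of_mem_avoiding hec.symm
    exact key e _ _ (inv_mem hc) hc (by rw [inv_mul_cancel]; exact one_mem _)
      (fun j => conjHom_of_ne _) (conjHom_of_self hc)
  · have hw := commutatorElement_mem_avoiding hec.symm hed.symm
    exact key e _ _ (one_mem _) hw (by rw [one_mul]; exact commutatorElement_mem _ _)
      (fun j => rightHom_of_ne _) (by rw [one_mul]; exact rightHom_of_self hw)

/-- It spares a second set of conjugation formulas for inverse transvections: invariance under them
follows from invariance under sign changes. -/
theorem invGen_conj_rightMul_inv {a b : ι} (hab : a ≠ b) :
    (rightMul b a)⁻¹ = invGen a * rightMul b a * (invGen a)⁻¹ := by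
  refine mulAut_ext fun j => inv_apply_eq_of ?_
  rw [invGen_inv, MulAut.mul_apply, MulAut.mul_apply]
  by_cases hja : j = a
  · subst hja
    rw [invGen_of_self, map_inv, rightMul_of_ne _ hab, map_inv, invGen_of_self, inv_inv,
      rightMul_of_ne _ hab]
  by_cases hjb : j = b
  · subst hjb
    rw [invGen_of_ne hja, rightMul_of_self hab, map_mul, invGen_of_ne hja, invGen_of_self, map_mul,
      map_inv, rightMul_of_self hab, rightMul_of_ne _ hab]
    group
  · rw [invGen_of_ne hja, rightMul_of_ne _ hjb, invGen_of_ne hja, rightMul_of_ne _ hjb]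

/-- Nielsen's generators of `Aut (F_n)`. -/
def nielsenGenerators (ι : Type*) [DecidableEq ι] : Set (MulAut (FreeGroup ι)) :=
  {f | (∃ a i, i ≠ a ∧ f = rightMul a i) ∨ ∃ σ, IsSignedPerm f σ}

theorem closure_nielsenGenerators_le_normalizer :
    Subgroup.closure (nielsenGenerators ι) ≤ Subgroup.normalizer (magnusSubgroup ι : Set _) := by
  have hcl : ∀ f : MulAut (FreeGroup ι),
      (∀ m ∈ magnusGenerators ι, f * m * f⁻¹ ∈ magnusSubgroup ι) →
      ∀ m ∈ magnusSubgroup ι, f * m * f⁻¹ ∈ magnusSubgroup ι := by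
    intro f hf
    have : magnusSubgroup ι ≤ (magnusSubgroup ι).comap (MulAut.conj f).toMonoidHom := by
      conv_lhs => rw [magnusSubgroup]
      rw [Subgroup.closure_le]
      exact hf
    exact this
  have hiff : ∀ f : MulAut (FreeGroup ι),
      (∀ m ∈ magnusSubgroup ι, f * m * f⁻¹ ∈ magnusSubgroup ι) →
      (∀ m ∈ magnusSubgroup ι, f⁻¹ * m * f⁻¹⁻¹ ∈ magnusSubgroup ι) →
      f ∈ Subgroup.normalizer (magnusSubgroup ι : Set _) := by
    intro f h1 h2
    rw [Subgroup.mem_normalizer_iff]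
    refine fun m => ⟨h1 m, fun h => ?_⟩
    have := h2 _ h
    group at this
    exact this
  have hperm : ∀ w σ, IsSignedPerm w σ → w ∈ Subgroup.normalizer (magnusSubgroup ι : Set _) :=
    fun w σ hw => hiff w (hcl _ fun m => hw.conj_mem) (hcl _ fun m => hw.inv.conj_mem)
  rw [Subgroup.closure_le]
  rintro f (⟨b, a, hab, rfl⟩ | ⟨σ, hσ⟩)
  · refine hiff _ (hcl _ fun m => rightMul_conj_mem hab) fun m hm => ?_
    have hi := Subgroup.mem_normalizer_iff.1 (hperm _ _ (isSignedPerm_invGen a))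
    have h := (hi _).1 (hcl _ (fun m => rightMul_conj_mem hab) _ ((hi m).1 hm))
    rw [invGen_conj_rightMul_inv hab, invGen_inv]
    rw [invGen_inv] at h
    have e := invGen_inv a
    convert h using 1
    rw [mul_inv_rev, mul_inv_rev, e]
    simp only [mul_assoc]
  · exact hperm f σ hσ

end FreeAut

/-! ### Transvections act unipotently on Magnus' subgroup -/

-- Here u m u⁻¹ m⁻¹ = p · (m q m⁻¹), and conjugation by `M` does not affect polynomiality. Thus `p`
-- and `q` only have to be treated before `m`, as in a triangular system.
open scoped commutatorElement in
theorem mem_polyCurveSubgroup_of_conj_eq {Γ : Type*} [Group Γ] {M : Subgroup Γ} [M.Normal]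
    {u m p q : Γ} (hm : m ∈ M) (hp : p ∈ polyCurveSubgroup M u) (hq : q ∈ polyCurveSubgroup M u)
    (hqM : q ∈ M) (h : u * m * u⁻¹ = p * m * q) : m ∈ polyCurveSubgroup M u := by
  refine mem_polyCurveSubgroup_of_commutator hm ?_
  rw [h, mul_assoc, mul_assoc, ← mul_assoc m]
  exact mul_mem hp (conj_mem_polyCurveSubgroup hqM hm hq)

theorem IsPolyCurve.conj {Γ : Type*} [Group Γ] {M : Subgroup Γ} [M.Normal] {k : ℕ} {x : ℤ → Γ}
    (hx : IsPolyCurve M k x) (g : Γ) : IsPolyCurve M k fun t => g * x t * g⁻¹ := by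
  obtain ⟨hx, J, _, a, p, ha, hp⟩ := hx
  have hc : ∀ y, y ∈ M.lowerCentralSeries k → g * y * g⁻¹ ∈ M.lowerCentralSeries k :=
    fun y hy => Subgroup.Normal.conj_mem inferInstance y hy g
  exact ⟨fun t => hc _ (hx t), J, inferInstance, fun j => g * a j * g⁻¹, p, fun j => hc _ (ha j),
    fun χ hχ t => hp _ (hχ.comp_conj g) t⟩

theorem IsUnipotentOn.conj {Γ : Type*} [Group Γ] {M : Subgroup Γ} [M.Normal] {u : Γ}
    (hu : IsUnipotentOn M u) (g : Γ) : IsUnipotentOn M (g * u * g⁻¹) := by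
  intro m hm
  have hm' : g⁻¹ * m * g ∈ M := by
    simpa using Subgroup.Normal.conj_mem inferInstance m hm g⁻¹
  convert (hu _ hm').conj g using 2 with t
  rw [conj_zpow]
  group

namespace FreeAut

open FreeGroup (of lift)
open scoped commutatorElement

variable {ι : Type*} [DecidableEq ι] {a b : ι} [(magnusSubgroup ι).Normal]

theorem rightHom_conj_mem_polyCurveSubgroup {u : MulAut (FreeGroup ι)} {e : ι} {w : FreeGroup ι}
    (v : FreeGroup ι) (hw : w ∈ _root_.commutator (FreeGroup ι))
    (h : rightHom e w ∈ polyCurveSubgroup (magnusSubgroup ι) u) :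
    rightHom e (v * w * v⁻¹) ∈ polyCurveSubgroup (magnusSubgroup ι) u := by
  rw [← conjHom_conj_rightHom]
  exact conj_mem_polyCurveSubgroup (rightHom_mem hw) (conjHom_mem e v) h

/-- This is the bottom of the triangular system: conjugation by the transvection changes the element
only by an element of ⁅M, M⁆. -/
theorem rightHom_target_mem_polyCurveSubgroup {w : FreeGroup ι}
    (hw : w ∈ _root_.commutator (FreeGroup ι)) :
    rightHom b w ∈ polyCurveSubgroup (magnusSubgroup ι) (rightMul b a) := by
  refine mem_polyCurveSubgroup_of_commutator (rightHom_mem hw)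
    (mem_polyCurveSubgroup_of_mem_commutator ?_)
  rw [rightMul_conj_rightHom_same, ← conjHom_conj_rightHom]
  exact Subgroup.commutator_mem_commutator (conjHom_mem b (of a)) (rightHom_mem hw)

theorem conjHom_target_mem_polyCurveSubgroup (hab : a ≠ b) {c : ι} (hc : c ≠ b) :
    conjHom b (of c) ∈ polyCurveSubgroup (magnusSubgroup ι) (rightMul b a) := by
  have hw := commutatorElement_mem (of c)⁻¹ (of a)
  refine mem_polyCurveSubgroup_of_conj_eq (conjHom_mem _ _) (one_mem _)
    (rightHom_target_mem_polyCurveSubgroup hw) (rightHom_mem hw) ?_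
  rw [rightMul_conj_conjHom_same hab hc, one_mul]

theorem conjHom_source_mem_polyCurveSubgroup (hab : a ≠ b) {c : ι} (hca : c ≠ a) :
    conjHom a (of c) ∈ polyCurveSubgroup (magnusSubgroup ι) (rightMul b a) := by
  by_cases hcb : c = b
  · subst hcb
    refine mem_polyCurveSubgroup_of_conj_eq (conjHom_mem _ _)
      (conjHom_target_mem_polyCurveSubgroup hab hab) (one_mem _) (one_mem _) ?_
    rw [rightMul_conj_conjHom_swap hab, mul_one]
  · refine mem_polyCurveSubgroup_of_conj_eq (conjHom_mem _ _)
      (rightHom_target_mem_polyCurveSubgroup (commutatorElement_mem (of a) (of c)⁻¹)) (one_mem _)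
      (one_mem _) ?_
    rw [rightMul_conj_conjHom_other hab hca hcb, mul_one]

theorem rightHom_source_mem_polyCurveSubgroup (hab : a ≠ b) {c d : ι} (hca : c ≠ a) (hda : d ≠ a) :
    rightHom a ⁅of c, of d⁆ ∈ polyCurveSubgroup (magnusSubgroup ι) (rightMul b a) := by
  have hswap : ∀ c, c ≠ a → c ≠ b →
      rightHom a ⁅of b, of c⁆ ∈ polyCurveSubgroup (magnusSubgroup ι) (rightMul b a) := by
    intro c hca hcb
    have hba := conjHom_target_mem_polyCurveSubgroup hab hab
    have hac := conjHom_source_mem_polyCurveSubgroup hab hab.symm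
    have hbc := conjHom_target_mem_polyCurveSubgroup hab hcb
    refine mem_polyCurveSubgroup_of_conj_eq (rightHom_mem (commutatorElement_mem _ _))
      -- The factors surrounding `rightHom a ⁅of b, of c⁆` in `rightMul_conj_rightHom_swap`, all
      -- treated earlier.
      (p := conjHom b (of a) * conjHom a (of b) * conjHom b (of c)⁻¹ * rightHom b ⁅of a, of c⁆⁻¹ *
        conjHom a (of b)⁻¹) (q := conjHom a (of c) * conjHom b (of a)⁻¹) ?_ ?_
      (mul_mem (conjHom_mem _ _) (conjHom_mem _ _)) ?_
    · refine mul_mem (mul_mem (mul_mem (mul_mem hba hac) ?_)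
        (rightHom_target_mem_polyCurveSubgroup (inv_mem (commutatorElement_mem _ _)))) ?_
      · rw [map_inv]; exact inv_mem hbc
      · rw [map_inv]; exact inv_mem hac
    · refine mul_mem (conjHom_source_mem_polyCurveSubgroup hab hca) ?_
      rw [map_inv]; exact inv_mem hba
    · rw [rightMul_conj_rightHom_swap hab hca hcb]
      simp only [mul_assoc]
  by_cases hcb : c = b
  · subst hcb
    by_cases hdb : d = c
    · subst hdb
      rw [commutatorElement_self, map_one]
      exact one_mem _
    · exact hswap d hda hdb
  by_cases hdb : d = b
  · subst hdb
    rw [← rightHom_commutator_inv]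
    exact inv_mem (hswap c hca hcb)
  · refine mem_polyCurveSubgroup_of_conj_eq (rightHom_mem (commutatorElement_mem _ _))
      (rightHom_target_mem_polyCurveSubgroup
        (conj_mem_commutator (of a) (inv_mem (commutatorElement_mem (of c) (of d)))))
      (one_mem _) (one_mem _) ?_
    rw [rightMul_conj_rightHom_other hab (commutatorElement_mem_avoiding hca hda)
      (commutatorElement_mem_avoiding hcb hdb), mul_one]

theorem conjHom_other_mem_polyCurveSubgroup (hab : a ≠ b) {e c : ι} (hea : e ≠ a) (heb : e ≠ b)
    (hc : c ≠ e) : conjHom e (of c) ∈ polyCurveSubgroup (magnusSubgroup ι) (rightMul b a) := by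
  have h1 : ∀ c, c ≠ e → c ≠ b →
      conjHom e (of c) ∈ polyCurveSubgroup (magnusSubgroup ι) (rightMul b a) := by
    intro c hc hcb
    refine mem_polyCurveSubgroup_of_conj_eq (conjHom_mem _ _) (one_mem _) (one_mem _) (one_mem _) ?_
    rw [rightMul_conj_conjHom hea heb (of_mem_avoiding hc), rightMul_of_ne _ hcb, one_mul, mul_one]
  by_cases hcb : c = b
  · subst hcb
    refine mem_polyCurveSubgroup_of_conj_eq (conjHom_mem _ _) (one_mem _) (h1 a hea.symm hab)
      (conjHom_mem _ _) ?_
    rw [rightMul_conj_conjHom hea heb (of_mem_avoiding hc), rightMul_of_self hab, one_mul, map_mul]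
  · exact h1 c hc hcb

theorem rightHom_other_mem_polyCurveSubgroup (hab : a ≠ b) {e c d : ι} (hea : e ≠ a) (heb : e ≠ b)
    (hc : c ≠ e) (hd : d ≠ e) :
    rightHom e ⁅of c, of d⁆ ∈ polyCurveSubgroup (magnusSubgroup ι) (rightMul b a) := by
  have h1 : ∀ c d, c ≠ e → d ≠ e → c ≠ b → d ≠ b →
      rightHom e ⁅of c, of d⁆ ∈ polyCurveSubgroup (magnusSubgroup ι) (rightMul b a) := by
    intro c d hc hd hcb hdb
    refine mem_polyCurveSubgroup_of_conj_eq (rightHom_mem (commutatorElement_mem _ _)) (one_mem _)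
      (one_mem _) (one_mem _) ?_
    rw [rightMul_conj_rightHom hea heb (commutatorElement_mem_avoiding hc hd),
      map_commutatorElement, rightMul_of_ne _ hcb, rightMul_of_ne _ hdb, one_mul, mul_one]
  -- When x_b becomes x_b x_a, the commutator ⁅x_b, x_d⁆ gains a conjugate of ⁅x_a, x_d⁆, which the
  -- transvection fixes.
  have h2 : ∀ d, d ≠ e → d ≠ b →
      rightHom e ⁅of b, of d⁆ ∈ polyCurveSubgroup (magnusSubgroup ι) (rightMul b a) := by
    intro d hd hdb
    refine mem_polyCurveSubgroup_of_conj_eq (rightHom_mem (commutatorElement_mem _ _))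
      (rightHom_conj_mem_polyCurveSubgroup (of b) (commutatorElement_mem _ _)
        (h1 a d hea.symm hd hab hdb)) (one_mem _) (one_mem _) ?_
    rw [rightMul_conj_rightHom hea heb (commutatorElement_mem_avoiding heb.symm hd),
      map_commutatorElement, rightMul_of_self hab, rightMul_of_ne _ hdb, mul_one, ← map_mul]
    congr 1
    simp only [commutatorElement_def]
    group
  by_cases hcb : c = b
  · subst hcb
    by_cases hdb : d = c
    · subst hdb
      rw [commutatorElement_self, map_one]
      exact one_mem _
    · exact h2 d hd hdb
  by_cases hdb : d = b
  · subst hdb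
    rw [← rightHom_commutator_inv]
    exact inv_mem (h2 c hc hcb)
  · exact h1 c d hc hd hcb hdb

theorem isUnipotentOn_rightMul (hab : a ≠ b) :
    IsUnipotentOn (magnusSubgroup ι) (rightMul b a) := by
  refine IsUnipotentOn.of_closure (S := magnusGenerators ι) rfl ?_
  rintro _ (⟨e, c, hec, rfl⟩ | ⟨e, c, d, hec, hed, rfl⟩)
  · by_cases heb : e = b
    · subst heb; exact conjHom_target_mem_polyCurveSubgroup hab hec.symm
    by_cases hea : e = a
    · subst hea; exact conjHom_source_mem_polyCurveSubgroup hab hec.symm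
    exact conjHom_other_mem_polyCurveSubgroup hab hea heb hec.symm
  · by_cases heb : e = b
    · subst heb; exact rightHom_target_mem_polyCurveSubgroup (commutatorElement_mem _ _)
    by_cases hea : e = a
    · subst hea; exact rightHom_source_mem_polyCurveSubgroup hab hec.symm hed.symm
    exact rightHom_other_mem_polyCurveSubgroup hab hea heb hec.symm hed.symm

theorem isUnipotentOn_of_mem_transvections {u : MulAut (FreeGroup ι)} (hu : u ∈ transvections ι) :
    IsUnipotentOn (magnusSubgroup ι) u := by
  obtain ⟨g, a, i, hi, rfl⟩ := hu
  exact (isUnipotentOn_rightMul hi).conj g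

end FreeAut

/-! ### Common prefixes and cancellation in free groups -/

namespace FreeGroup

section CommonPrefix

variable {β : Type*} [DecidableEq β]

/-- The length of the longest common prefix of two lists. -/
def commonPrefixLength : List β → List β → ℕ
  | a :: l, b :: m => if a = b then commonPrefixLength l m + 1 else 0
  | _, _ => 0

theorem commonPrefixLength_nil_left (l : List β) : commonPrefixLength [] l = 0 := by
  simp [commonPrefixLength]

theorem commonPrefixLength_nil_right (l : List β) : commonPrefixLength l [] = 0 := by
  cases l <;> simp [commonPrefixLength]

theorem commonPrefixLength_self (l : List β) : commonPrefixLength l l = l.length := by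
  induction l <;> simp [commonPrefixLength, *]

theorem commonPrefixLength_comm (l m : List β) :
    commonPrefixLength l m = commonPrefixLength m l := by
  induction l generalizing m with
  | nil => rw [commonPrefixLength_nil_left, commonPrefixLength_nil_right]
  | cons a l ih => cases m <;> simp [commonPrefixLength, ih, eq_comm]

/-- The ultrametric inequality for words. -/
theorem min_commonPrefixLength_le (l m r : List β) :
    min (commonPrefixLength l m) (commonPrefixLength m r) ≤ commonPrefixLength l r := by
  induction l generalizing m r with
  | nil => simp [commonPrefixLength_nil_left]
  | cons a l ih =>
    cases m with
    | nil => simp [commonPrefixLength]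
    | cons b m =>
      cases r with
      | nil => simp [commonPrefixLength]
      | cons c r =>
        have := ih m r
        simp only [commonPrefixLength]
        split_ifs <;> first | omega | simp_all

theorem take_commonPrefixLength (l m : List β) :
    l.take (commonPrefixLength l m) = m.take (commonPrefixLength l m) := by
  induction l generalizing m with
  | nil => simp [commonPrefixLength_nil_left]
  | cons a l ih =>
    cases m with
    | nil => simp [commonPrefixLength]
    | cons b m =>
      simp only [commonPrefixLength]
      split_ifs with h
      · simp [h, ih m]
      · simp

end CommonPrefix

variable {ι : Type*}

theorem IsReduced.invRev {L : List (ι × Bool)} (h : IsReduced L) : IsReduced (invRev L) := by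
  classical
  rw [isReduced_iff_reduce_eq] at *
  rw [reduce_invRev, h]

variable [DecidableEq ι]

/-- The length of the longest common prefix of the reduced words of `g` and `h`. -/
def cp (g h : FreeGroup ι) : ℕ := commonPrefixLength g.toWord h.toWord

theorem cp_comm (g h : FreeGroup ι) : cp g h = cp h g := commonPrefixLength_comm _ _

theorem cp_self (g : FreeGroup ι) : cp g g = g.norm := commonPrefixLength_self _

theorem cp_eq_of_lt {g h k : FreeGroup ι} (hlt : cp g h < cp h k) : cp g k = cp g h := by
  have h1 := min_commonPrefixLength_le g.toWord h.toWord k.toWord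
  have h2 := min_commonPrefixLength_le g.toWord k.toWord h.toWord
  rw [commonPrefixLength_comm k.toWord h.toWord] at h2
  unfold cp at *
  omega

theorem IsReduced.norm_mk {L : List (ι × Bool)} (h : IsReduced L) : norm (mk L) = L.length := by
  rw [norm, toWord_mk, h.reduce_eq]

/-- The common prefix is exactly what cancels in g⁻¹h; once the first letters differ, the
concatenation is reduced. -/
theorem norm_inv_mul_add (g h : FreeGroup ι) : norm (g⁻¹ * h) + 2 * cp g h = norm g + norm h := by
  have key : ∀ l m : List (ι × Bool), IsReduced l → IsReduced m →
      norm ((mk l)⁻¹ * mk m) + 2 * commonPrefixLength l m = l.length + m.length := by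
    intro l
    induction l with
    | nil =>
      intro m _ hm
      simp [commonPrefixLength_nil_left, ← one_eq_mk, hm.norm_mk]
    | cons a l ih =>
      intro m hl hm
      cases m with
      | nil =>
        simp only [commonPrefixLength_nil_right, ← one_eq_mk, mul_one, norm_inv_eq, hl.norm_mk]
        simp
      | cons b m =>
        by_cases hab : a = b
        · subst hab
          have := ih m (hl.infix (List.suffix_cons a l).isInfix)
            (hm.infix (List.suffix_cons a m).isInfix)
          have e : (mk (a :: l))⁻¹ * mk (a :: m) = (mk l)⁻¹ * mk m := by
            rw [← List.singleton_append, ← List.singleton_append (l := m), ← mul_mk, ← mul_mk]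
            group
          simp only [commonPrefixLength, if_true, e, List.length_cons]
          omega
        · have hred : IsReduced (FreeGroup.invRev (a :: l) ++ b :: m) := by
            rw [invRev_cons]
            refine List.isChain_append.2 ⟨?_, hm, ?_⟩
            · rw [← invRev_cons]; exact hl.invRev
            · intro x hx y hy
              simp only [FreeGroup.invRev, List.map_cons, List.map_nil, List.reverse_singleton,
                List.getLast?_append, List.getLast?_singleton, Option.some_or, Option.mem_def,
                Option.some.injEq] at hx
              simp only [List.head?_cons, Option.mem_def, Option.some.injEq] at hy
              subst hx hy
              rintro h1
              obtain ⟨a1, a2⟩ := a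
              obtain ⟨b1, b2⟩ := b
              simp only at h1
              subst h1
              cases a2 <;> cases b2 <;> simp_all
          rw [inv_mk, mul_mk, hred.norm_mk]
          simp [commonPrefixLength, hab]
  have := key g.toWord h.toWord isReduced_toWord isReduced_toWord
  rwa [mk_toWord, mk_toWord] at this

/-- Squaring doubles the cyclically reduced core, which is nonempty, and leaves the conjugating part
unchanged. -/
theorem norm_lt_norm_mul_self {g : FreeGroup ι} (hg : g ≠ 1) : norm g < norm (g * g) := by
  have h1 := reduceCyclically.reduce_flatten_replicate_succ (isReduced_toWord (x := g)) 0
  have h2 := reduceCyclically.reduce_flatten_replicate_succ (isReduced_toWord (x := g)) 1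
  have e : norm (g * g) = (reduce (List.replicate 2 g.toWord).flatten).length := by
    simp [norm, toWord_mul]
  have e1 : norm g = (reduce (List.replicate 1 g.toWord).flatten).length := by
    simp [norm]
  rw [e, e1, h1, h2]
  have hne : reduceCyclically g.toWord ≠ [] := by
    intro h
    have := reduceCyclically.conj_conjugator_reduceCyclically g.toWord
    rw [h, List.append_nil] at this
    apply hg
    rw [← mk_toWord (x := g), ← this, ← mul_mk, ← inv_mk, mul_inv_cancel]
  have := List.length_pos_iff.2 hne
  simp only [List.length_append, List.length_flatten, List.map_replicate, List.sum_replicate,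
    smul_eq_mul]
  omega

end FreeGroup

/-! ### Nielsen's length estimate and the tie-breaking weight -/

namespace FreeGroup

section

variable {ι : Type*} [DecidableEq ι]

/-- If a part of every factor survives the cancellation on both sides, then a
reduced product of `n` factors has length at least `n`. -/
theorem length_le_norm_prod {β : Type*} (R : β → β → Prop) (y : β → FreeGroup ι)
    (hsymm : ∀ b, R b b)
    (hy : ∀ b, y b ≠ 1)
    (h1 : ∀ a b, R a b → 2 * cp (y a)⁻¹ (y b) ≤ norm (y a) ∧ 2 * cp (y a)⁻¹ (y b) ≤ norm (y b))
    (h2 : ∀ a b c, R a b → R b c → cp (y a)⁻¹ (y b) + cp (y b)⁻¹ (y c) < norm (y b))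
    (L : List β) (hL : L.IsChain R) : L.length ≤ norm (L.map y).prod := by
  -- The second inequality keeps the induction going: the product still begins with more of `y b`
  -- than a preceding `y a` can cancel.
  have key : ∀ (L : List β) (b : β), (b :: L).IsChain R → ∀ a, R a b →
      cp (y a)⁻¹ (y b) + (b :: L).length ≤ norm ((b :: L).map y).prod ∧
        cp (y a)⁻¹ (y b) < cp ((b :: L).map y).prod (y b) := by
    intro L
    induction L with
    | nil =>
      intro b _ a hab
      have hpos : norm (y b) ≠ 0 := by rw [Ne, norm_eq_zero]; exact hy b
      have := h1 a b hab
      simp only [List.map_cons, List.map_nil, List.prod_singleton, List.length_singleton, cp_self]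
      omega
    | cons c L ih =>
      intro b hL a hab
      rw [List.isChain_cons_cons] at hL
      obtain ⟨ih1, ih2⟩ := ih c hL.2 b hL.1
      have h2' := h2 a b c hab hL.1
      rw [List.map_cons, List.prod_cons]
      generalize hW : (List.map y (c :: L)).prod = W at *
      have e : cp (y b)⁻¹ W = cp (y b)⁻¹ (y c) := by
        apply cp_eq_of_lt
        rwa [cp_comm (y c)]
      have n1 := norm_inv_mul_add (y b)⁻¹ W
      have n2 := norm_inv_mul_add (y b * W) (y b)
      rw [inv_inv, norm_inv_eq, e] at n1
      have e2 : norm ((y b * W)⁻¹ * y b) = norm W := by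
        rw [← norm_inv_eq (x := W)]; congr 1; group
      rw [e2] at n2
      simp only [List.length_cons] at *
      omega
  cases L with
  | nil => simp
  | cons b L => have := (key L b hL b (hsymm b)).1; omega

end

section Tie

variable {ι : Type*} (e : ι × Bool → ℕ) (N : ℕ)

/-- A numerical encoding of words, compatible with the lexicographic order on words of the same
length. -/
def encode (L : List (ι × Bool)) : ℕ := Nat.ofDigits N (L.reverse.map e)

theorem encode_append (L M : List (ι × Bool)) :
    encode e N (L ++ M) = encode e N M + N ^ M.length * encode e N L := by
  rw [encode, List.reverse_append, List.map_append, Nat.ofDigits_append]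
  simp [encode]

variable {e N}

theorem encode_injective (hN : 1 < N) (he : Function.Injective e) (hlt : ∀ a, e a < N)
    {L M : List (ι × Bool)} (hLM : L.length = M.length) (h : encode e N L = encode e N M) :
    L = M := by
  have hd : ∀ K : List (ι × Bool), ∀ l ∈ K.reverse.map e, l < N := by
    intro K l hl
    obtain ⟨a, -, rfl⟩ := List.mem_map.1 hl
    exact hlt a
  have := Nat.ofDigits_inj_of_len_eq hN (by simpa using hLM) (hd L) (hd M) h
  exact List.reverse_injective (List.map_injective_iff.2 he this)

variable [DecidableEq ι] (e N)

/-- The first half of the reduced word of `g`. -/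
def half (g : FreeGroup ι) : List (ι × Bool) := g.toWord.take ((g.norm + 1) / 2)

/-- The quantity used to choose between words of the same length in Nielsen's method. -/
def tieWeight (g : FreeGroup ι) : ℕ := encode e N (half g) + encode e N (half g⁻¹)

theorem tieWeight_inv (g : FreeGroup ι) : tieWeight e N g⁻¹ = tieWeight e N g := by
  rw [tieWeight, tieWeight, inv_inv, add_comm]

variable {e N}

/-- Write y = p q⁻¹ with halves of equal length, and z = q r. Then y z = p r has the length of z,
and its initial half is that of z with `q` replaced by the smaller `p`. -/
theorem tieWeight_mul_lt (hN : 1 < N) {y z : FreeGroup ι} (hy : 2 * cp y⁻¹ z = norm y)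
    (hz : 2 * cp y⁻¹ z ≤ norm z)
    (hlt : encode e N (y.toWord.take (norm y / 2)) < encode e N (y⁻¹.toWord.take (norm y / 2))) :
    tieWeight e N (y * z) < tieWeight e N z := by
  have hh : cp y⁻¹ z = norm y / 2 := by omega
  set p := y.toWord.take (norm y / 2) with hp
  set q := y⁻¹.toWord.take (norm y / 2) with hq
  set r := z.toWord.drop (norm y / 2) with hr
  have hqz : q = z.toWord.take (norm y / 2) := by
    rw [hq, ← hh]; exact take_commonPrefixLength _ _
  have hzw : z.toWord = q ++ r := by rw [hqz, hr, List.take_append_drop]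
  have hpl : p.length = norm y / 2 := by
    rw [hp, List.length_take]; change min _ (norm y) = _; omega
  have hql : q.length = norm y / 2 := by
    rw [hq, List.length_take]; change min _ (norm y⁻¹) = _; rw [norm_inv_eq]; omega
  have hyw : y.toWord = p ++ FreeGroup.invRev q := by
    have e1 : y.toWord = p ++ y.toWord.drop (norm y / 2) := by rw [hp, List.take_append_drop]
    have e2 : FreeGroup.invRev y.toWord =
        FreeGroup.invRev (y.toWord.drop (norm y / 2)) ++ FreeGroup.invRev p := by
      rw [← FreeGroup.invRev_append, ← e1]
    have e3 : q = FreeGroup.invRev (y.toWord.drop (norm y / 2)) := by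
      rw [hq, toWord_inv, e2, List.take_left']
      rw [FreeGroup.invRev_length, List.length_drop]
      change norm y - _ = _
      omega
    rw [e3, FreeGroup.invRev_invRev, ← e1]
  have hmul : y * z = mk (p ++ r) := by
    rw [← mk_toWord (x := y), ← mk_toWord (x := z), hyw, hzw]
    simp only [← mul_mk, ← inv_mk]
    group
  have hn := norm_inv_mul_add y⁻¹ z
  rw [inv_inv, norm_inv_eq] at hn
  have hzl : norm z = q.length + r.length := by
    rw [← List.length_append, ← hzw]; rfl
  have hyz : (y * z).toWord = p ++ r := by
    have hs : (reduce (p ++ r)).Sublist (p ++ r) := Red.sublist reduce.red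
    rw [hmul, toWord_mk]
    refine hs.eq_of_length ?_
    rw [← toWord_mk, ← hmul, List.length_append]
    change norm (y * z) = _
    omega
  have hnorm : norm (y * z) = norm z := by omega
  have key : ∀ t : List (ι × Bool), encode e N (p ++ t) < encode e N (q ++ t) := by
    intro t
    rw [encode_append, encode_append]
    have : 0 < N ^ t.length := by positivity
    gcongr
  have half1 : half z = q ++ r.take ((norm z + 1) / 2 - norm y / 2) := by
    rw [half, hzw, List.take_append, hql, List.take_of_length_le (by omega)]
  have half2 : half (y * z) = p ++ r.take ((norm z + 1) / 2 - norm y / 2) := by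
    rw [half, hyz, hnorm, List.take_append, hpl, List.take_of_length_le (by omega)]
  -- Since `q` takes up at most half of `z`, the final half lies inside `r` and is unaffected.
  have half3 : half (y * z)⁻¹ = half z⁻¹ := by
    rw [half, half, toWord_inv, toWord_inv, hyz, hzw, norm_inv_eq, norm_inv_eq, hnorm,
      FreeGroup.invRev_append, FreeGroup.invRev_append,
      List.take_append_of_le_length (by rw [FreeGroup.invRev_length]; omega),
      List.take_append_of_le_length (by rw [FreeGroup.invRev_length]; omega)]
  rw [tieWeight, tieWeight, half1, half2, half3]
  have := key (r.take ((norm z + 1) / 2 - norm y / 2))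
  omega

/-- Equal codes mean p = q, so y = p p⁻¹. -/
theorem eq_one_of_encode_eq (hN : 1 < N) (he : Function.Injective e) (hlt : ∀ a, e a < N)
    {y : FreeGroup ι} (hy : Even (norm y))
    (h : encode e N (y.toWord.take (norm y / 2)) = encode e N (y⁻¹.toWord.take (norm y / 2))) :
    y = 1 := by
  have hl : y.toWord.length = norm y := rfl
  have h' := encode_injective hN he hlt (by
    rw [List.length_take, List.length_take]
    change min _ (norm y) = min _ (norm y⁻¹)
    rw [norm_inv_eq]) h
  have e1 : y.toWord = y.toWord.take (norm y / 2) ++ y.toWord.drop (norm y / 2) :=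
    (List.take_append_drop _ _).symm
  have e3 : y⁻¹.toWord.take (norm y / 2) = FreeGroup.invRev (y.toWord.drop (norm y / 2)) := by
    conv_lhs => rw [toWord_inv, e1, FreeGroup.invRev_append]
    rw [List.take_left']
    rw [FreeGroup.invRev_length, List.length_drop]
    obtain ⟨m, hm⟩ := hy
    omega
  rw [e3] at h'
  rw [← mk_toWord (x := y), e1, h', ← mul_mk, ← inv_mk, inv_mul_cancel]

end Tie

end FreeGroup

/-! ### Nielsen's theorem -/

namespace FreeAut

open FreeGroup (of lift cp norm)

variable {ι : Type*}

/-- The element of the free group given by a letter. -/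
def letter (l : ι × Bool) : FreeGroup ι := FreeGroup.mk [l]

/-- The inverse letter. -/
def invLetter (l : ι × Bool) : ι × Bool := (l.1, !l.2)

theorem letter_true (i : ι) : letter (i, true) = of i := rfl

theorem letter_invLetter (l : ι × Bool) : letter (invLetter l) = (letter l)⁻¹ := rfl

theorem letter_false (i : ι) : letter (i, false) = (of i)⁻¹ := rfl

theorem prod_map_letter (L : List (ι × Bool)) : (L.map letter).prod = FreeGroup.mk L := by
  induction L with
  | nil => rfl
  | cons a L ih => rw [List.map_cons, List.prod_cons, ih]; rfl

theorem letter_ne_one (l : ι × Bool) : letter l ≠ 1 := by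
  obtain ⟨i, b⟩ := l
  cases b
  · rw [letter_false]; simp
  · rw [letter_true]; simp

theorem map_letter_ne_one (f : MulAut (FreeGroup ι)) (l : ι × Bool) : f (letter l) ≠ 1 := by
  rw [Ne, EmbeddingLike.map_eq_one_iff]
  exact letter_ne_one l

variable [DecidableEq ι]

theorem exists_nielsen_move {l m : ι × Bool} (h : l.1 ≠ m.1) :
    ∃ g ∈ Subgroup.closure (nielsenGenerators ι), (∀ j, j ≠ l.1 → g (of j) = of j) ∧
      g (letter l) = letter l * letter m := by
  obtain ⟨a, s⟩ := l
  obtain ⟨i, t⟩ := m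
  change a ≠ i at h
  have hr : rightMul a i ∈ Subgroup.closure (nielsenGenerators ι) :=
    Subgroup.subset_closure (Or.inl ⟨a, i, h.symm, rfl⟩)
  have hi : invGen a ∈ Subgroup.closure (nielsenGenerators ι) :=
    Subgroup.subset_closure (Or.inr ⟨1, isSignedPerm_invGen a⟩)
  have hl : leftMul a i ∈ Subgroup.closure (nielsenGenerators ι) := by
    rw [← invGen_conj_rightMul]
    exact mul_mem (mul_mem hi hr) (inv_mem hi)
  cases s <;> cases t <;> simp only [letter_true, letter_false]
  · refine ⟨(leftMul a i)⁻¹, inv_mem hl, fun j => leftMul_inv_of_ne i, ?_⟩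
    rw [map_inv, leftMul_inv_of_self h.symm, mul_inv_rev]
  · refine ⟨leftMul a i, hl, fun j => leftMul_of_ne i, ?_⟩
    rw [map_inv, leftMul_of_self h.symm, mul_inv_rev, inv_inv]
  · exact ⟨(rightMul a i)⁻¹, inv_mem hr, fun j => rightMul_inv_of_ne i,
      rightMul_inv_of_self h.symm⟩
  · exact ⟨rightMul a i, hr, fun j => rightMul_of_ne i, rightMul_of_self h.symm⟩

/-- A Nielsen move alters one basis image, so the total weight changes by the change at that letter;
invariance under inversion allows inverse letters. -/
theorem sum_comp_add_of_eq_off [Fintype ι] {w : FreeGroup ι → ℕ} (hw : ∀ x, w x⁻¹ = w x)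
    {f g : MulAut (FreeGroup ι)} {l : ι × Bool} (h : ∀ j, j ≠ l.1 → f (of j) = g (of j)) :
    ∑ i, w (f (of i)) + w (g (letter l)) = ∑ i, w (g (of i)) + w (f (letter l)) := by
  have e : ∀ f : MulAut (FreeGroup ι), w (f (letter l)) = w (f (of l.1)) := by
    intro f
    obtain ⟨i, b⟩ := l
    cases b
    · rw [letter_false, map_inv, hw]
    · rw [letter_true]
  rw [e, e, Fintype.sum_eq_add_sum_compl l.1, Fintype.sum_eq_add_sum_compl l.1 (fun i => w (g _)),
    Finset.sum_congr rfl fun i hi => by rw [h i (by simpa using hi)]]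
  ring

/-- A Nielsen-minimal automorphism. -/
theorem exists_minimal [Fintype ι] (e : ι × Bool → ℕ) (N : ℕ) (f : MulAut (FreeGroup ι)) :
    ∃ g ∈ Subgroup.closure (nielsenGenerators ι), ∀ l m : ι × Bool, l.1 ≠ m.1 →
      norm ((f * g) (letter l)) ≤ norm ((f * g) (letter l) * (f * g) (letter m)) ∧
      (norm ((f * g) (letter l)) = norm ((f * g) (letter l) * (f * g) (letter m)) →
        FreeGroup.tieWeight e N ((f * g) (letter l)) ≤
          FreeGroup.tieWeight e N ((f * g) (letter l) * (f * g) (letter m))) := by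
  -- Total length is minimized first, and ties are broken by the total tie weight.
  let wt : Subgroup.closure (nielsenGenerators ι) → ℕ ×ₗ ℕ := fun g =>
    toLex (∑ i, norm ((f * (g : MulAut (FreeGroup ι))) (of i)),
      ∑ i, FreeGroup.tieWeight e N ((f * (g : MulAut (FreeGroup ι))) (of i)))
  obtain ⟨⟨g, hgm⟩, -, hg⟩ := WellFounded.has_min (InvImage.wf wt wellFounded_lt) Set.univ
    Set.univ_nonempty
  refine ⟨g, hgm, fun l m hlm => ?_⟩
  obtain ⟨s, hs, hs1, hs2⟩ := exists_nielsen_move hlm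
  have hmin := hg (⟨g, hgm⟩ * ⟨s, hs⟩) (Set.mem_univ _)
  have hoff : ∀ j, j ≠ l.1 → (f * (g * s)) (of j) = (f * g) (of j) := by
    intro j hj
    rw [← mul_assoc]
    change (f * g) (s (of j)) = _
    rw [hs1 j hj]
  have hon : (f * (g * s)) (letter l) = (f * g) (letter l) * (f * g) (letter m) := by
    rw [← mul_assoc]
    change (f * g) (s (letter l)) = _
    rw [hs2, map_mul]
  have e1 := sum_comp_add_of_eq_off (fun x => FreeGroup.norm_inv_eq (x := x)) hoff
  have e2 := sum_comp_add_of_eq_off (FreeGroup.tieWeight_inv e N) hoff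
  rw [hon] at e1 e2
  change ¬ (wt (⟨g, hgm⟩ * ⟨s, hs⟩) < wt ⟨g, hgm⟩) at hmin
  rw [Prod.Lex.toLex_lt_toLex] at hmin
  simp only [Subgroup.coe_mul] at hmin
  constructor
  · by_contra hlt
    exact hmin (Or.inl (by omega))
  · intro heq
    by_contra hlt
    exact hmin (Or.inr ⟨by omega, by omega⟩)

theorem isSignedPerm_of_apply_inv [Finite ι] {f : MulAut (FreeGroup ι)}
    (h : ∀ i, ∃ l, f (of i) = letter l) : ∃ σ, IsSignedPerm f σ := by
  choose l hl using h
  have hinj : Function.Injective fun i => (l i).1 := by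
    intro i j hij
    change (l i).1 = (l j).1 at hij
    have h2 : f (of i) = f (of j) ∨ f (of i) = f (of j)⁻¹ := by
      rw [map_inv, hl, hl]
      generalize l i = p at *
      generalize l j = q at *
      obtain ⟨a, s⟩ := p
      obtain ⟨b, t⟩ := q
      simp only at hij
      subst hij
      cases s <;> cases t <;> simp [letter_true, letter_false]
    rcases h2 with h2 | h2
    · exact FreeGroup.of_injective (f.injective h2)
    · have := congrArg FreeGroup.toWord (f.injective h2)
      simp [FreeGroup.toWord_inv, FreeGroup.invRev] at this
  refine ⟨Equiv.ofBijective _ (Finite.injective_iff_bijective.1 hinj), fun i => ?_⟩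
  rw [hl]
  change letter (l i) = of (l i).1 ∨ letter (l i) = (of (l i).1)⁻¹
  generalize l i = p
  obtain ⟨a, s⟩ := p
  cases s
  · exact Or.inr rfl
  · exact Or.inl rfl

/-- Minimality makes the images of the letters Nielsen reduced, so a reduced word of length m in
them has length at least m. As x_i has length 1, it is the image of a single letter. -/
theorem exists_apply_eq_letter {e : ι × Bool → ℕ} {N : ℕ} (hN : 1 < N)
    (he : Function.Injective e) (hlt : ∀ a, e a < N) {f : MulAut (FreeGroup ι)}
    (hf : ∀ l m : ι × Bool, l.1 ≠ m.1 →
      norm (f (letter l)) ≤ norm (f (letter l) * f (letter m)) ∧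
      (norm (f (letter l)) = norm (f (letter l) * f (letter m)) →
        FreeGroup.tieWeight e N (f (letter l)) ≤
          FreeGroup.tieWeight e N (f (letter l) * f (letter m)))) (i : ι) :
    ∃ l, f⁻¹ (of i) = letter l := by
  have hinv : ∀ l, (f (letter l))⁻¹ = f (letter (invLetter l)) := fun l => by
    rw [letter_invLetter, map_inv]
  have hlast : ∀ l m : ι × Bool, l.1 ≠ m.1 →
      norm (f (letter m)) ≤ norm (f (letter l) * f (letter m)) ∧
      (norm (f (letter m)) = norm (f (letter l) * f (letter m)) →
        FreeGroup.tieWeight e N (f (letter m)) ≤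
          FreeGroup.tieWeight e N (f (letter l) * f (letter m))) := by
    intro l m hlm
    have := hf (invLetter m) (invLetter l) hlm.symm
    rwa [← hinv, ← hinv, ← mul_inv_rev, FreeGroup.norm_inv_eq, FreeGroup.norm_inv_eq,
      FreeGroup.tieWeight_inv, FreeGroup.tieWeight_inv] at this
  have hne : ∀ l m : ι × Bool, l.1 ≠ m.1 →
      2 * cp (f (letter l))⁻¹ (f (letter m)) ≤ norm (f (letter l)) ∧
      2 * cp (f (letter l))⁻¹ (f (letter m)) ≤ norm (f (letter m)) := by
    intro l m hlm
    have h1 := (hf l m hlm).1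
    have h2 := (hlast l m hlm).1
    have h3 := FreeGroup.norm_inv_mul_add (f (letter l))⁻¹ (f (letter m))
    rw [inv_inv, FreeGroup.norm_inv_eq] at h3
    omega
  have hself : ∀ l, 2 * cp (f (letter l))⁻¹ (f (letter l)) < norm (f (letter l)) := by
    intro l
    have h1 := FreeGroup.norm_lt_norm_mul_self (map_letter_ne_one f l)
    have h3 := FreeGroup.norm_inv_mul_add (f (letter l))⁻¹ (f (letter l))
    rw [inv_inv, FreeGroup.norm_inv_eq] at h3
    omega
  have htie : ∀ l m : ι × Bool, l.1 ≠ m.1 →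
      2 * cp (f (letter l))⁻¹ (f (letter m)) = norm (f (letter l)) →
      ¬ FreeGroup.encode e N ((f (letter l)).toWord.take (norm (f (letter l)) / 2)) <
        FreeGroup.encode e N ((f (letter l))⁻¹.toWord.take (norm (f (letter l)) / 2)) := by
    intro l m hlm hcp hlt'
    have h3 := FreeGroup.norm_inv_mul_add (f (letter l))⁻¹ (f (letter m))
    rw [inv_inv, FreeGroup.norm_inv_eq] at h3
    have h4 := FreeGroup.tieWeight_mul_lt hN hcp (hne l m hlm).2 hlt'
    have h5 := (hlast l m hlm).2 (by omega)
    omega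
  -- Only adjacent mutually inverse letters are excluded, so reduced words are exactly the
  -- `R`-chains.
  let R : ι × Bool → ι × Bool → Prop := fun a b => a.1 = b.1 → a.2 = b.2
  have hR : ∀ l m, R l m → l = m ∨ l.1 ≠ m.1 := by
    intro l m h
    by_cases h1 : l.1 = m.1
    · exact Or.inl (Prod.ext h1 (h h1))
    · exact Or.inr h1
  have h1 : ∀ a b, R a b → 2 * cp (f (letter a))⁻¹ (f (letter b)) ≤ norm (f (letter a)) ∧
      2 * cp (f (letter a))⁻¹ (f (letter b)) ≤ norm (f (letter b)) := by
    intro a b hab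
    rcases hR a b hab with rfl | h
    · exact ⟨(hself a).le, (hself a).le⟩
    · exact hne a b h
  have h2 : ∀ a b c, R a b → R b c →
      cp (f (letter a))⁻¹ (f (letter b)) + cp (f (letter b))⁻¹ (f (letter c)) <
        norm (f (letter b)) := by
    intro a b c hab hbc
    have hab' := h1 a b hab
    have hbc' := h1 b c hbc
    -- Each cancellation takes at most half of `f (letter b)`, so failure means both take exactly
    -- half. The two tie inequalities then make both halves equal, and the image of a letter would
    -- be trivial.
    by_contra hcon
    have hab1 : a.1 ≠ b.1 := by
      rcases hR a b hab with rfl | h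
      · have := hself a; omega
      · exact h
    have hbc1 : b.1 ≠ c.1 := by
      rcases hR b c hbc with rfl | h
      · have := hself b; omega
      · exact h
    have t1 := htie b c hbc1 (by omega)
    have t2 := htie (invLetter b) (invLetter a) hab1.symm (by
      rw [← hinv, ← hinv, inv_inv, FreeGroup.cp_comm, FreeGroup.norm_inv_eq]; omega)
    rw [← hinv, inv_inv, FreeGroup.norm_inv_eq] at t2
    refine map_letter_ne_one f b (FreeGroup.eq_one_of_encode_eq hN he hlt ?_ (by omega))
    exact ⟨cp (f (letter a))⁻¹ (f (letter b)), by omega⟩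
  have hlen := FreeGroup.length_le_norm_prod R (fun l => f (letter l)) (fun b _ => rfl)
    (map_letter_ne_one f) h1 h2 (f⁻¹ (of i)).toWord FreeGroup.isReduced_toWord
  have hprod : ((f⁻¹ (of i)).toWord.map fun l => f (letter l)).prod = of i := by
    have : ((f⁻¹ (of i)).toWord.map fun l => f (letter l)) =
        ((f⁻¹ (of i)).toWord.map letter).map f := by rw [List.map_map]; rfl
    rw [this, ← map_list_prod, prod_map_letter, FreeGroup.mk_toWord, MulAut.apply_inv_self]
  rw [hprod, FreeGroup.norm_of] at hlen
  have hmk := FreeGroup.mk_toWord (x := f⁻¹ (of i))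
  match hL : (f⁻¹ (of i)).toWord, hlen with
  | [], _ =>
    rw [FreeGroup.toWord_eq_nil_iff, EmbeddingLike.map_eq_one_iff] at hL
    exact absurd hL (FreeGroup.of_ne_one i)
  | [l], _ => exact ⟨l, by rw [← hmk, hL]; rfl⟩

/-- **Nielsen's theorem**. -/
theorem closure_nielsenGenerators [Finite ι] :
    Subgroup.closure (nielsenGenerators ι) = ⊤ := by
  have := Fintype.ofFinite ι
  rw [eq_top_iff]
  rintro f -
  let e : ι × Bool → ℕ := fun a => (Fintype.equivFin (ι × Bool) a : ℕ)
  have he : Function.Injective e := fun a b h =>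
    (Fintype.equivFin _).injective (Fin.ext h)
  obtain ⟨g, hg, hmin⟩ := exists_minimal e (Fintype.card (ι × Bool) + 2) f
  obtain ⟨σ, hσ⟩ := isSignedPerm_of_apply_inv
    (exists_apply_eq_letter (by omega) he (fun a => by
      have := (Fintype.equivFin (ι × Bool) a).2
      simp only [e]
      omega) hmin)
  have hfg : (f * g)⁻¹ ∈ Subgroup.closure (nielsenGenerators ι) :=
    Subgroup.subset_closure (Or.inr ⟨σ, hσ⟩)
  have := mul_mem (inv_mem hfg) (inv_mem hg)
  rwa [inv_inv, mul_inv_cancel_right] at this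

instance normal_magnusSubgroup [Finite ι] : (magnusSubgroup ι).Normal := by
  refine Subgroup.normalizer_eq_top_iff.1 (top_le_iff.1 ?_)
  rw [← closure_nielsenGenerators]
  exact closure_nielsenGenerators_le_normalizer

end FreeAut

/-! ### Elementary systems: vectors, signs and Euclidean reductions -/

/-- A group acting on `ℤ^ι` together with elements `E i j` acting as the elementary matrices and a
subgroup `W` acting as the signed permutation matrices, satisfying the usual relations. -/
structure IsElementarySystem {ι Q : Type*} [DecidableEq ι] [Group Q] (ρ : Q →* Module.End ℤ (ι → ℤ))
    (E : ι → ι → Q) (W : Subgroup Q) : Prop where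
  apply_E : ∀ i j, i ≠ j → ∀ v, ρ (E i j) v = v + Pi.single i (v j)
  comm : ∀ i j k l, i ≠ j → k ≠ l → i ≠ l → k ≠ j → E i j * E k l = E k l * E i j
  chain : ∀ i j l, i ≠ j → j ≠ l → i ≠ l → E i j * E j l = E j l * E i j * E i l
  swap_mem : ∀ i j, i ≠ j → E i j * (E j i)⁻¹ * E i j ∈ W
  conj : ∀ w ∈ W, ∃ (σ : Equiv.Perm ι) (ε : ι → ℤˣ), (∀ v i, ρ w v (σ i) = ε i * v i) ∧
    ∀ i j, i ≠ j → w * E i j * w⁻¹ = E (σ i) (σ j) ^ ((ε i * ε j : ℤˣ) : ℤ)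
  sign : ∀ ε : ι → ℤˣ, ∃ w ∈ W, ∀ v i, ρ w v i = ε i * v i
  faithful : ∀ w ∈ W, (∀ v, ρ w v = v) → w = 1

namespace IsElementarySystem

section

variable {ι Q : Type*} [Group Q]

theorem apply_mul (ρ : Q →* Module.End ℤ (ι → ℤ)) (p q : Q) (v : ι → ℤ) :
    ρ (p * q) v = ρ p (ρ q v) := by
  rw [map_mul]; rfl

theorem apply_one (ρ : Q →* Module.End ℤ (ι → ℤ)) (v : ι → ℤ) : ρ 1 v = v := by
  rw [map_one]; rfl

theorem apply_inv_apply (ρ : Q →* Module.End ℤ (ι → ℤ)) (q : Q) (v : ι → ℤ) :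
    ρ q (ρ q⁻¹ v) = v := by
  rw [← apply_mul, mul_inv_cancel, apply_one]

theorem inv_apply_apply (ρ : Q →* Module.End ℤ (ι → ℤ)) (q : Q) (v : ι → ℤ) :
    ρ q⁻¹ (ρ q v) = v := by
  rw [← apply_mul, inv_mul_cancel, apply_one]

/-- The `ℓ¹`-norm of an integral vector. -/
def l1 [Fintype ι] (v : ι → ℤ) : ℤ := ∑ i, |v i|

theorem l1_of_nonneg [Fintype ι] {v : ι → ℤ} (h0 : ∀ i, 0 ≤ v i) : l1 v = ∑ i, v i :=
  Finset.sum_congr rfl fun i _ => abs_of_nonneg (h0 i)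

end

variable {ι Q : Type*} [DecidableEq ι] [Group Q] {ρ : Q →* Module.End ℤ (ι → ℤ)} {E : ι → ι → Q}
  {W : Subgroup Q}

theorem E_inv (h : IsElementarySystem ρ E W) {i j : ι} (hij : i ≠ j) (v : ι → ℤ) :
    ρ (E i j)⁻¹ v = v - Pi.single i (v j) := by
  have e : ρ (E i j) (v - Pi.single i (v j)) = v := by
    rw [h.apply_E i j hij]
    simp [hij.symm]
  rw [← e, inv_apply_apply, e]

theorem E_same (h : IsElementarySystem ρ E W) {i j : ι} (hij : i ≠ j) (v : ι → ℤ) :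
    ρ (E i j) v i = v i + v j := by
  simp [h.apply_E i j hij]

theorem E_ne (h : IsElementarySystem ρ E W) {i j k : ι} (hij : i ≠ j) (hk : k ≠ i) (v : ι → ℤ) :
    ρ (E i j) v k = v k := by
  simp [h.apply_E i j hij, hk]

theorem E_inv_same (h : IsElementarySystem ρ E W) {i j : ι} (hij : i ≠ j) (v : ι → ℤ) :
    ρ (E i j)⁻¹ v i = v i - v j := by
  simp [h.E_inv hij]

theorem E_inv_ne (h : IsElementarySystem ρ E W) {i j k : ι} (hij : i ≠ j) (hk : k ≠ i) (v : ι → ℤ) :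
    ρ (E i j)⁻¹ v k = v k := by
  simp [h.E_inv hij, hk]

theorem E_eq_self (h : IsElementarySystem ρ E W) {i j : ι} (hij : i ≠ j) {v : ι → ℤ} (hv : v j = 0) :
    ρ (E i j) v = v := by
  simp [h.apply_E i j hij, hv]

theorem E_inv_eq_self (h : IsElementarySystem ρ E W) {i j : ι} (hij : i ≠ j) {v : ι → ℤ}
    (hv : v j = 0) :
    ρ (E i j)⁻¹ v = v := by
  simp [h.E_inv hij, hv]

variable (ρ E W)

/-- The signed permutations that are trivial outside `D`. -/
def signedOn (D : Finset ι) : Subgroup Q where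
  carrier := {w | w ∈ W ∧ ∀ i ∉ D, ρ w (Pi.single i 1) = Pi.single i 1}
  one_mem' := ⟨one_mem _, fun i _ => apply_one ρ _⟩
  mul_mem' {a b} ha hb := ⟨mul_mem ha.1 hb.1, fun i hi => by
    rw [apply_mul, hb.2 i hi, ha.2 i hi]⟩
  inv_mem' {a} ha := ⟨inv_mem ha.1, fun i hi => by
    conv_lhs => rw [← ha.2 i hi]
    rw [inv_apply_apply]⟩

/-- The subgroup generated by the elementary elements and signed permutations on `D`. -/
def elemGroup (D : Finset ι) : Subgroup Q :=
  Subgroup.closure ({q | ∃ i ∈ D, ∃ j ∈ D, i ≠ j ∧ q = E i j} ∪ signedOn ρ W D)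

/-- The obvious generators of the stabilizer of the basis vector `e_a` in `elemGroup`. -/
def stabGroup (D : Finset ι) (a : ι) : Subgroup Q :=
  Subgroup.closure ({q | ∃ i ∈ D, ∃ j ∈ D, i ≠ j ∧ j ≠ a ∧ q = E i j} ∪
    signedOn ρ W (D.erase a))

variable {ρ E W}

theorem signedOn_data (h : IsElementarySystem ρ E W) {D : Finset ι} {w : Q}
    (hw : w ∈ signedOn ρ W D) :
    ∃ (σ : Equiv.Perm ι) (ε : ι → ℤˣ), (∀ v i, ρ w v (σ i) = ε i * v i) ∧
      (∀ i j, i ≠ j → w * E i j * w⁻¹ = E (σ i) (σ j) ^ ((ε i * ε j : ℤˣ) : ℤ)) ∧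
      (∀ i ∉ D, σ i = i ∧ ε i = 1) ∧ ∀ i ∈ D, σ i ∈ D := by
  obtain ⟨σ, ε, h1, h2⟩ := h.conj w hw.1
  have h3 : ∀ i ∉ D, σ i = i ∧ ε i = 1 := by
    intro i hi
    have := h1 (Pi.single i 1) i
    rw [hw.2 i hi, Pi.single_eq_same, mul_one] at this
    by_cases hσ : σ i = i
    · rw [hσ, Pi.single_eq_same] at this
      exact ⟨hσ, Units.ext this.symm⟩
    · rw [Pi.single_eq_of_ne hσ] at this
      exact absurd this.symm (ε i).ne_zero
  refine ⟨σ, ε, h1, h2, h3, fun i hi => ?_⟩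
  by_contra hσ
  exact hσ (by rwa [σ.injective (h3 _ hσ).1])

theorem exists_sign (h : IsElementarySystem ρ E W) {D : Finset ι} (ε : ι → ℤˣ)
    (hε : ∀ i ∉ D, ε i = 1) : ∃ w ∈ signedOn ρ W D, ∀ v i, ρ w v i = ε i * v i := by
  obtain ⟨w, hw, hw'⟩ := h.sign ε
  refine ⟨w, ⟨hw, fun i hi => ?_⟩, hw'⟩
  ext k
  rw [hw']
  by_cases hk : k = i
  · subst hk; simp [hε k hi]
  · simp [hk]

theorem E_single (h : IsElementarySystem ρ E W) {i j k : ι} (hij : i ≠ j) (hk : k ≠ j) :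
    ρ (E i j) (Pi.single k 1) = Pi.single k 1 :=
  h.E_eq_self hij (Pi.single_eq_of_ne hk.symm 1)

theorem E_inv_single (h : IsElementarySystem ρ E W) {i j k : ι} (hij : i ≠ j) (hk : k ≠ j) :
    ρ (E i j)⁻¹ (Pi.single k 1) = Pi.single k 1 :=
  h.E_inv_eq_self hij (Pi.single_eq_of_ne hk.symm 1)

theorem swap_mem_signedOn (h : IsElementarySystem ρ E W) {D : Finset ι} {i j : ι} (hij : i ≠ j)
    (hi : i ∈ D) (hj : j ∈ D) : E i j * (E j i)⁻¹ * E i j ∈ signedOn ρ W D := by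
  refine ⟨h.swap_mem i j hij, fun k hk => ?_⟩
  have hki : k ≠ i := fun e => hk (e ▸ hi)
  have hkj : k ≠ j := fun e => hk (e ▸ hj)
  rw [apply_mul, apply_mul, h.E_single hij hkj, h.E_inv_single hij.symm hki, h.E_single hij hkj]

/-- Primitive vectors supported in `D`. -/
def IsPrimitiveOn (D : Finset ι) (v : ι → ℤ) : Prop :=
  (∀ i ∉ D, v i = 0) ∧ ∀ (c : ℤ) (u : ι → ℤ), v = c • u → IsUnit c

theorem IsPrimitiveOn.apply {ι Q : Type*} [Group Q] {ρ : Q →* Module.End ℤ (ι → ℤ)}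
    {D : Finset ι} {v : ι → ℤ} (hv : IsPrimitiveOn D v) {q : Q}
    (hq : ∀ i ∉ D, ρ q v i = 0) : IsPrimitiveOn D (ρ q v) := by
  refine ⟨hq, fun c u hu => hv.2 c (ρ q⁻¹ u) ?_⟩
  rw [← inv_apply_apply ρ q v, hu, map_smul]

theorem IsPrimitiveOn.signedOn (h : IsElementarySystem ρ E W) {D : Finset ι} {v : ι → ℤ}
    (hv : IsPrimitiveOn D v) {w : Q} (hw : w ∈ signedOn ρ W D) : IsPrimitiveOn D (ρ w v) := by
  obtain ⟨σ, ε, h1, -, h3, -⟩ := h.signedOn_data hw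
  refine hv.apply fun i hi => ?_
  have := h1 v i
  rwa [(h3 i hi).1, hv.1 i hi, mul_zero] at this

theorem IsPrimitiveOn.elem (h : IsElementarySystem ρ E W) {D : Finset ι} {v : ι → ℤ}
    (hv : IsPrimitiveOn D v) {i j : ι} (hij : i ≠ j) (hi : i ∈ D) :
    IsPrimitiveOn D (ρ (E i j) v) :=
  hv.apply fun k hk => by rw [h.E_ne hij (fun e => hk (by rwa [e])), hv.1 k hk]

theorem IsPrimitiveOn.elem_inv (h : IsElementarySystem ρ E W) {D : Finset ι} {v : ι → ℤ}
    (hv : IsPrimitiveOn D v) {i j : ι} (hij : i ≠ j) (hi : i ∈ D) :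
    IsPrimitiveOn D (ρ (E i j)⁻¹ v) :=
  hv.apply fun k hk => by rw [h.E_inv_ne hij (fun e => hk (by rwa [e])), hv.1 k hk]

theorem isPrimitiveOn_single {D : Finset ι} {a : ι} (ha : a ∈ D) :
    IsPrimitiveOn D (Pi.single a 1) := by
  refine ⟨fun i hi => Pi.single_eq_of_ne (fun e => hi (by rwa [e])) 1, fun c u hu => ?_⟩
  have := congrFun hu a
  rw [Pi.single_eq_same, Pi.smul_apply, smul_eq_mul] at this
  exact IsUnit.of_mul_eq_one _ this.symm

/-- A nonnegative primitive vector is a basis vector or admits a Euclidean reduction. -/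
theorem IsPrimitiveOn.eq_single_or {D : Finset ι} {v : ι → ℤ} (hv : IsPrimitiveOn D v)
    (h0 : ∀ i, 0 ≤ v i) :
    (∃ b ∈ D, v = Pi.single b 1) ∨ ∃ i ∈ D, ∃ j ∈ D, i ≠ j ∧ 0 < v j ∧ v j ≤ v i := by
  have hne : ∃ b, v b ≠ 0 := by
    by_contra! hc
    exact not_isUnit_zero (hv.2 0 0 (by ext i; simp [hc]))
  obtain ⟨b, hb⟩ := hne
  have hD : ∀ i, v i ≠ 0 → i ∈ D := fun i hi => by
    by_contra hc
    exact hi (hv.1 i hc)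
  by_cases hc : ∃ c, c ≠ b ∧ v c ≠ 0
  · obtain ⟨c, hcb, hc⟩ := hc
    right
    have := h0 b
    have := h0 c
    rcases le_total (v c) (v b) with hle | hle
    · exact ⟨b, hD b hb, c, hD c hc, hcb.symm, by omega, hle⟩
    · exact ⟨c, hD c hc, b, hD b hb, hcb, by omega, hle⟩
  · push Not at hc
    left
    have e : v = v b • Pi.single b 1 := by
      ext i
      by_cases hi : i = b
      · subst hi; simp
      · simp [hc i hi, hi]
    have hu := hv.2 _ _ e
    have h1 : v b = 1 := by
      rcases Int.isUnit_iff.1 hu with h1 | h1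
      · exact h1
      · have := h0 b; omega
    exact ⟨b, hD b hb, by rw [e, h1, one_smul]⟩

theorem nonneg_E_inv (h : IsElementarySystem ρ E W) {i j : ι} (hij : i ≠ j) {v : ι → ℤ}
    (h0 : ∀ k, 0 ≤ v k) (hle : v j ≤ v i) (k : ι) : 0 ≤ ρ (E i j)⁻¹ v k := by
  by_cases hk : k = i
  · subst hk; rw [h.E_inv_same hij]; omega
  · rw [h.E_inv_ne hij hk]; exact h0 k

theorem exists_nonneg (h : IsElementarySystem ρ E W) {D : Finset ι} {v : ι → ℤ}
    (hv : IsPrimitiveOn D v) :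
    ∃ w ∈ signedOn ρ W D, (∀ i, 0 ≤ ρ w v i) ∧ ∃ ε : ι → ℤˣ, ∀ v i, ρ w v i = ε i * v i := by
  obtain ⟨w, hw, hw'⟩ := h.exists_sign (D := D) (fun i => if 0 ≤ v i then 1 else -1)
    (fun i hi => by simp [hv.1 i hi])
  refine ⟨w, hw, fun i => ?_, _, hw'⟩
  rw [hw']
  split_ifs with hi
  · simpa using hi
  · simp only [Units.val_neg, Units.val_one]; omega

section Norm

variable [Fintype ι]

theorem l1_signedOn (h : IsElementarySystem ρ E W) {D : Finset ι} {w : Q}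
    (hw : w ∈ signedOn ρ W D) (v : ι → ℤ) : l1 (ρ w v) = l1 v := by
  obtain ⟨σ, ε, h1, -⟩ := h.signedOn_data hw
  rw [l1, ← Equiv.sum_comp σ]
  refine Finset.sum_congr rfl fun i _ => ?_
  rw [h1, abs_mul]
  rcases Int.units_eq_one_or (ε i) with e | e <;> simp [e]

theorem l1_E_inv (h : IsElementarySystem ρ E W) {i j : ι} (hij : i ≠ j) {v : ι → ℤ}
    (h0 : ∀ k, 0 ≤ v k) (hle : v j ≤ v i) : l1 (ρ (E i j)⁻¹ v) = l1 v - v j := by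
  rw [l1_of_nonneg (h.nonneg_E_inv hij h0 hle), l1_of_nonneg h0, h.E_inv hij]
  simp [Finset.sum_sub_distrib]

end Norm

end IsElementarySystem

/-! ### Sections from primitive vectors to cosets of the expected stabilizer -/

namespace IsElementarySystem

variable {ι Q : Type*} [DecidableEq ι] [Group Q] {ρ : Q →* Module.End ℤ (ι → ℤ)} {E : ι → ι → Q}
  {W : Subgroup Q}

theorem sign_conj (h : IsElementarySystem ρ E W) {w : Q} (hw : w ∈ W) {ε : ι → ℤˣ}
    (hε : ∀ v i, ρ w v i = ε i * v i) {i j : ι} (hij : i ≠ j) :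
    w * E i j * w⁻¹ = E i j ^ ((ε i * ε j : ℤˣ) : ℤ) := by
  obtain ⟨σ, ε', h1, h2⟩ := h.conj w hw
  have key : ∀ i, σ i = i ∧ ε' i = ε i := by
    intro i
    have := h1 (Pi.single i 1) i
    rw [hε, Pi.single_eq_same, mul_one] at this
    by_cases hσ : σ i = i
    · rw [hσ, Pi.single_eq_same, mul_one] at this
      exact ⟨hσ, Units.ext this.symm⟩
    · rw [Pi.single_eq_of_ne hσ, mul_zero] at this
      exact absurd this.symm (ε' i).ne_zero
  rw [h2 i j hij, (key i).1, (key j).1, (key i).2, (key j).2]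

/-- Changing the sign of one coordinate inverts the elementary elements involving it; this lets
vectors of mixed sign be treated through nonnegative ones. -/
theorem exists_flip (h : IsElementarySystem ρ E W) {D : Finset ι} {i : ι} (hi : i ∈ D) :
    ∃ w ∈ signedOn ρ W D, (∀ v, ρ w v i = -v i) ∧ (∀ v k, k ≠ i → ρ w v k = v k) ∧
      ∀ j, j ≠ i → ((E i j)⁻¹ * w = w * E i j ∧ E i j * w = w * (E i j)⁻¹) ∧
        (E j i)⁻¹ * w = w * E j i ∧ E j i * w = w * (E j i)⁻¹ := by
  have key : ∀ w x : Q, w * x * w⁻¹ = x⁻¹ → x⁻¹ * w = w * x ∧ x * w = w * x⁻¹ := by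
    intro w x hx
    have h1 : x⁻¹ * w = w * x := by rw [← hx]; group
    exact ⟨h1, by rw [eq_mul_inv_iff_mul_eq, mul_assoc, ← h1, mul_inv_cancel_left]⟩
  obtain ⟨w, hw, hw'⟩ := h.exists_sign (D := D) (Function.update 1 i (-1)) fun k hk => by
    rw [Function.update_of_ne (fun e => hk (by rwa [e]))]; rfl
  refine ⟨w, hw, fun v => by simp [hw'], fun v k hk => by simp [hw', hk], fun j hj => ?_⟩
  refine ⟨key _ _ ?_, key _ _ ?_⟩
  · rw [h.sign_conj hw.1 hw' hj.symm]; simp [hj]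
  · rw [h.sign_conj hw.1 hw' hj]; simp [hj]

theorem exists_neg (h : IsElementarySystem ρ E W) (D : Finset ι) :
    ∃ w ∈ signedOn ρ W D, (∀ v, ∀ k ∈ D, ρ w v k = -v k) ∧
      ∀ i ∈ D, ∀ j ∈ D, i ≠ j → w * E i j = E i j * w := by
  obtain ⟨w, hw, hw'⟩ := h.exists_sign (D := D) (fun k => if k ∈ D then -1 else 1) fun k hk => by
    simp [hk]
  refine ⟨w, hw, fun v k hk => by simp [hw', hk], fun i hi j hj hij => ?_⟩
  have := h.sign_conj hw.1 hw' hij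
  rw [mul_inv_eq_iff_eq_mul] at this
  rw [this]
  simp [hi, hj]

theorem mem_signedOn_erase {D : Finset ι} {a : ι} {w : Q} (hw : w ∈ signedOn ρ W D)
    (ha : ρ w (Pi.single a 1) = Pi.single a 1) : w ∈ signedOn ρ W (D.erase a) := by
  refine ⟨hw.1, fun i hi => ?_⟩
  by_cases e : i = a
  · rw [e, ha]
  · exact hw.2 i fun hiD => hi (Finset.mem_erase.2 ⟨e, hiD⟩)

theorem elem_mem_stabGroup {D : Finset ι} {a i j : ι} (hi : i ∈ D) (hj : j ∈ D) (hij : i ≠ j)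
    (hja : j ≠ a) : E i j ∈ stabGroup ρ E W D a := by
  rw [stabGroup]
  exact Subgroup.subset_closure (Or.inl ⟨i, hi, j, hj, hij, hja, rfl⟩)

theorem signedOn_le_stabGroup {D : Finset ι} {a : ι} :
    signedOn ρ W (D.erase a) ≤ stabGroup ρ E W D a := by
  rw [stabGroup]
  exact fun w hw => Subgroup.subset_closure (Or.inr hw)

theorem exists_signedOn_single (h : IsElementarySystem ρ E W) {D : Finset ι} {a b : ι}
    (ha : a ∈ D) (hb : b ∈ D) :
    ∃ w ∈ signedOn ρ W D, ρ w (Pi.single a 1) = Pi.single b 1 := by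
  by_cases hab : b = a
  · subst hab; exact ⟨1, one_mem _, apply_one ρ _⟩
  refine ⟨_, h.swap_mem_signedOn hab hb ha, ?_⟩
  ext k
  rw [apply_mul, apply_mul, h.apply_E b a hab, h.E_inv (Ne.symm hab), h.apply_E b a hab]
  by_cases hk : k = a
  · subst hk; simp [Ne.symm hab]
  · by_cases hk' : k = b
    · subst hk'; simp [hab]
    · simp [hk', Ne.symm hab]

variable [Fintype ι]

theorem l1_single (a : ι) : l1 (Pi.single a 1 : ι → ℤ) = 1 := by
  rw [l1, Finset.sum_eq_single a (fun b _ hb => by simp [hb]) (by simp)]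
  simp

/-- A map from vectors of norm at most `B` to cosets of the stabilizer of `e_a` that is compatible
with the signed permutations and the Euclidean reductions. -/
structure IsSection (ρ : Q →* Module.End ℤ (ι → ℤ)) (E : ι → ι → Q) (W : Subgroup Q)
    (D : Finset ι) (a : ι) (B : ℤ) (s : (ι → ℤ) → Q ⧸ stabGroup ρ E W D a) : Prop where
  base : s (Pi.single a 1) = (1 : Q)
  signed : ∀ w ∈ signedOn ρ W D, ∀ v, IsPrimitiveOn D v → l1 v ≤ B → s (ρ w v) = w • s v
  reduce : ∀ v, IsPrimitiveOn D v → l1 v ≤ B → ∀ i ∈ D, ∀ j ∈ D, i ≠ j → 0 < v j → v j ≤ v i →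
    s v = E i j • s (ρ (E i j)⁻¹ v)

namespace IsSection

variable {D : Finset ι} {a : ι} {B : ℤ} {s : (ι → ℤ) → Q ⧸ stabGroup ρ E W D a}

/-- Induct on the norm. A basis vector is moved to e_a, where E i j becomes a generator of
`stabGroup` or its inverse. Otherwise E i j is carried past a Euclidean reduction by the commutation
or chain relation, both of which only produce elementary elements with the same vanishing coordinate
`j`. -/
theorem elem_smul_of_zero (h : IsElementarySystem ρ E W) (ha : a ∈ D) (hB : 1 ≤ B)
    (hs : IsSection ρ E W D a B s)
    {v : ι → ℤ} (hv : IsPrimitiveOn D v) (hvB : l1 v ≤ B) {i j : ι} (hi : i ∈ D) (hj : j ∈ D)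
    (hij : i ≠ j) (h0 : v j = 0) : E i j • s v = s v := by
  obtain ⟨n, hn⟩ : ∃ n : ℕ, l1 v ≤ n := ⟨(l1 v).toNat, Int.self_le_toNat _⟩
  induction n using Nat.strong_induction_on generalizing v i j with
  | _ n ih =>
  -- reduction to nonnegative vectors
  obtain ⟨w, hw, hw0, -⟩ := h.exists_nonneg hv
  obtain ⟨σ, ε, h1, h2, -, h4⟩ := h.signedOn_data hw
  have hyv : ρ w v (σ j) = 0 := by rw [h1, h0, mul_zero]
  have hyP := hv.signedOn h hw
  have hyl := h.l1_signedOn hw v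
  suffices hy : E (σ i) (σ j) • s (ρ w v) = s (ρ w v) by
    rw [hs.signed w hw v hv hvB] at hy
    have hst : E (σ i) (σ j) ^ ((ε i * ε j : ℤˣ) : ℤ) ∈ MulAction.stabilizer Q (w • s v) :=
      zpow_mem (MulAction.mem_stabilizer_iff.2 hy) _
    rw [← h2 i j hij, MulAction.mem_stabilizer_iff, smul_smul, inv_mul_cancel_right, mul_smul]
      at hst
    exact MulAction.injective w hst
  generalize ρ w v = y at *
  have hi' := h4 i hi
  have hj' := h4 j hj
  have hij' : σ i ≠ σ j := σ.injective.ne hij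
  generalize σ i = i at *
  generalize σ j = j at *
  rcases hyP.eq_single_or hw0 with ⟨b, hb, rfl⟩ | ⟨k, hk, l, hl, hkl, hl0, hlk⟩
  · obtain ⟨u, hu, hub⟩ := h.exists_signedOn_single ha hb
    obtain ⟨τ, δ, t1, t2, -, t4⟩ := h.signedOn_data (inv_mem hu)
    have hbj : τ j ≠ a := by
      intro e
      have := t1 (Pi.single b 1) j
      rw [← hub, inv_apply_apply, hub, hyv, mul_zero, e, Pi.single_eq_same] at this
      exact one_ne_zero this
    have hsb : s (Pi.single b 1) = (u : Q ⧸ stabGroup ρ E W D a) := by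
      rw [← hub, hs.signed u hu _ (isPrimitiveOn_single ha), hs.base, MulAction.Quotient.smul_coe,
        smul_eq_mul, mul_one]
      rw [l1_single]
      exact hB
    rw [hsb, MulAction.Quotient.smul_coe, smul_eq_mul]
    refine (QuotientGroup.eq.2 ?_).symm
    rw [← mul_assoc]
    have := t2 i j hij'
    rw [inv_inv] at this
    rw [this]
    exact zpow_mem (elem_mem_stabGroup (t4 i hi') (t4 j hj') (τ.injective.ne hij') hbj) _
  · have hzP := hyP.elem_inv h hkl hk
    have hzl := h.l1_E_inv hkl hw0 hlk
    have hjk : j ≠ k := by rintro rfl; omega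
    have hjl : j ≠ l := by rintro rfl; omega
    have hzj : ρ (E k l)⁻¹ y j = 0 := by rw [h.E_inv_ne hkl hjk, hyv]
    have hzn : l1 (ρ (E k l)⁻¹ y) ≤ ((n - 1 : ℕ) : ℤ) := by omega
    have hn1 : n - 1 < n := by
      have : 0 ≤ l1 (ρ (E k l)⁻¹ y) := Finset.sum_nonneg fun i _ => abs_nonneg _
      omega
    have ih' := fun i (hi : i ∈ D) (hij : i ≠ j) =>
      ih (n - 1) hn1 hzP (by omega) hi hj' hij hzj hzn
    rw [hs.reduce y hyP (by omega) k hk l hl hkl hl0 hlk]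
    generalize s (ρ (E k l)⁻¹ y) = x at *
    by_cases hil : i = l
    · subst hil
      have e : E i j * E k i = E k i * E i j * (E k j)⁻¹ :=
        eq_mul_inv_of_mul_eq (h.chain k i j hkl hij' hjk.symm).symm
      have e2 : (E k j)⁻¹ • x = x := by rw [inv_smul_eq_iff, ih' k hk hjk.symm]
      rw [← mul_smul, e, mul_smul, mul_smul, e2, ih' i hi' hij']
    · rw [← mul_smul, h.comm i j k l hij' hkl hil hjk.symm, mul_smul, ih' i hi' hij']

/-- Compatibility with reductions extends to all E i j for which both vectors are within the bound.
After normalizing `0 ≤ v j` with −1, the sign of `v i` decides whether E i j is a reduction read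
backwards, a reduction of the sign-flipped vector, or a combination with a signed swap. -/
theorem elem (h : IsElementarySystem ρ E W) (ha : a ∈ D) (hB : 1 ≤ B)
    (hs : IsSection ρ E W D a B s)
    {v : ι → ℤ} (hv : IsPrimitiveOn D v) (hvB : l1 v ≤ B) {i j : ι} (hi : i ∈ D) (hj : j ∈ D)
    (hij : i ≠ j) (hB' : l1 (ρ (E i j) v) ≤ B) : s (ρ (E i j) v) = E i j • s v := by
  have main : ∀ v, IsPrimitiveOn D v → l1 v ≤ B → l1 (ρ (E i j) v) ≤ B → 0 ≤ v j →
      s (ρ (E i j) v) = E i j • s v := by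
    intro v hv hvB hB' h0
    have hui := h.E_same hij v
    have huj := h.E_ne hij hij.symm v
    have hu := hv.elem h hij hi
    by_cases hj0 : v j = 0
    · rw [h.E_eq_self hij hj0, hs.elem_smul_of_zero h ha hB hv hvB hi hj hij hj0]
    by_cases hi0 : 0 ≤ v i
    · rw [hs.reduce _ hu hB' i hi j hj hij (by omega) (by omega), inv_apply_apply]
    obtain ⟨w, hw, w1, w2, w3⟩ := h.exists_flip hi
    have w3ij := (w3 j hij.symm).1
    have w3ji := (w3 j hij.symm).2
    have hwv := hv.signedOn h hw
    have hwl := h.l1_signedOn hw v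
    have hwi := w1 v
    have hwj := w2 v j hij.symm
    by_cases hi1 : v i + v j ≤ 0
    · have r := hs.reduce _ hwv (by omega) i hi j hj hij (by omega) (by omega)
      obtain ⟨e, e'⟩ := w3ij
      rw [← apply_mul, e, apply_mul, hs.signed w hw _ hu hB', hs.signed w hw _ hv hvB, ← mul_smul,
        e', mul_smul] at r
      rw [MulAction.injective w r, smul_inv_smul]
    · have hji := hij.symm
      -- Here v i < 0 < v i + v j. Both E i j v and the flip of v reduce by E j i: the first to t z,
      -- the second to the flip of z, where z = E j i v is no longer than v.
      set t := (E j i)⁻¹ * E i j * (E j i)⁻¹ with ht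
      have htm : t ∈ signedOn ρ W D := by
        have := inv_mem (h.swap_mem_signedOn hji hj hi)
        rwa [mul_inv_rev, mul_inv_rev, inv_inv, ← mul_assoc] at this
      have r1 := hs.reduce _ hu hB' j hj i hi hji (by omega) (by omega)
      have r2 := hs.reduce _ hwv (by omega) j hj i hi hji (by omega) (by omega)
      obtain ⟨e, e'⟩ := w3ji
      have hz := hv.elem h hji hj
      have e2 : (E j i)⁻¹ * E i j = t * E j i := by rw [ht]; group
      have hlz : l1 (ρ (E j i) v) ≤ B := by
        refine le_trans ?_ hvB
        refine Finset.sum_le_sum fun k _ => ?_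
        by_cases hk : k = j
        · subst hk
          rw [h.E_same hji, abs_of_nonneg (by omega), abs_of_nonneg h0]
          omega
        · rw [h.E_ne hji hk]
      rw [← apply_mul, e2, apply_mul, hs.signed t htm _ hz hlz] at r1
      rw [← apply_mul, e, apply_mul, hs.signed w hw _ hz hlz, hs.signed w hw _ hv hvB,
        ← mul_smul, e', mul_smul] at r2
      rw [r1, MulAction.injective w r2]
      simp only [smul_smul, ht]
      congr 1
      group
  by_cases h0 : 0 ≤ v j
  · exact main v hv hvB hB' h0
  · obtain ⟨w, hw, w1, w2⟩ := h.exists_neg D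
    have e := w2 i hi j hj hij
    have h1 : ρ (E i j) (ρ w v) = ρ w (ρ (E i j) v) := by rw [← apply_mul, ← apply_mul, e]
    have r := main (ρ w v) (hv.signedOn h hw) (by rw [h.l1_signedOn hw]; exact hvB)
      (by rw [h1, h.l1_signedOn hw]; exact hB') (by rw [w1 v j hj]; omega)
    rw [h1, hs.signed w hw _ (hv.elem h hij hi) hB', hs.signed w hw _ hv hvB, ← mul_smul, ← e,
      mul_smul] at r
    exact MulAction.injective w r

end IsSection

end IsElementarySystem

/-! ### Confluence of reductions and stabilizers of basis vectors -/

namespace IsElementarySystem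

variable {ι Q : Type*} [DecidableEq ι] [Group Q] {ρ : Q →* Module.End ℤ (ι → ℤ)} {E : ι → ι → Q}
  {W : Subgroup Q} [Fintype ι]

namespace IsSection

variable {D : Finset ι} {a : ι} {B : ℤ} {s : (ι → ℤ) → Q ⧸ stabGroup ρ E W D a}

theorem down (h : IsElementarySystem ρ E W) (ha : a ∈ D) (hB : 1 ≤ B)
    (hs : IsSection ρ E W D a B s) {v : ι → ℤ} (hv : IsPrimitiveOn D v) (hvB : l1 v ≤ B)
    (h0 : ∀ k, 0 ≤ v k) {i j : ι} (hi : i ∈ D) (hj : j ∈ D) (hij : i ≠ j) (hle : v j ≤ v i) :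
    s v = E i j • s (ρ (E i j)⁻¹ v) := by
  have hl := h.l1_E_inv hij h0 hle
  have hj0 := h0 j
  have := hs.elem h ha hB (hv.elem_inv h hij hi) (by omega) hi hj hij
    (by rw [apply_inv_apply]; exact hvB)
  rwa [apply_inv_apply] at this

/-- Local confluence: any two reductions of `y` have a common continuation already known to the
section. The overlap of the index pairs decides whether the commutation, chain or swap relation
closes the diamond. -/
theorem reduction_unique (h : IsElementarySystem ρ E W) (ha : a ∈ D) (hB : 1 ≤ B)
    (hs : IsSection ρ E W D a B s) {y : ι → ℤ} (hy : IsPrimitiveOn D y) (hyB : l1 y ≤ B + 1)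
    (h0 : ∀ k, 0 ≤ y k) {i j k l : ι} (hi : i ∈ D) (hj : j ∈ D) (hij : i ≠ j) (hj0 : 0 < y j)
    (hji : y j ≤ y i) (hk : k ∈ D) (hl : l ∈ D) (hkl : k ≠ l) (hl0 : 0 < y l) (hlk : y l ≤ y k) :
    E i j • s (ρ (E i j)⁻¹ y) = E k l • s (ρ (E k l)⁻¹ y) := by
  -- properties of a single reduction
  have red : ∀ i ∈ D, ∀ j ∈ D, i ≠ j → 0 < y j → y j ≤ y i → IsPrimitiveOn D (ρ (E i j)⁻¹ y) ∧
      l1 (ρ (E i j)⁻¹ y) ≤ B ∧ ∀ k, 0 ≤ ρ (E i j)⁻¹ y k := fun i hi j hj hij hj0 hle =>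
    ⟨hy.elem_inv h hij hi, by rw [h.l1_E_inv hij h0 hle]; omega, h.nonneg_E_inv hij h0 hle⟩
  have commuting : ∀ i ∈ D, ∀ j ∈ D, ∀ k ∈ D, ∀ l ∈ D, i ≠ j → k ≠ l → 0 < y j → y j ≤ y i →
      0 < y l → y l ≤ y k → i ≠ l → k ≠ j → i ≠ k →
      E i j • s (ρ (E i j)⁻¹ y) = E k l • s (ρ (E k l)⁻¹ y) := by
    intro i hi j hj k hk l hl hij hkl hj0 hji hl0 hlk hil hkj hik
    obtain ⟨p1, p2, p3⟩ := red i hi j hj hij hj0 hji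
    obtain ⟨q1, q2, q3⟩ := red k hk l hl hkl hl0 hlk
    rw [hs.down h ha hB p1 p2 p3 hk hl hkl
        (by rw [h.E_inv_ne hij hik.symm, h.E_inv_ne hij hil.symm]; exact hlk),
      hs.down h ha hB q1 q2 q3 hi hj hij
        (by rw [h.E_inv_ne hkl hkj.symm, h.E_inv_ne hkl hik]; exact hji),
      ← mul_smul, ← mul_smul, ← apply_mul, ← apply_mul, ← mul_inv_rev, ← mul_inv_rev,
      h.comm i j k l hij hkl hil hkj]
  have chain : ∀ i ∈ D, ∀ j ∈ D, ∀ l ∈ D, i ≠ j → j ≠ l → i ≠ l → 0 < y j → y j ≤ y i →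
      0 < y l → y l ≤ y j → E i j • s (ρ (E i j)⁻¹ y) = E j l • s (ρ (E j l)⁻¹ y) := by
    intro i hi j hj l hl hij hjl hil hj0 hji hl0 hlj
    obtain ⟨p1, p2, p3⟩ := red i hi j hj hij hj0 hji
    obtain ⟨q1, q2, q3⟩ := red j hj l hl hjl hl0 hlj
    have hq : ρ (E j l)⁻¹ y j ≤ ρ (E j l)⁻¹ y i := by
      rw [h.E_inv_same hjl, h.E_inv_ne hjl hij]; omega
    have hql := h.l1_E_inv hij q3 hq
    have hqj := q3 j
    rw [hs.down h ha hB p1 p2 p3 hj hl hjl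
        (by rw [h.E_inv_ne hij hij.symm, h.E_inv_ne hij hil.symm]; exact hlj),
      hs.down h ha hB q1 q2 q3 hi hj hij hq,
      hs.down h ha hB (q1.elem_inv h hij hi) (by omega) (h.nonneg_E_inv hij q3 hq) hi hl hil
        (by
          rw [h.E_inv_ne hij hil.symm, h.E_inv_same hij, h.E_inv_ne hjl hjl.symm,
            h.E_inv_ne hjl hij, h.E_inv_same hjl]
          omega),
      ← mul_smul, ← mul_smul, ← mul_smul, ← apply_mul, ← apply_mul, ← apply_mul, ← mul_inv_rev,
      ← mul_inv_rev, ← mul_inv_rev, ← mul_assoc, h.chain i j l hij hjl hil]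
  have swap : ∀ i ∈ D, ∀ j ∈ D, i ≠ j → 0 < y j → y j = y i →
      E i j • s (ρ (E i j)⁻¹ y) = E j i • s (ρ (E j i)⁻¹ y) := by
    intro i hi j hj hij hj0 hji
    obtain ⟨p1, p2, p3⟩ := red i hi j hj hij hj0 hji.le
    have hz : ρ (E i j)⁻¹ y i = 0 := by rw [h.E_inv_same hij]; omega
    have htm : (E j i)⁻¹ * E i j * (E j i)⁻¹ ∈ signedOn ρ W D := by
      have := inv_mem (h.swap_mem_signedOn hij.symm hj hi)
      rwa [mul_inv_rev, mul_inv_rev, inv_inv, ← mul_assoc] at this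
    have r := hs.signed _ htm _ p1 p2
    rw [apply_mul, apply_mul, h.E_inv_eq_self hij.symm hz, apply_inv_apply] at r
    have e : (E j i)⁻¹ • s (ρ (E i j)⁻¹ y) = s (ρ (E i j)⁻¹ y) := by
      rw [inv_smul_eq_iff, hs.elem_smul_of_zero h ha hB p1 p2 hj hi hij.symm hz]
    rw [r, mul_smul, mul_smul, smul_inv_smul, e]
  have same : ∀ i ∈ D, ∀ j ∈ D, ∀ l ∈ D, i ≠ j → i ≠ l → j ≠ l → 0 < y j → y j ≤ y i →
      0 < y l → y l ≤ y j → E i j • s (ρ (E i j)⁻¹ y) = E i l • s (ρ (E i l)⁻¹ y) := by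
    intro i hi j hj l hl hij hil hjl hj0 hji hl0 hlj
    rw [chain i hi j hj l hl hij hjl hil hj0 hji hl0 hlj]
    exact commuting j hj l hl i hi l hl hjl hil hl0 hlj hl0 (hlj.trans hji) hjl hil hij.symm
  by_cases hik : i = k
  · subst hik
    by_cases hjl : j = l
    · rw [hjl]
    rcases le_total (y l) (y j) with hle | hle
    · exact same i hi j hj l hl hij hkl hjl hj0 hji hl0 hle
    · exact (same i hi l hl j hj hkl hij (Ne.symm hjl) hl0 hlk hj0 hle).symm
  by_cases hil : i = l
  · subst hil
    by_cases hjk : j = k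
    · subst hjk
      exact swap i hi j hj hij hj0 (le_antisymm hji hlk)
    · exact (chain k hk i hi j hj hkl hij (Ne.symm hjk) hl0 hlk hj0 hji).symm
  by_cases hjk : j = k
  · subst hjk
    exact chain i hi j hj l hl hij hkl hil hj0 hji hl0 hlk
  · exact commuting i hi j hj k hk l hl hij hkl hj0 hji hl0 hlk hil (Ne.symm hjk) hik

end IsSection

/-- The primitive vectors of norm 1 are the ±e_b, a single orbit of the signed permutations, and the
stabilizer of e_a among these lies in `stabGroup`. No reduction applies at this norm. -/
theorem exists_isSection_one (h : IsElementarySystem ρ E W) {D : Finset ι} {a : ι} (ha : a ∈ D) :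
    ∃ s, IsSection ρ E W D a 1 s := by
  classical
  let s : (ι → ℤ) → Q ⧸ stabGroup ρ E W D a := fun v =>
    if hv : ∃ w ∈ signedOn ρ W D, ρ w (Pi.single a 1) = v then
      (hv.choose : Q ⧸ stabGroup ρ E W D a) else (1 : Q)
  have hs : ∀ w ∈ signedOn ρ W D, s (ρ w (Pi.single a 1)) = (w : Q ⧸ stabGroup ρ E W D a) := by
    intro w hw
    have hv : ∃ w' ∈ signedOn ρ W D, ρ w' (Pi.single a 1) = ρ w (Pi.single a 1) := ⟨w, hw, rfl⟩
    simp only [s]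
    rw [dif_pos hv]
    have h1 := hv.choose_spec
    refine QuotientGroup.eq.2 (signedOn_le_stabGroup ?_)
    refine mem_signedOn_erase (mul_mem (inv_mem h1.1) hw) ?_
    exact (apply_mul ρ _ _ _).trans ((congrArg _ h1.2.symm).trans (inv_apply_apply ρ _ _))
  have hsingle : ∀ v, IsPrimitiveOn D v → l1 v ≤ 1 →
      ∃ w ∈ signedOn ρ W D, ρ w (Pi.single a 1) = v := by
    intro v hv hl
    obtain ⟨w, hw, hw0, -⟩ := h.exists_nonneg hv
    rcases (hv.signedOn h hw).eq_single_or hw0 with ⟨b, hb, hvb⟩ | ⟨i, hi, j, hj, hij, hj0, hji⟩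
    · obtain ⟨u, hu, hub⟩ := h.exists_signedOn_single ha hb
      refine ⟨w⁻¹ * u, mul_mem (inv_mem hw) hu, ?_⟩
      rw [apply_mul, hub, ← hvb, inv_apply_apply]
    · exfalso
      rw [← h.l1_signedOn hw, l1_of_nonneg hw0] at hl
      have h2 : ∑ k ∈ ({i, j} : Finset ι), ρ w v k ≤ ∑ k, ρ w v k :=
        Finset.sum_le_sum_of_subset_of_nonneg (Finset.subset_univ _) fun k _ _ => hw0 k
      rw [Finset.sum_pair hij] at h2
      omega
  refine ⟨s, ⟨?_, fun w hw v hv hl => ?_, fun v hv hl i hi j hj hij hj0 hji => ?_⟩⟩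
  · have := hs 1 (one_mem _)
    rwa [apply_one] at this
  · obtain ⟨u, hu, rfl⟩ := hsingle v hv hl
    rw [← apply_mul, hs _ (mul_mem hw hu), hs u hu]
    rfl
  · exfalso
    have h2 : ∑ k ∈ ({i, j} : Finset ι), |v k| ≤ l1 v :=
      Finset.sum_le_sum_of_subset_of_nonneg (Finset.subset_univ _) fun k _ _ => abs_nonneg _
    rw [Finset.sum_pair hij, abs_of_pos hj0, abs_of_pos (by omega)] at h2
    omega

/-- A vector on the new shell takes the value forced by any sign change followed by any reduction.
`reduction_unique` shows that the value does not depend on the choice, once everything is moved to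
the nonnegative orthant. -/
theorem IsSection.extend (h : IsElementarySystem ρ E W) {D : Finset ι} {a : ι} {B : ℤ}
    {s : (ι → ℤ) → Q ⧸ stabGroup ρ E W D a} (ha : a ∈ D) (hB : 1 ≤ B)
    (hs : IsSection ρ E W D a B s) : ∃ s', IsSection ρ E W D a (B + 1) s' := by
  classical
  let Cand : (ι → ℤ) → Q ⧸ stabGroup ρ E W D a → Prop := fun v x =>
    ∃ w ∈ signedOn ρ W D, ∃ i ∈ D, ∃ j ∈ D, i ≠ j ∧ 0 < ρ w v j ∧ ρ w v j ≤ ρ w v i ∧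
      w • x = E i j • s (ρ (E i j)⁻¹ (ρ w v))
  have huniq : ∀ v, IsPrimitiveOn D v → l1 v ≤ B + 1 → ∀ x x', Cand v x → Cand v x' → x = x' := by
    intro v hv hl
    obtain ⟨w₀, hw₀, hw0, -⟩ := h.exists_nonneg hv
    have key : ∀ x, Cand v x → ∃ i ∈ D, ∃ j ∈ D, i ≠ j ∧ 0 < ρ w₀ v j ∧ ρ w₀ v j ≤ ρ w₀ v i ∧
        w₀ • x = E i j • s (ρ (E i j)⁻¹ (ρ w₀ v)) := by
      rintro x ⟨w, hw, i, hi, j, hj, hij, hj0, hji, hx⟩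
      have hu : w₀ * w⁻¹ ∈ signedOn ρ W D := mul_mem hw₀ (inv_mem hw)
      obtain ⟨σ, ε, h1, h2, -, h4⟩ := h.signedOn_data hu
      have hwv : ρ w₀ v = ρ (w₀ * w⁻¹) (ρ w v) := by rw [apply_mul, inv_apply_apply]
      have hwx : w₀ • x = (w₀ * w⁻¹) • w • x := by rw [smul_smul, inv_mul_cancel_right]
      have hy := hv.signedOn h hw
      have hyl := h.l1_signedOn hw v
      rw [hwv] at hw0 ⊢
      rw [hwx, hx]
      generalize w₀ * w⁻¹ = u at *
      generalize ρ w v = y at *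
      -- A signed permutation taking the vector into the nonnegative orthant cannot change the sign
      -- of a positive coordinate, so it conjugates E i j to an elementary element rather than its
      -- inverse.
      have hε : ∀ k, 0 < y k → ε k = 1 := by
        intro k hk
        have := hw0 (σ k)
        rw [h1] at this
        rcases Int.units_eq_one_or (ε k) with e | e
        · exact e
        · rw [e] at this; simp at this; omega
      have hεi := hε i (by omega)
      have hεj := hε j hj0
      have hσ := σ.injective.ne hij
      refine ⟨σ i, h4 i hi, σ j, h4 j hj, hσ, ?_, ?_, ?_⟩
      · rw [h1, hεj]; simpa using hj0
      · rw [h1, h1, hεi, hεj]; simpa using hji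
      · have hE := h2 i j hij
        rw [hεi, hεj] at hE
        simp only [mul_one, Units.val_one, zpow_one] at hE
        have e1 : u * E i j = E (σ i) (σ j) * u := by rw [← hE]; group
        have e2 : (E (σ i) (σ j))⁻¹ * u = u * (E i j)⁻¹ := by rw [← hE]; group
        have hneg : l1 (ρ (E i j)⁻¹ y) ≤ B := by
          have : l1 (ρ (E i j)⁻¹ y) + y j ≤ l1 y := by
            rw [l1, l1, Fintype.sum_eq_add_sum_compl i,
              Fintype.sum_eq_add_sum_compl i (fun k => |y k|),
              h.E_inv_same hij, abs_of_nonneg (by omega), abs_of_pos (a := y i) (by omega),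
              Finset.sum_congr rfl fun k hk => by rw [h.E_inv_ne hij (by simpa using hk)]]
            omega
          omega
        rw [smul_smul, e1, ← apply_mul, e2, apply_mul, hs.signed u hu _ (hy.elem_inv h hij hi) hneg,
          smul_smul]
    intro x x' hx hx'
    obtain ⟨i, hi, j, hj, hij, hj0, hji, e⟩ := key x hx
    obtain ⟨k, hk, l, hl', hkl, hl0, hlk, e'⟩ := key x' hx'
    refine MulAction.injective w₀ ?_
    change w₀ • x = w₀ • x'
    rw [e, e']
    exact hs.reduction_unique h ha hB (hv.signedOn h hw₀) (by rw [h.l1_signedOn hw₀]; exact hl) hw0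
      hi hj hij hj0 hji hk hl' hkl hl0 hlk
  have hex : ∀ v, IsPrimitiveOn D v → ¬ l1 v ≤ B → ∃ x, Cand v x := by
    intro v hv hl
    obtain ⟨w, hw, hw0, -⟩ := h.exists_nonneg hv
    rcases (hv.signedOn h hw).eq_single_or hw0 with ⟨b, hb, hvb⟩ | ⟨i, hi, j, hj, hij, hj0, hji⟩
    · exfalso
      rw [← h.l1_signedOn hw, hvb, l1_single] at hl
      exact hl hB
    · exact ⟨w⁻¹ • E i j • s (ρ (E i j)⁻¹ (ρ w v)), w, hw, i, hi, j, hj, hij, hj0, hji,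
        smul_inv_smul _ _⟩
  let s' : (ι → ℤ) → Q ⧸ stabGroup ρ E W D a := fun v =>
    if l1 v ≤ B then s v else if hv : ∃ x, Cand v x then hv.choose else (1 : Q)
  have hs'1 : ∀ v, l1 v ≤ B → s' v = s v := fun v hv => if_pos hv
  have hs'2 : ∀ v, IsPrimitiveOn D v → l1 v ≤ B + 1 → ¬ l1 v ≤ B → ∀ x, Cand v x → s' v = x := by
    intro v hv hl hl' x hx
    have hc : ∃ x, Cand v x := ⟨x, hx⟩
    simp only [s']
    rw [if_neg hl', dif_pos hc]
    exact huniq v hv hl _ _ hc.choose_spec hx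
  refine ⟨s', ⟨?_, fun w hw v hv hl => ?_, fun v hv hl i hi j hj hij hj0 hji => ?_⟩⟩
  · rw [hs'1 _ (by rw [l1_single]; exact hB), hs.base]
  · by_cases hl' : l1 v ≤ B
    · rw [hs'1 _ (by rw [h.l1_signedOn hw]; exact hl'), hs'1 v hl', hs.signed w hw v hv hl']
    · obtain ⟨x, hx⟩ := hex v hv hl'
      rw [hs'2 v hv hl hl' x hx]
      refine hs'2 _ (hv.signedOn h hw) (by rw [h.l1_signedOn hw]; exact hl)
        (by rw [h.l1_signedOn hw]; exact hl') _ ?_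
      obtain ⟨u, hu, i, hi, j, hj, hij, hj0, hji, e⟩ := hx
      have e' : ρ (u * w⁻¹) (ρ w v) = ρ u v := by rw [apply_mul, inv_apply_apply]
      exact ⟨u * w⁻¹, mul_mem hu (inv_mem hw), i, hi, j, hj, hij, by rw [e']; exact hj0,
        by rw [e']; exact hji, by rw [e', smul_smul, inv_mul_cancel_right, e]⟩
  · have hlow : l1 (ρ (E i j)⁻¹ v) ≤ B := by
      have : l1 (ρ (E i j)⁻¹ v) + v j ≤ l1 v := by
        rw [l1, l1, Fintype.sum_eq_add_sum_compl i, Fintype.sum_eq_add_sum_compl i (fun k => |v k|),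
          h.E_inv_same hij, abs_of_nonneg (by omega), abs_of_pos (a := v i) (by omega),
          Finset.sum_congr rfl fun k hk => by rw [h.E_inv_ne hij (by simpa using hk)]]
        omega
      omega
    rw [hs'1 _ hlow]
    by_cases hl' : l1 v ≤ B
    · rw [hs'1 v hl']
      exact hs.reduce v hv hl' i hi j hj hij hj0 hji
    · refine hs'2 v hv hl hl' _ ⟨1, one_mem _, i, hi, j, hj, hij, ?_, ?_, ?_⟩
      · rwa [apply_one]
      · rwa [apply_one]
      · rw [apply_one, one_smul]

theorem exists_isSection (h : IsElementarySystem ρ E W) {D : Finset ι} {a : ι} (ha : a ∈ D)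
    (n : ℕ) : ∃ s, IsSection ρ E W D a (n + 1) s := by
  induction n with
  | zero => simpa using h.exists_isSection_one ha
  | succ n ih =>
    obtain ⟨s, hs⟩ := ih
    simpa using hs.extend h ha (by omega)

/-- The stabilizer of a basis vector in `elemGroup` is generated by the obvious elements. -/
theorem mem_stabGroup (h : IsElementarySystem ρ E W) {D : Finset ι} {a : ι} (ha : a ∈ D) {p : Q}
    (hp : p ∈ elemGroup ρ E W D) (hpa : ρ p (Pi.single a 1) = Pi.single a 1) :
    p ∈ stabGroup ρ E W D a := by
  -- For a bound exceeding the norms of all vectors met along a word for `p`, the section takes p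
  -- e_a to the coset of `p`. If `p` fixes e_a, that coset is therefore trivial.
  have key : ∀ p ∈ elemGroup ρ E W D, IsPrimitiveOn D (ρ p (Pi.single a 1)) ∧
      ∃ B₀ : ℤ, ∀ B, B₀ ≤ B → 1 ≤ B → ∀ s, IsSection ρ E W D a B s →
        s (ρ p (Pi.single a 1)) = (p : Q ⧸ stabGroup ρ E W D a) := by
    intro p hp
    rw [elemGroup] at hp
    induction hp using Subgroup.closure_induction_left with
    | one =>
      refine ⟨by rw [apply_one]; exact isPrimitiveOn_single ha, 0, fun B _ _ s hs => ?_⟩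
      rw [apply_one, hs.base]
    | mul_left x hx y _ ih =>
      obtain ⟨hP, B₀, ih⟩ := ih
      rcases hx with ⟨i, hi, j, hj, hij, rfl⟩ | hx
      · refine ⟨by rw [apply_mul]; exact hP.elem h hij hi, max B₀
          (max (l1 (ρ y (Pi.single a 1))) (l1 (ρ (E i j * y) (Pi.single a 1)))),
          fun B hB hB1 s hs => ?_⟩
        simp only [max_le_iff] at hB
        rw [apply_mul] at hB ⊢
        rw [hs.elem h ha hB1 hP hB.2.1 hi hj hij hB.2.2, ih B hB.1 hB1 s hs]
        rfl
      · refine ⟨by rw [apply_mul]; exact hP.signedOn h hx, max B₀ (l1 (ρ y (Pi.single a 1))),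
          fun B hB hB1 s hs => ?_⟩
        simp only [max_le_iff] at hB
        rw [apply_mul, hs.signed x hx _ hP hB.2, ih B hB.1 hB1 s hs]
        rfl
    | inv_mul_cancel x hx y _ ih =>
      obtain ⟨hP, B₀, ih⟩ := ih
      rcases hx with ⟨i, hi, j, hj, hij, rfl⟩ | hx
      · have hP' := hP.elem_inv h hij hi
        refine ⟨by rw [apply_mul]; exact hP', max B₀
          (max (l1 (ρ y (Pi.single a 1))) (l1 (ρ ((E i j)⁻¹ * y) (Pi.single a 1)))),
          fun B hB hB1 s hs => ?_⟩
        simp only [max_le_iff] at hB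
        rw [apply_mul] at hB ⊢
        have := hs.elem h ha hB1 hP' hB.2.2 hi hj hij (by rw [apply_inv_apply]; exact hB.2.1)
        rw [apply_inv_apply, ih B hB.1 hB1 s hs, eq_comm, ← eq_inv_smul_iff] at this
        rw [this]
        rfl
      · refine ⟨by rw [apply_mul]; exact hP.signedOn h (inv_mem hx),
          max B₀ (l1 (ρ y (Pi.single a 1))), fun B hB hB1 s hs => ?_⟩
        simp only [max_le_iff] at hB
        rw [apply_mul, hs.signed _ (inv_mem hx) _ hP hB.2, ih B hB.1 hB1 s hs]
        rfl
  obtain ⟨-, B₀, hB₀⟩ := key p hp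
  obtain ⟨s, hs⟩ := h.exists_isSection ha B₀.toNat
  have := hB₀ _ (by have := Int.self_le_toNat B₀; omega) (by omega) s hs
  rw [hpa, hs.base, QuotientGroup.eq, inv_one, one_mul] at this
  exact this

end IsElementarySystem

/-! ### Faithfulness of elementary systems -/

theorem Subgroup.mem_normalizer_of_conj_mem {G : Type*} [Group G] {H : Subgroup G} {g : G}
    (h1 : ∀ x ∈ H, g * x * g⁻¹ ∈ H) (h2 : ∀ x ∈ H, g⁻¹ * x * g⁻¹⁻¹ ∈ H) :
    g ∈ Subgroup.normalizer (H : Set G) := by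
  rw [Subgroup.mem_normalizer_iff]
  refine fun x => ⟨h1 x, fun h => ?_⟩
  have := h2 _ h
  group at this
  exact this

theorem Subgroup.conj_mem_closure {G : Type*} [Group G] {S : Set G} {H : Subgroup G} {g : G}
    (h : ∀ s ∈ S, g * s * g⁻¹ ∈ H) : ∀ x ∈ Subgroup.closure S, g * x * g⁻¹ ∈ H := by
  have : Subgroup.closure S ≤ H.comap (MulAut.conj g).toMonoidHom := by
    rw [Subgroup.closure_le]
    exact h
  exact this

namespace IsElementarySystem

variable {ι Q : Type*} [DecidableEq ι] [Group Q] {ρ : Q →* Module.End ℤ (ι → ℤ)} {E : ι → ι → Q}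
  {W : Subgroup Q}

variable (E) in
/-- The subgroup generated by the elementary elements `E a j`, `j ∈ D`. -/
def rowGroup (D : Finset ι) (a : ι) : Subgroup Q :=
  Subgroup.closure {q | ∃ j ∈ D, q = E a j}

theorem elem_mem_rowGroup {ι Q : Type*} [Group Q] {E : ι → ι → Q} {D : Finset ι} {a j : ι} (hj : j ∈ D) : E a j ∈ rowGroup E D a := by
  rw [rowGroup]
  exact Subgroup.subset_closure ⟨j, hj, rfl⟩

theorem elemGroup_le_normalizer (h : IsElementarySystem ρ E W) {D : Finset ι} {a : ι}
    (ha : a ∉ D) :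
    elemGroup ρ E W D ≤ Subgroup.normalizer (rowGroup E D a : Set Q) := by
  have hne : ∀ j ∈ D, a ≠ j := fun j hj e => ha (by rwa [e])
  rw [elemGroup, Subgroup.closure_le]
  rintro g (⟨i, hi, k, hk, hik, rfl⟩ | hg)
  · refine Subgroup.mem_normalizer_of_conj_mem (Subgroup.conj_mem_closure ?_)
      (Subgroup.conj_mem_closure ?_)
    all_goals
      rintro _ ⟨j, hj, rfl⟩
      by_cases hij : i = j
      · subst hij
        have h1 := h.chain a i k (hne i hi) hik (hne k hk)
        have h2 : Commute (E a k) (E i k) := h.comm a k i k (hne k hk) hik (hne k hk) hik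
        have mi := elem_mem_rowGroup (E := E) (a := a) hi
        have mk := elem_mem_rowGroup (E := E) (a := a) hk
        first
        | have e : E i k * E a i * (E i k)⁻¹ = E a i * (E a k)⁻¹ := by
            rw [mul_inv_eq_iff_eq_mul, mul_assoc, (Commute.inv_left h2).eq, ← mul_assoc, h1,
              mul_inv_cancel_right]
          rw [e]
          exact mul_mem mi (inv_mem mk)
        | have e : (E i k)⁻¹ * E a i * (E i k)⁻¹⁻¹ = E a i * E a k := by
            rw [inv_inv, mul_assoc, h1]; group
          rw [e]
          exact mul_mem mi mk
      · have hc := h.comm i k a j hik (hne j hj) hij (hne k hk)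
        have hc' : Commute (E i k) (E a j) := hc
        first
        | rw [hc'.eq, mul_inv_cancel_right]; exact elem_mem_rowGroup hj
        | rw [hc'.inv_left.eq, mul_inv_cancel_right]; exact elem_mem_rowGroup hj
  · have key : ∀ w ∈ signedOn ρ W D, ∀ x ∈ rowGroup E D a, w * x * w⁻¹ ∈ rowGroup E D a := by
      intro w hw
      refine Subgroup.conj_mem_closure ?_
      rintro _ ⟨j, hj, rfl⟩
      obtain ⟨σ, ε, -, h2, h3, h4⟩ := h.signedOn_data hw
      rw [h2 a j (hne j hj), (h3 a ha).1]
      exact zpow_mem (elem_mem_rowGroup (h4 j hj)) _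
    exact Subgroup.mem_normalizer_of_conj_mem (key g hg) (key _ (inv_mem hg))

/-- The stabilizer of e_a is, as for integral matrices, generated by the row group of `a` and the
elementary group on the remaining indices, and the latter normalizes the former. -/
theorem exists_mul_of_mem_stabGroup (h : IsElementarySystem ρ E W) {D : Finset ι} {a : ι}
    (ha : a ∉ D) {p : Q} (hp : p ∈ stabGroup ρ E W (insert a D) a) :
    ∃ t ∈ rowGroup E D a, ∃ q ∈ elemGroup ρ E W D, p = t * q := by
  have hle : stabGroup ρ E W (insert a D) a ≤ rowGroup E D a ⊔ elemGroup ρ E W D := by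
    rw [stabGroup, Subgroup.closure_le, Finset.erase_insert ha]
    rintro g (⟨i, hi, j, hj, hij, hja, rfl⟩ | hg)
    · have hj' : j ∈ D := (Finset.mem_insert.1 hj).resolve_left hja
      rcases Finset.mem_insert.1 hi with rfl | hi
      · exact Subgroup.mem_sup_left (elem_mem_rowGroup hj')
      · exact Subgroup.mem_sup_right (Subgroup.subset_closure (Or.inl ⟨i, hi, j, hj', hij, rfl⟩))
    · exact Subgroup.mem_sup_right (Subgroup.subset_closure (Or.inr hg))
  have := hle hp
  rw [← SetLike.mem_coe,
    Subgroup.coe_mul_of_right_le_normalizer_left _ _ (h.elemGroup_le_normalizer ha)] at this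
  obtain ⟨t, ht, q, hq, rfl⟩ := this
  exact ⟨t, ht, q, hq, rfl⟩

/-- The E a j commute, so an element is a product of their powers, and the exponent of E a j is read
off from the image of e_j. -/
theorem eq_one_of_mem_rowGroup (h : IsElementarySystem ρ E W) {D : Finset ι} {a : ι} (ha : a ∉ D)
    {t : Q} (ht : t ∈ rowGroup E D a) (hρ : ∀ v, ρ t v = v) : t = 1 := by
  induction D using Finset.induction_on generalizing t with
  | empty =>
    have : rowGroup E ∅ a = ⊥ := by simp [rowGroup]
    rwa [this, Subgroup.mem_bot] at ht
  | insert j D hj ih =>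
    rw [Finset.mem_insert, not_or] at ha
    have hne : ∀ j ∈ D, a ≠ j := fun j hj e => ha.2 (by rwa [e])
    have hcomm : ∀ x ∈ rowGroup E D a, Commute x (E a j) ∧
        ρ x (Pi.single j 1) = Pi.single j 1 := by
      intro x hx
      rw [rowGroup] at hx
      induction hx using Subgroup.closure_induction with
      | one => exact ⟨Commute.one_left _, apply_one ρ _⟩
      | mul x y _ _ hx hy =>
        exact ⟨hx.1.mul_left hy.1, by rw [apply_mul, hy.2, hx.2]⟩
      | inv x _ hx => exact ⟨hx.1.inv_left, by conv_lhs => rw [← hx.2, inv_apply_apply]⟩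
      | mem x hx =>
        obtain ⟨k, hk, rfl⟩ := hx
        refine ⟨h.comm a k a j (hne k hk) ha.1 ha.1 (hne k hk), h.E_single (hne k hk) ?_⟩
        rintro rfl
        exact hj hk
    have hdec : ∀ x ∈ rowGroup E (insert j D) a, ∃ c : ℤ, ∃ y ∈ rowGroup E D a,
        x = E a j ^ c * y := by
      intro x hx
      rw [rowGroup] at hx
      induction hx using Subgroup.closure_induction with
      | one => exact ⟨0, 1, one_mem _, by simp⟩
      | mul x y _ _ hx hy =>
        obtain ⟨c, x, hx, rfl⟩ := hx
        obtain ⟨d, y, hy, rfl⟩ := hy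
        refine ⟨c + d, x * y, mul_mem hx hy, ?_⟩
        rw [zpow_add, mul_assoc, ← mul_assoc x, ((hcomm x hx).1.zpow_right d).eq]
        simp only [mul_assoc]
      | inv x _ hx =>
        obtain ⟨c, x, hx, rfl⟩ := hx
        refine ⟨-c, x⁻¹, inv_mem hx, ?_⟩
        rw [mul_inv_rev, zpow_neg, (((hcomm x hx).1.zpow_right c).inv_inv).eq]
      | mem x hx =>
        obtain ⟨k, hk, rfl⟩ := hx
        rcases Finset.mem_insert.1 hk with rfl | hk
        · exact ⟨1, 1, one_mem _, by simp⟩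
        · exact ⟨0, E a k, elem_mem_rowGroup hk, by simp⟩
    obtain ⟨c, y, hy, rfl⟩ := hdec t ht
    have hpow : ∀ c : ℤ, ρ (E a j ^ c) (Pi.single j 1) = Pi.single j 1 + Pi.single a c := by
      have hja : j ≠ a := Ne.symm ha.1
      intro c
      induction c using Int.induction_on with
      | zero => simp
      | succ n ihn =>
        rw [zpow_add_one, (Commute.self_zpow (E a j) n).symm.eq, apply_mul, ihn, h.apply_E a j ha.1]
        simp [hja, add_assoc, Pi.single_add]
      | pred n ihn =>
        rw [zpow_sub_one, (Commute.self_zpow (E a j) (-n)).symm.inv_right.eq, apply_mul, ihn,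
          h.E_inv ha.1]
        simp [hja, sub_eq_add_neg, add_assoc, Pi.single_add, Pi.single_neg]
    have hc := congrFun (hρ (Pi.single j 1)) a
    rw [apply_mul, (hcomm y hy).2, hpow] at hc
    simp only [Pi.add_apply, Pi.single_eq_same, add_eq_left] at hc
    subst hc
    rw [zpow_zero, one_mul] at hρ ⊢
    exact ih ha.2 hy hρ

theorem elemGroup_apply_of_notMem (h : IsElementarySystem ρ E W) {D : Finset ι} {a : ι}
    (ha : a ∉ D) {q : Q} (hq : q ∈ elemGroup ρ E W D) : ∀ v, ρ q v a = v a := by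
  rw [elemGroup] at hq
  induction hq using Subgroup.closure_induction with
  | one => intro v; rw [apply_one]
  | mul x y _ _ hx hy => intro v; rw [apply_mul, hx, hy]
  | inv x _ hx => intro v; rw [← hx (ρ x⁻¹ v), apply_inv_apply]
  | mem x hx =>
    intro v
    rcases hx with ⟨i, hi, j, hj, hij, rfl⟩ | hx
    · exact h.E_ne hij (fun e => ha (by rwa [e])) v
    · obtain ⟨σ, ε, h1, -, h3, -⟩ := h.signedOn_data hx
      have := h1 v a
      rwa [(h3 a ha).1, (h3 a ha).2, Units.val_one, one_mul] at this

theorem rowGroup_apply_of_ne (h : IsElementarySystem ρ E W) {D : Finset ι} {a k : ι}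
    (ha : a ∉ D) (hk : k ≠ a) {q : Q} (hq : q ∈ rowGroup E D a) : ∀ v, ρ q v k = v k := by
  rw [rowGroup] at hq
  induction hq using Subgroup.closure_induction with
  | one => intro v; rw [apply_one]
  | mul x y _ _ hx hy => intro v; rw [apply_mul, hx, hy]
  | inv x _ hx => intro v; rw [← hx (ρ x⁻¹ v), apply_inv_apply]
  | mem x hx =>
    intro v
    obtain ⟨j, hj, rfl⟩ := hx
    exact h.E_ne (fun e => ha (by rwa [e])) hk v

/-- An elementary system acts faithfully. -/
theorem eq_one_of_mem_elemGroup [Fintype ι] (h : IsElementarySystem ρ E W) {D : Finset ι} {p : Q}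
    (hp : p ∈ elemGroup ρ E W D) (hρ : ∀ v, ρ p v = v) : p = 1 := by
  induction D using Finset.induction_on generalizing p with
  | empty =>
    have hle : elemGroup ρ E W ∅ ≤ W := by
      rw [elemGroup, Subgroup.closure_le]
      rintro g (⟨i, hi, -⟩ | hg)
      · exact absurd hi (Finset.notMem_empty i)
      · exact hg.1
    exact h.faithful p (hle hp) hρ
  | insert a D ha ih =>
    obtain ⟨t, ht, q, hq, rfl⟩ := h.exists_mul_of_mem_stabGroup ha
      (h.mem_stabGroup (Finset.mem_insert_self a D) hp (hρ _))
    have htq : ∀ v, ρ t v = ρ q⁻¹ v := by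
      intro v
      have := hρ (ρ q⁻¹ v)
      rwa [apply_mul, apply_inv_apply] at this
    -- `t` can only change coordinate `a` while `q` leaves it alone; as their product acts
    -- trivially, each of them does.
    have ht1 : t = 1 := by
      refine h.eq_one_of_mem_rowGroup ha ht fun v => ?_
      ext k
      by_cases hk : k = a
      · subst hk
        rw [htq, h.elemGroup_apply_of_notMem ha (inv_mem hq)]
      · exact h.rowGroup_apply_of_ne ha hk ht v
    subst ht1
    rw [one_mul] at hρ ⊢
    exact ih hq hρ

end IsElementarySystem

/-! ### The action on ℤ^n and Magnus' theorem -/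

namespace FreeAut

open FreeGroup (of lift)
open scoped commutatorElement

section

variable {ι : Type*}

theorem IsSignedPerm.exists_sign {f : MulAut (FreeGroup ι)} {σ : Equiv.Perm ι}
    (hf : IsSignedPerm f σ) :
    ∃ ε : ι → ℤˣ, ∀ i, f (of i) = of (σ i) ^ (ε i : ℤ) := by
  have : ∀ i, ∃ ε : ℤˣ, f (of i) = of (σ i) ^ (ε : ℤ) := by
    intro i
    rcases hf i with h | h
    · exact ⟨1, by simp [h]⟩
    · exact ⟨-1, by simp [h]⟩
  choose ε hε using this
  exact ⟨ε, hε⟩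

theorem exists_signAut (ε : ι → ℤˣ) :
    ∃ f : MulAut (FreeGroup ι), ∀ i, f (of i) = of i ^ (ε i : ℤ) := by
  have h : ∀ i : ι, lift (fun i => of i ^ (ε i : ℤ)) ((of i : FreeGroup ι) ^ (ε i : ℤ)) = of i := by
    intro i
    rw [map_zpow, FreeGroup.lift_apply_of, ← zpow_mul, Int.units_coe_mul_self, zpow_one]
  exact ⟨substAut _ _ h h, fun i => substAut_of _ _ _ _ i⟩

end

variable {ι : Type*} [DecidableEq ι]

/-- The exponent sums of a word. -/
def abVec (x : FreeGroup ι) : ι → ℤ :=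
  (lift (fun i => Multiplicative.ofAdd (Pi.single i (1 : ℤ) : ι → ℤ)) x).toAdd

@[simp] theorem abVec_of (i : ι) : abVec (of i) = Pi.single i 1 := by simp [abVec]

@[simp] theorem abVec_one : abVec (1 : FreeGroup ι) = 0 := by simp [abVec]

@[simp] theorem abVec_mul (x y : FreeGroup ι) : abVec (x * y) = abVec x + abVec y := by
  simp [abVec]

@[simp] theorem abVec_inv (x : FreeGroup ι) : abVec x⁻¹ = -abVec x := by simp [abVec]

theorem rightMul_chain {i j l : ι} (hij : i ≠ j) (hjl : j ≠ l) (hil : i ≠ l) :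
    rightMul j i * rightMul l j = rightMul l j * rightMul j i * rightMul l i := by
  refine mulAut_ext fun m => ?_
  simp only [MulAut.mul_apply]
  by_cases hmj : m = j
  · subst hmj
    rw [rightMul_of_ne _ hjl, rightMul_of_ne _ hjl, rightMul_of_self hij, map_mul,
      rightMul_of_ne _ hjl, rightMul_of_ne _ hil]
  by_cases hml : m = l
  · subst hml
    rw [rightMul_of_self hjl, rightMul_of_self hil, map_mul, map_mul, map_mul,
      rightMul_of_ne _ hmj, rightMul_of_self hij, rightMul_of_ne _ hij, rightMul_of_ne _ hil,
      rightMul_of_self hjl, mul_assoc]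
  · rw [rightMul_of_ne _ hml, rightMul_of_ne _ hml, rightMul_of_ne _ hmj, rightMul_of_ne _ hml]

theorem abVec_zpow (x : FreeGroup ι) (n : ℤ) : abVec (x ^ n) = n • abVec x := by
  simp [abVec]

variable [Fintype ι]

theorem linearCombination_abVec (f : MulAut (FreeGroup ι)) (x : FreeGroup ι) :
    Fintype.linearCombination ℤ (fun j => abVec (f (of j))) (abVec x) = abVec (f x) := by
  induction x using FreeGroup.induction_on with
  | C1 => simp
  | of i => simp
  | inv_of i h => rw [abVec_inv, map_neg, h, map_inv, abVec_inv]
  | mul x y hx hy => rw [abVec_mul, map_add, hx, hy, map_mul, abVec_mul]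

/-- The action of `Aut (F_n)` on the abelianization `ℤ^n`. -/
def abHom (ι : Type*) [DecidableEq ι] [Fintype ι] :
    MulAut (FreeGroup ι) →* Module.End ℤ (ι → ℤ) where
  toFun f := Fintype.linearCombination ℤ (fun j => abVec (f (of j)))
  map_one' := by
    refine LinearMap.pi_ext' fun i => LinearMap.ext_ring ?_
    simp
  map_mul' f g := by
    refine LinearMap.pi_ext' fun i => LinearMap.ext_ring ?_
    simp [linearCombination_abVec]

theorem abHom_abVec (f : MulAut (FreeGroup ι)) (x : FreeGroup ι) :
    abHom ι f (abVec x) = abVec (f x) := linearCombination_abVec f x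

theorem abHom_apply (f : MulAut (FreeGroup ι)) (v : ι → ℤ) :
    abHom ι f v = ∑ i, v i • abVec (f (of i)) := rfl

theorem abHom_eq_one_iff {f : MulAut (FreeGroup ι)} :
    abHom ι f = 1 ↔ ∀ i, abVec (f (of i)) = abVec (of i) := by
  constructor
  · intro h i
    rw [← abHom_abVec, h]
    rfl
  · intro h
    refine LinearMap.pi_ext' fun i => LinearMap.ext_ring ?_
    have := abHom_abVec f (of i)
    rw [abVec_of] at this
    simp [this, h]

theorem magnusSubgroup_le_ker : magnusSubgroup ι ≤ (abHom ι).ker := by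
  rw [magnusSubgroup, Subgroup.closure_le]
  rintro f hf
  rw [SetLike.mem_coe, MonoidHom.mem_ker, abHom_eq_one_iff]
  intro i
  rcases hf with ⟨a, b, hab, rfl⟩ | ⟨a, b, c, hab, hac, rfl⟩
  · by_cases hi : i = a
    · subst hi; rw [conjHom_of_self (of_mem_avoiding hab.symm)]; simp
    · rw [conjHom_of_ne _ hi]
  · by_cases hi : i = a
    · subst hi
      rw [rightHom_of_self (commutatorElement_mem_avoiding hab.symm hac.symm)]
      simp [commutatorElement_def]
    · rw [rightHom_of_ne _ hi]

/-- The subgroup of signed permutations. -/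
def signedPerms (ι : Type*) : Subgroup (MulAut (FreeGroup ι)) where
  carrier := {f | ∃ σ, IsSignedPerm f σ}
  one_mem' := ⟨1, IsSignedPerm.one⟩
  mul_mem' := fun ⟨σ, hσ⟩ ⟨τ, hτ⟩ => ⟨σ * τ, hσ.mul hτ⟩
  inv_mem' := fun ⟨σ, hσ⟩ => ⟨σ⁻¹, hσ.inv⟩

/-- The automorphism of `ℤ^n` induced by a class modulo `magnusSubgroup`. -/
def quotHom (ι : Type*) [DecidableEq ι] [Fintype ι] :
    MulAut (FreeGroup ι) ⧸ magnusSubgroup ι →* Module.End ℤ (ι → ℤ) :=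
  QuotientGroup.lift _ (abHom ι) magnusSubgroup_le_ker

theorem mk_eq_one_of_mem {f : MulAut (FreeGroup ι)} (hf : f ∈ magnusSubgroup ι) :
    (f : MulAut (FreeGroup ι) ⧸ magnusSubgroup ι) = 1 :=
  (QuotientGroup.eq_one_iff f).2 hf

/-- The product of the two is a conjugation of x_a, hence trivial in the quotient. -/
theorem mk_leftMul (a i : ι) : ((leftMul a i : MulAut (FreeGroup ι)) :
    MulAut (FreeGroup ι) ⧸ magnusSubgroup ι) = (rightMul a i : MulAut (FreeGroup ι))⁻¹ := by
  have := mk_eq_one_of_mem (conjHom_mem a (of i))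
  rw [conjHom_apply, leftHom_of, rightHom_of, QuotientGroup.mk_mul] at this
  exact eq_inv_of_mul_eq_one_left this

theorem abHom_rightMul {a i : ι} (h : i ≠ a) (v : ι → ℤ) :
    abHom ι (rightMul a i) v = v + Pi.single i (v a) := by
  have e : abHom ι (rightMul a i) = 1 + (LinearMap.single ℤ (fun _ => ℤ) i).comp
      (LinearMap.proj a) := by
    refine LinearMap.pi_ext' fun k => LinearMap.ext_ring ?_
    have := abHom_abVec (rightMul a i) (of k)
    rw [abVec_of] at this
    simp only [LinearMap.coe_comp, LinearMap.coe_single, Function.comp_apply, this,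
      LinearMap.add_apply, Module.End.one_apply, LinearMap.coe_proj, Function.eval]
    by_cases hk : k = a
    · subst hk; rw [rightMul_of_self h]; simp
    · rw [rightMul_of_ne _ hk]; simp [Ne.symm hk]
  rw [e]
  rfl

/-- With equal target letters the commutator is `rightHom j ⁅of i, of k⁆`, which is trivial modulo
Magnus' subgroup; with different targets the automorphisms themselves commute. -/
theorem commute_mk_rightMul {i j k l : ι} (hij : i ≠ j) (hkl : k ≠ l) (hil : i ≠ l) (hkj : k ≠ j) :
    Commute (rightMul j i : MulAut (FreeGroup ι) ⧸ magnusSubgroup ι)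
      (rightMul l k : MulAut (FreeGroup ι)) := by
  by_cases hjl : j = l
  · subst hjl
    have := mk_eq_one_of_mem (rightHom_mem (a := j) (commutatorElement_mem (of i) (of k)))
    rw [map_commutatorElement, rightHom_of, rightHom_of] at this
    exact commutatorElement_eq_one_iff_commute.1 this
  · have : rightMul j i * rightMul l k = rightMul l k * rightMul j i := by
      refine mulAut_ext fun m => ?_
      rw [MulAut.mul_apply, MulAut.mul_apply]
      by_cases hmj : m = j
      · subst hmj
        rw [rightMul_of_ne _ hjl, rightMul_of_self hij, map_mul, rightMul_of_ne _ hjl,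
          rightMul_of_ne _ hil]
      by_cases hml : m = l
      · subst hml
        rw [rightMul_of_ne _ hmj, rightMul_of_self hkl, map_mul, rightMul_of_ne _ hmj,
          rightMul_of_ne _ hkj]
      · rw [rightMul_of_ne _ hmj, rightMul_of_ne _ hml, rightMul_of_ne _ hmj]
    exact congrArg (QuotientGroup.mk (s := magnusSubgroup ι)) this

theorem abHom_of_sign {f : MulAut (FreeGroup ι)} {σ : Equiv.Perm ι} {ε : ι → ℤˣ}
    (hε : ∀ i, f (of i) = of (σ i) ^ (ε i : ℤ)) (v : ι → ℤ) (i : ι) :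
    abHom ι f v (σ i) = ε i * v i := by
  rw [abHom_apply, Finset.sum_apply, Finset.sum_eq_single i]
  · simp [hε, abVec_zpow, mul_comm]
  · intro j _ hj
    simp [hε, abVec_zpow, hj.symm]
  · simp

theorem mk_conj_rightMul {f : MulAut (FreeGroup ι)} {σ : Equiv.Perm ι} {ε : ι → ℤˣ}
    (hε : ∀ i, f (of i) = of (σ i) ^ (ε i : ℤ)) {i j : ι} (hij : i ≠ j) :
    ((f * rightMul j i * f⁻¹ : MulAut (FreeGroup ι)) :
      MulAut (FreeGroup ι) ⧸ magnusSubgroup ι) =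
      (rightMul (σ j) (σ i) : MulAut (FreeGroup ι) ⧸ magnusSubgroup ι) ^
        ((ε i * ε j : ℤˣ) : ℤ) := by
  have hσ : σ i ≠ σ j := σ.injective.ne hij
  have hother : ∀ g : MulAut (FreeGroup ι), (∀ k, k ≠ σ j → g (of k) = of k) →
      g (f (of j)) = f (of j) * f (of i) → f * rightMul j i * f⁻¹ = g := by
    intro g h1 h2
    rw [mul_inv_eq_iff_eq_mul]
    refine mulAut_ext fun k => ?_
    rw [MulAut.mul_apply, MulAut.mul_apply]
    by_cases hk : k = j
    · subst hk; rw [h2, rightMul_of_self hij, map_mul]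
    · rw [rightMul_of_ne _ hk, hε k, map_zpow, h1 _ (σ.injective.ne hk)]
  rcases Int.units_eq_one_or (ε i) with hi | hi <;> rcases Int.units_eq_one_or (ε j) with hj | hj
  · rw [hother (rightMul (σ j) (σ i)) (fun k => rightMul_of_ne _)
      (by rw [hε, hε, hi, hj]; simp [rightMul_of_self hσ])]
    simp [hi, hj]
  · rw [hother (leftMul (σ j) (σ i)) (fun k => leftMul_of_ne _)
      (by rw [hε, hε, hi, hj]; simp [leftMul_of_self hσ])]
    simp [hi, hj, mk_leftMul]
  · rw [hother (rightMul (σ j) (σ i))⁻¹ (fun k => rightMul_inv_of_ne _)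
      (by rw [hε, hε, hi, hj]; simp [rightMul_inv_of_self hσ])]
    simp [hi, hj]
  · rw [hother (leftMul (σ j) (σ i))⁻¹ (fun k => leftMul_inv_of_ne _)
      (by
        have h := leftMul_inv_of_self hσ
        generalize (leftMul (σ j) (σ i))⁻¹ = g at *
        rw [hε, hε, hi, hj]; simp [h])]
    simp [hi, hj, mk_leftMul]

/-- The indices are reversed: x_j ↦ x_j x_i acts on column vectors by adding coordinate `j` to
coordinate `i`. -/
theorem isElementarySystem : IsElementarySystem (quotHom ι)
    (fun i j => ((rightMul j i : MulAut (FreeGroup ι)) : MulAut (FreeGroup ι) ⧸ magnusSubgroup ι))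
    ((signedPerms ι).map (QuotientGroup.mk' (magnusSubgroup ι))) where
  apply_E i j hij v := abHom_rightMul hij v
  comm i j k l hij hkl hil hkj := commute_mk_rightMul hij hkl hil hkj
  chain i j l hij hjl hil :=
    congrArg (QuotientGroup.mk (s := magnusSubgroup ι)) (rightMul_chain hij hjl hil)
  swap_mem i j hij := by
    refine ⟨signedSwap j i, ⟨_, isSignedPerm_signedSwap hij.symm⟩, ?_⟩
    rw [signedSwap, QuotientGroup.mk'_apply, QuotientGroup.mk_mul, QuotientGroup.mk_mul,
      QuotientGroup.mk_inv, QuotientGroup.mk_inv, mk_leftMul, QuotientGroup.mk_inv, inv_inv]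
  conj := by
    rintro _ ⟨f, ⟨σ, hσ⟩, rfl⟩
    obtain ⟨ε, hε⟩ := hσ.exists_sign
    exact ⟨σ, ε, fun v i => abHom_of_sign hε v i, fun i j hij => mk_conj_rightMul hε hij⟩
  sign ε := by
    obtain ⟨f, hf⟩ := exists_signAut ε
    refine ⟨f, ⟨f, ⟨1, fun i => ?_⟩, rfl⟩, fun v i => abHom_of_sign (σ := 1) hf v i⟩
    rcases Int.units_eq_one_or (ε i) with h | h <;> simp [hf, h]
  faithful := by
    rintro _ ⟨f, ⟨σ, hσ⟩, rfl⟩ h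
    obtain ⟨ε, hε⟩ := hσ.exists_sign
    have : f = 1 := by
      refine mulAut_ext fun i => ?_
      have h1 := abHom_of_sign hε (Pi.single i 1) i
      have h2 : abHom ι f (Pi.single i 1) = Pi.single i 1 := h _
      rw [h2, Pi.single_eq_same, mul_one] at h1
      by_cases hi : σ i = i
      · rw [hi, Pi.single_eq_same] at h1
        rw [hε, hi, ← h1, zpow_one]; rfl
      · rw [Pi.single_eq_of_ne hi] at h1
        exact absurd h1.symm (ε i).ne_zero
    rw [this, map_one]

/-- **Magnus' theorem**: the kernel of the action of `Aut (F_n)` on `ℤ^n` is generated by Magnus'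
generators. -/
theorem ker_abHom : (abHom ι).ker = magnusSubgroup ι := by
  refine le_antisymm (fun f hf => ?_) magnusSubgroup_le_ker
  rw [← QuotientGroup.eq_one_iff]
  refine isElementarySystem.eq_one_of_mem_elemGroup (D := Finset.univ) ?_ fun v => ?_
  · have hle : Subgroup.closure (nielsenGenerators ι) ≤
        (IsElementarySystem.elemGroup (quotHom ι) (fun i j =>
          ((rightMul j i : MulAut (FreeGroup ι)) : MulAut (FreeGroup ι) ⧸ magnusSubgroup ι))
          ((signedPerms ι).map (QuotientGroup.mk' (magnusSubgroup ι))) Finset.univ).comap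
          (QuotientGroup.mk' (magnusSubgroup ι)) := by
      rw [Subgroup.closure_le, IsElementarySystem.elemGroup]
      rintro g (⟨a, i, hia, rfl⟩ | ⟨σ, hσ⟩)
      · exact Subgroup.subset_closure (Or.inl ⟨i, Finset.mem_univ _, a, Finset.mem_univ _, hia,
          rfl⟩)
      · exact Subgroup.subset_closure (Or.inr ⟨⟨g, ⟨σ, hσ⟩, rfl⟩,
          fun i hi => absurd (Finset.mem_univ i) hi⟩)
    rw [closure_nielsenGenerators] at hle
    exact hle (Subgroup.mem_top f)
  · change abHom ι f v = v
    rw [MonoidHom.mem_ker.1 hf]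
    rfl

end FreeAut

/-! ### Commuting chains in the lower central series of Magnus' subgroup -/

namespace FreeAut

open FreeGroup (of lift)
open scoped commutatorElement

section

variable {ι : Type*}

theorem supportedIn_mono {D E : Set ι} (h : D ⊆ E) : supportedIn D ≤ supportedIn E := by
  intro f hf
  have key : ∀ f ∈ supportedIn D, ∀ i ∈ E, f (of i) ∈ wordsIn E := by
    intro f hf i hi
    by_cases hiD : i ∈ D
    · exact wordsIn_mono h ((hf.2 _).2 (of_mem_wordsIn hiD))
    · rw [hf.1 i hiD]; exact of_mem_wordsIn hi
  exact mem_supportedIn_of_apply_mem (fun i hi => hf.1 i fun hiD => hi (h hiD)) (key f hf)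
    (key _ (inv_mem hf))

theorem exists_perm_image_subset [Fintype ι] [DecidableEq ι] {D T : Finset ι}
    (h : D.card + T.card ≤ Fintype.card ι) :
    ∃ σ : Equiv.Perm ι, Disjoint (σ '' (D : Set ι)) (T : Set ι) := by
  have hc : D.card ≤ Tᶜ.card := by rw [Finset.card_compl]; omega
  obtain ⟨D', hD', hcard⟩ := Finset.exists_subset_card_eq hc
  let e : {x // x ∈ D} ≃ {x // x ∈ D'} := Finset.equivOfCardEq hcard.symm
  refine ⟨e.extendSubtype, ?_⟩
  rw [Set.disjoint_left]
  rintro _ ⟨x, hx, rfl⟩ hT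
  have := hD' (e.extendSubtype_mem x hx)
  rw [Finset.mem_compl] at this
  exact this hT

variable [DecidableEq ι]

theorem exists_supportedIn_of_mem_iteratedCommutators {k : ℕ} {f : MulAut (FreeGroup ι)}
    (hf : f ∈ iteratedCommutators (magnusGenerators ι) k) :
    ∃ D : Finset ι, D.card ≤ 3 * (k + 1) ∧ f ∈ supportedIn (D : Set ι) := by
  induction k generalizing f with
  | zero => simpa using exists_supportedIn_of_mem_magnusGenerators hf
  | succ k ih =>
    obtain ⟨c, hc, s, hs, rfl⟩ := hf
    obtain ⟨D, hD, hcD⟩ := ih hc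
    obtain ⟨E, hE, hsE⟩ := exists_supportedIn_of_mem_magnusGenerators hs
    have h1 : c ∈ supportedIn ((D ∪ E : Finset ι) : Set ι) :=
      supportedIn_mono (by simp) hcD
    have h2 : s ∈ supportedIn ((D ∪ E : Finset ι) : Set ι) :=
      supportedIn_mono (by simp) hsE
    refine ⟨D ∪ E, (Finset.card_union_le _ _).trans (by omega), ?_⟩
    rw [commutatorElement_def]
    exact mul_mem (mul_mem (mul_mem h1 h2) (inv_mem h1)) (inv_mem h2)

/-- If `a ∈ D` the only possible new letter is `b`; otherwise it is `a`. This is the source of the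
+1 in the bound on the rank. -/
theorem swap_image_union_card {D : Finset ι} (a b : ι) :
    (D ∪ D.image (Equiv.swap a b)).card ≤ D.card + 1 := by
  by_cases ha : a ∈ D
  · have : D ∪ D.image (Equiv.swap a b) ⊆ insert b D := by
      intro x hx
      rcases Finset.mem_union.1 hx with hx | hx
      · exact Finset.mem_insert_of_mem hx
      · obtain ⟨y, hy, rfl⟩ := Finset.mem_image.1 hx
        by_cases h1 : y = a
        · simp [h1]
        · by_cases h2 : y = b
          · simp [h2, ha]
          · rw [Equiv.swap_apply_of_ne_of_ne h1 h2]; exact Finset.mem_insert_of_mem hy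
    exact (Finset.card_le_card this).trans (Finset.card_insert_le _ _)
  · have : D ∪ D.image (Equiv.swap a b) ⊆ insert a D := by
      intro x hx
      rcases Finset.mem_union.1 hx with hx | hx
      · exact Finset.mem_insert_of_mem hx
      · obtain ⟨y, hy, rfl⟩ := Finset.mem_image.1 hx
        have h1 : y ≠ a := fun e => ha (e ▸ hy)
        by_cases h2 : y = b
        · simp [h2]
        · rw [Equiv.swap_apply_of_ne_of_ne h1 h2]; exact Finset.mem_insert_of_mem hy
    exact (Finset.card_le_card this).trans (Finset.card_insert_le _ _)

end

variable {ι : Type*} [DecidableEq ι] [Fintype ι]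

/-- `x` and `y` are commuting elements of `L` at which `χ` does not vanish. -/
def CommuteOff {Γ : Type*} [Group Γ] (L : Subgroup Γ) (χ : Γ → ℝ) (x y : Γ) : Prop :=
  x ∈ L ∧ y ∈ L ∧ Commute x y ∧ χ x ≠ 0 ∧ χ y ≠ 0

theorem CommuteOff.symm {Γ : Type*} [Group Γ] {L : Subgroup Γ} {χ : Γ → ℝ} {x y : Γ}
    (h : CommuteOff L χ x y) : CommuteOff L χ y x :=
  ⟨h.2.1, h.1, h.2.2.1.symm, h.2.2.2.2, h.2.2.2.1⟩

theorem reflTransGen_commuteOff_symm {Γ : Type*} [Group Γ] {L : Subgroup Γ} {χ : Γ → ℝ} {x y : Γ}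
    (h : Relation.ReflTransGen (CommuteOff L χ) x y) :
    Relation.ReflTransGen (CommuteOff L χ) y x := by
  induction h with
  | refl => exact Relation.ReflTransGen.refl
  | tail _ h ih => exact (Relation.ReflTransGen.single h.symm).trans ih

/-- A commutator `c` with χ c ≠ 0 involves at most 3(k+1) letters. Its permuted copies, conjugated
by one well-chosen `g`, all have nonzero χ, and copies with disjoint letters commute. A copy and its
transposed copy together occupy at most 3(k+1) + 1 letters, so a third copy disjoint from both
exists when 6(k+1) + 1 ≤ n. -/
theorem exists_commuting_chain {k : ℕ} (hn : 6 * (k + 1) + 1 ≤ Fintype.card ι)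
    {χ : MulAut (FreeGroup ι) → ℝ} (hχ : IsLcsCharacter (magnusSubgroup ι) k χ)
    (hne : ∃ x ∈ (magnusSubgroup ι).lowerCentralSeries k, χ x ≠ 0) :
    ∃ b ∈ (magnusSubgroup ι).lowerCentralSeries k, χ b ≠ 0 ∧ ∀ m ∈ magnusSubgroup ι,
      Relation.ReflTransGen (CommuteOff ((magnusSubgroup ι).lowerCentralSeries k) χ)
        b (m * b * m⁻¹) := by
  obtain ⟨c, hcI, hc0⟩ : ∃ c ∈ iteratedCommutators (magnusGenerators ι) k, χ c ≠ 0 := by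
    by_contra! hcon
    obtain ⟨x, hx, hx0⟩ := hne
    exact hx0 (hχ.eq_zero_of_iteratedCommutators (M := magnusSubgroup ι)
      (S := magnusGenerators ι) rfl hcon x hx)
  obtain ⟨D₀, hD₀, hcD₀⟩ := exists_supportedIn_of_mem_iteratedCommutators hcI
  obtain ⟨D, hDD, hD⟩ := Finset.exists_superset_card_eq hD₀ (by omega)
  have hcD : c ∈ supportedIn (D : Set ι) := supportedIn_mono (by exact_mod_cast hDD) hcD₀
  choose w hwU hwσ using fun σ : Equiv.Perm ι => exists_isSignedPerm σ
  have hnorm : ∀ g x, x ∈ (magnusSubgroup ι).lowerCentralSeries k →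
      g * x * g⁻¹ ∈ (magnusSubgroup ι).lowerCentralSeries k :=
    fun g x hx => Subgroup.Normal.conj_mem inferInstance x hx g
  have hcL : c ∈ (magnusSubgroup ι).lowerCentralSeries k :=
    iteratedCommutators_subset (M := magnusSubgroup ι) Subgroup.subset_closure k hcI
  -- Each copy can separately be conjugated back to `c` by a product of transvections; polynomiality
  -- gives one `g` for all copies.
  obtain ⟨g, -, hg⟩ := hχ.exists_conj_forall_ne_zero
    (fun u hu => isUnipotentOn_of_mem_transvections (ι := ι) hu)
    (fun σ : Equiv.Perm ι => w σ * c * (w σ)⁻¹) (fun σ => hnorm _ _ hcL)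
    (fun σ => ⟨(w σ)⁻¹, inv_mem (hwU σ), by
      have : (w σ)⁻¹ * (w σ * c * (w σ)⁻¹) * (w σ)⁻¹⁻¹ = c := by group
      rwa [this]⟩)
  let x : Equiv.Perm ι → MulAut (FreeGroup ι) := fun σ => g * (w σ * c * (w σ)⁻¹) * g⁻¹
  have hxL : ∀ σ : Equiv.Perm ι, x σ ∈ (magnusSubgroup ι).lowerCentralSeries k :=
    fun σ => hnorm _ _ (hnorm _ _ hcL)
  have hsupp : ∀ σ : Equiv.Perm ι, w σ * c * (w σ)⁻¹ ∈ supportedIn (σ '' (D : Set ι)) :=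
    fun σ => (hwσ σ).conj_mem_supportedIn hcD
  have hconj : ∀ p q : MulAut (FreeGroup ι), Commute p q →
      Commute (g * p * g⁻¹) (g * q * g⁻¹) := fun p q hpq => by
    simpa using hpq.map (MulAut.conj g)
  have hR : ∀ σ τ : Equiv.Perm ι, Disjoint (σ '' (D : Set ι)) (τ '' (D : Set ι)) →
      CommuteOff ((magnusSubgroup ι).lowerCentralSeries k) χ (x σ) (x τ) := fun σ τ hd =>
    ⟨hxL σ, hxL τ, hconj _ _ (commute_of_supportedIn hd (hsupp σ) (hsupp τ)), hg σ, hg τ⟩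
  have hswap : ∀ (a b : ι) (σ : Equiv.Perm ι),
      Relation.ReflTransGen (CommuteOff ((magnusSubgroup ι).lowerCentralSeries k) χ)
        (x σ) (x (Equiv.swap a b * σ)) := by
    intro a b σ
    have hcard := swap_image_union_card (D := D.image σ) a b
    rw [Finset.card_image_of_injective _ σ.injective] at hcard
    obtain ⟨τ, hτ⟩ := exists_perm_image_subset (D := D)
      (T := D.image σ ∪ (D.image σ).image (Equiv.swap a b)) (by omega)
    rw [Finset.coe_union, Set.disjoint_union_right, Finset.coe_image, Finset.coe_image,
      Finset.coe_image, ← Set.image_comp] at hτ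
    exact (Relation.ReflTransGen.single (hR _ _ hτ.1.symm)).trans
      (Relation.ReflTransGen.single (hR _ _ hτ.2))
  have hall : ∀ σ : Equiv.Perm ι, Relation.ReflTransGen
      (CommuteOff ((magnusSubgroup ι).lowerCentralSeries k) χ) (x 1) (x σ) := by
    intro σ
    induction σ using Equiv.Perm.swap_induction_on with
    | one => exact Relation.ReflTransGen.refl
    | swap_mul σ a b _ ih => exact ih.trans (hswap a b σ)
  refine ⟨x 1, hxL 1, hg 1, ?_⟩
  have htrans : ∀ m ∈ magnusSubgroup ι, ∀ p q, Relation.ReflTransGen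
      (CommuteOff ((magnusSubgroup ι).lowerCentralSeries k) χ) p q → Relation.ReflTransGen
      (CommuteOff ((magnusSubgroup ι).lowerCentralSeries k) χ) (m * p * m⁻¹) (m * q * m⁻¹) := by
    intro m hm p q hpq
    refine Relation.ReflTransGen.lift (fun y => m * y * m⁻¹) ?_ _ _ hpq
    rintro p q ⟨h1, h2, h3, h4, h5⟩
    refine ⟨hnorm _ _ h1, hnorm _ _ h2, by simpa using h3.map (MulAut.conj m), ?_, ?_⟩
    · rwa [hχ.map_conj h1 hm]
    · rwa [hχ.map_conj h2 hm]
  -- the elements of `magnusSubgroup` for which the claim holds form a subgroup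
  let H : Subgroup (MulAut (FreeGroup ι)) :=
    { carrier := {m | m ∈ magnusSubgroup ι ∧ Relation.ReflTransGen
        (CommuteOff ((magnusSubgroup ι).lowerCentralSeries k) χ) (x 1) (m * x 1 * m⁻¹)}
      one_mem' := ⟨one_mem _, by simpa using Relation.ReflTransGen.refl⟩
      mul_mem' := by
        rintro m m' ⟨hm, h⟩ ⟨hm', h'⟩
        refine ⟨mul_mem hm hm', ?_⟩
        have := h.trans (htrans m hm _ _ h')
        convert this using 1
        group
      inv_mem' := by
        rintro m ⟨hm, h⟩
        refine ⟨inv_mem hm, ?_⟩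
        have := reflTransGen_commuteOff_symm (htrans m⁻¹ (inv_mem hm) _ _ h)
        convert this using 1
        group }
  -- The generator `s` uses at most three letters, so some copy avoids it and its g-conjugate
  -- commutes with that of `s`. Going from `x 1` to `x τ`, and then back along the conjugated chain,
  -- links `x 1` to its conjugate.
  have hgen : ∀ s ∈ magnusGenerators ι, g * s * g⁻¹ ∈ H := by
    intro s hs
    have hsM : s ∈ magnusSubgroup ι := Subgroup.subset_closure hs
    have hgs : g * s * g⁻¹ ∈ magnusSubgroup ι := normal_magnusSubgroup.conj_mem s hsM g
    obtain ⟨T, hT, hsT⟩ := exists_supportedIn_of_mem_magnusGenerators hs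
    obtain ⟨τ, hτ⟩ := exists_perm_image_subset (D := D) (T := T) (by omega)
    have hcomm : Commute (g * s * g⁻¹) (x τ) :=
      hconj _ _ (commute_of_supportedIn hτ.symm hsT (hsupp τ))
    refine ⟨hgs, (hall τ).trans ?_⟩
    have := htrans _ hgs _ _ (reflTransGen_commuteOff_symm (hall τ))
    rwa [hcomm.eq, mul_inv_cancel_right] at this
  intro m hm
  -- By normality the g-conjugates of Magnus' generators generate the same subgroup.
  have h1 := Subgroup.conj_mem_closure hgen (g⁻¹ * m * g) (by
    have := normal_magnusSubgroup.conj_mem m hm g⁻¹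
    rwa [inv_inv] at this)
  have h2 : g * (g⁻¹ * m * g) * g⁻¹ = m := by group
  rw [h2] at h1
  exact h1.2

theorem fg_lowerCentralSeries_succ {k : ℕ} (hn : 6 * (k + 1) + 1 ≤ Fintype.card ι)
    (hfg : Group.FG ((magnusSubgroup ι).lowerCentralSeries k)) :
    Group.FG ((magnusSubgroup ι).lowerCentralSeries (k + 1)) := by
  classical
  set L := (magnusSubgroup ι).lowerCentralSeries k with hL
  have hle : (magnusSubgroup ι).lowerCentralSeries (k + 1) ≤ L :=
    (magnusSubgroup ι).lowerCentralSeries_antitone (Nat.le_succ k)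
  have hLM : L ≤ magnusSubgroup ι := (magnusSubgroup ι).lowerCentralSeries_le_self k
  let N : Subgroup L := ((magnusSubgroup ι).lowerCentralSeries (k + 1)).subgroupOf L
  have hNfg : N.FG := by
    refine Subgroup.fg_of_commuting_chains N ?_ ?_
    · rw [_root_.commutator_def, Subgroup.commutator_le]
      intro x _ y _
      exact Subgroup.commutator_mem_commutator x.2 (hLM y.2)
    · intro χ hmul hzero ⟨y, hy⟩
      -- χ is extended by the junk value 0 outside `L`; only its values on `L` matter.
      let χ' : MulAut (FreeGroup ι) → ℝ := fun x => if h : x ∈ L then χ ⟨x, h⟩ else 0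
      have hχ' : ∀ x (h : x ∈ L), χ' x = χ ⟨x, h⟩ := fun x h => dif_pos h
      have hlcs : IsLcsCharacter (magnusSubgroup ι) k χ' := by
        refine ⟨fun a ha b hb => ?_, fun a ha => ?_⟩
        · rw [hχ' a ha, hχ' b hb, hχ' _ (mul_mem ha hb), ← hmul]; rfl
        · rw [hχ' a (hle ha)]; exact hzero _ ha
      obtain ⟨b, hbL, hb0, hb⟩ := exists_commuting_chain hn hlcs
        ⟨y, y.2, by rw [hχ' y y.2]; exact hy⟩
      refine ⟨⟨b, hbL⟩, by rwa [← hχ' b hbL], fun g => ?_⟩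
      have key : ∀ z, Relation.ReflTransGen (CommuteOff L χ') b z → ∃ hz : z ∈ L,
          Relation.ReflTransGen (CommutesOffKer χ) ⟨b, hbL⟩ ⟨z, hz⟩ := by
        intro z hz
        induction hz with
        | refl => exact ⟨hbL, Relation.ReflTransGen.refl⟩
        | tail _ h ih =>
          obtain ⟨hz, ih⟩ := ih
          obtain ⟨h1, h2, h3, h4, h5⟩ := h
          rw [hχ' _ h1] at h4
          rw [hχ' _ h2] at h5
          exact ⟨h2, ih.tail ⟨Subtype.ext h3, h4, h5⟩⟩
      obtain ⟨hz, h⟩ := key _ (hb g (hLM g.2))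
      exact h
  have := (Group.fg_iff_subgroup_fg N).2 hNfg
  exact Group.fg_of_surjective
    (f := (Subgroup.subgroupOfEquivOfLe hle).toMonoidHom)
      (Subgroup.subgroupOfEquivOfLe hle).surjective

theorem fg_lowerCentralSeries {k : ℕ} (hn : k ≠ 0 → 6 * k + 1 ≤ Fintype.card ι) :
    Group.FG ((magnusSubgroup ι).lowerCentralSeries k) := by
  induction k with
  | zero =>
    rw [Subgroup.lowerCentralSeries_zero, Group.fg_iff_subgroup_fg, magnusSubgroup]
    exact ⟨finite_magnusGenerators.toFinset, by rw [Set.Finite.coe_toFinset]⟩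
  | succ k ih =>
    have := hn (Nat.succ_ne_zero k)
    exact fg_lowerCentralSeries_succ this (ih fun _ => by omega)

end FreeAut

/-! ### Finite generation of subgroups lying above derived terms -/

section FiniteGeneration

theorem Subgroup.fg_map_iff_of_injective {G G' : Type*} [Group G] [Group G'] {f : G →* G'}
    (hf : Function.Injective f) {H : Subgroup G} : (H.map f).FG ↔ H.FG := by
  rw [← Group.fg_iff_subgroup_fg, ← Group.fg_iff_subgroup_fg]
  let e := H.equivMapOfInjective f hf
  exact ⟨fun _ => Group.fg_of_surjective (f := e.symm.toMonoidHom) e.symm.surjective,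
    fun _ => Group.fg_of_surjective (f := e.toMonoidHom) e.surjective⟩

theorem Subgroup.fg_of_comm {A : Type*} [CommGroup A] [Group.FG A] (H : Subgroup A) : H.FG := by
  have : Module.Finite ℤ (Additive A) := Module.Finite.iff_addGroup_fg.2 inferInstance
  rw [Subgroup.fg_iff_add_fg]
  have h := IsNoetherian.noetherian (AddSubgroup.toIntSubmodule (Subgroup.toAddSubgroup H))
  rw [Submodule.fg_iff_addSubgroup_fg] at h
  simpa using h

/-- H/(H ∩ N) embeds in a finitely generated abelian group; lifts of finitely many generators
together with H ∩ N generate `H`. -/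
theorem Subgroup.fg_of_fg_inf {G : Type*} [Group G] [Group.FG G] {N H : Subgroup G} [N.Normal]
    (hN : _root_.commutator G ≤ N) (h : (H ⊓ N).FG) : H.FG := by
  let : CommGroup (G ⧸ N) :=
    { (inferInstance : Group (G ⧸ N)) with
      mul_comm := (Subgroup.Normal.quotient_commutative_iff_commutator_le.2 hN).is_comm.comm }
  obtain ⟨T, hT⟩ := Subgroup.fg_of_comm (H.map (QuotientGroup.mk' N))
  have hTs : (T : Set (G ⧸ N)) ⊆ QuotientGroup.mk' N '' H := by
    rw [← Subgroup.coe_map, ← hT]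
    exact Subgroup.subset_closure
  classical
  obtain ⟨S, hSH, rfl⟩ := Finset.subset_set_image_iff.1 hTs
  have hS : Subgroup.closure (S : Set G) ≤ H := (Subgroup.closure_le H).2 hSH
  have key : Subgroup.closure (S : Set G) ⊔ H ⊓ N = H := by
    refine le_antisymm (sup_le hS inf_le_left) fun x hx => ?_
    have hx' := Subgroup.mem_map_of_mem (QuotientGroup.mk' N) hx
    rw [← hT, Finset.coe_image, ← MonoidHom.map_closure] at hx'
    obtain ⟨y, hy, hyx⟩ := hx'
    have : x = y * (y⁻¹ * x) := by group
    rw [this]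
    exact mul_mem (Subgroup.mem_sup_left hy) (Subgroup.mem_sup_right
      ⟨H.mul_mem (H.inv_mem (hS hy)) hx, QuotientGroup.eq.1 hyx⟩)
  rw [← key]
  exact Subgroup.FG.sup ⟨S, rfl⟩ h

theorem Subgroup.fg_inf_of_commutator_le {G : Type*} [Group G] {J K K' : Subgroup G}
    [K'.Normal] (hle : K' ≤ K) (hK : K.FG) (hcomm : ⁅K, K⁆ ≤ K') (h : (J ⊓ K').FG) :
    (J ⊓ K).FG := by
  have : Group.FG K := (Group.fg_iff_subgroup_fg K).2 hK
  have hinj := K.subtype_injective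
  rw [← Subgroup.subgroupOf_map_subtype, Subgroup.fg_map_iff_of_injective hinj]
  refine Subgroup.fg_of_fg_inf (N := K'.subgroupOf K) ?_ ?_
  · rw [_root_.commutator_def, Subgroup.commutator_le]
    intro x _ y _
    exact hcomm (Subgroup.commutator_mem_commutator x.2 y.2)
  · have e : J.subgroupOf K ⊓ K'.subgroupOf K = (J ⊓ K').subgroupOf K := rfl
    rwa [← Subgroup.fg_map_iff_of_injective hinj, e,
      Subgroup.subgroupOf_map_subtype, inf_assoc, inf_eq_left.2 hle]

end FiniteGeneration

/-! ### Automorphisms shifting the lower central series -/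

section JohnsonFiltration

open scoped commutatorElement

variable {G : Type*} [Group G]

theorem map_mem_lowerCentralSeries (f : MulAut G) {i : ℕ} {x : G}
    (hx : x ∈ (⊤ : Subgroup G).lowerCentralSeries i) :
    f x ∈ (⊤ : Subgroup G).lowerCentralSeries i := by
  have := Subgroup.characteristic_iff_map_le.1
    (Subgroup.lowerCentralSeries_characteristic (⊤ : Subgroup G) i) f
  exact this ⟨x, hx, rfl⟩

/-- The automorphisms that shift the lower central series by `j` steps. -/
def lcsShift (G : Type*) [Group G] (j : ℕ) : Subgroup (MulAut G) where
  carrier := {f | ∀ i, ∀ x ∈ (⊤ : Subgroup G).lowerCentralSeries i,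
    f x * x⁻¹ ∈ (⊤ : Subgroup G).lowerCentralSeries (i + j)}
  one_mem' i x _ := by simp
  mul_mem' {f g} hf hg i x hx := by
    have := mul_mem (hf i (g x) (map_mem_lowerCentralSeries g hx)) (hg i x hx)
    simpa [mul_assoc] using this
  inv_mem' {f} hf i x hx := by
    have := inv_mem (hf i (f⁻¹ x) (map_mem_lowerCentralSeries f⁻¹ hx))
    simpa using this

theorem commutator_lcsShift_le (j : ℕ) :
    ⁅lcsShift G j, lcsShift G 1⁆ ≤ lcsShift G (j + 1) := by
  rw [Subgroup.commutator_le]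
  intro f hf g hg i y hy
  set x := (g * f)⁻¹ y with hxdef
  have hxi : x ∈ (⊤ : Subgroup G).lowerCentralSeries i := map_mem_lowerCentralSeries _ hy
  have hyx : y = g (f x) := by rw [hxdef, ← MulAut.mul_apply, MulAut.apply_inv_self]
  have hfg : ⁅f, g⁆ y = f (g x) := by
    rw [hxdef, commutatorElement_def]
    simp
  rw [hfg, hyx]
  have ha := hf i x hxi
  have hb := hg i x hxi
  have h1 := hf _ _ hb
  have h2 := hg _ _ ha
  have h3 : ⁅f x * x⁻¹, g x * x⁻¹⁆ ∈ (⊤ : Subgroup G).lowerCentralSeries (i + j + 1) :=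
    Subgroup.commutator_mem_commutator ha trivial
  -- With c = f(x)x⁻¹ and d = g(x)x⁻¹ this equals f(d)d⁻¹ · ⁅c, d⁆⁻¹ · (g(c)c⁻¹)⁻¹, and each factor
  -- lies deep enough.
  have e : f (g x) * (g (f x))⁻¹ = (f (g x * x⁻¹) * (g x * x⁻¹)⁻¹) *
     ((⁅f x * x⁻¹, g x * x⁻¹⁆)⁻¹ * (g (f x * x⁻¹) * (f x * x⁻¹)⁻¹)⁻¹) := by
    simp only [commutatorElement_def, map_mul, map_inv, mul_inv_rev, inv_inv]
    group
  rw [e, ← add_assoc]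
  refine mul_mem ?_ (mul_mem (inv_mem h3) (inv_mem h2))
  rwa [add_right_comm] at h1

/-- The three subgroups lemma, applied in the quotient by the target term. -/
theorem commutator_lowerCentralSeries_one_le (i : ℕ) :
    ⁅(⊤ : Subgroup G).lowerCentralSeries 1, (⊤ : Subgroup G).lowerCentralSeries i⁆ ≤
      (⊤ : Subgroup G).lowerCentralSeries (i + 2) := by
  let L : ℕ → Subgroup G := (⊤ : Subgroup G).lowerCentralSeries
  let π := QuotientGroup.mk' (L (i + 2))
  have h0 : (L (i + 2)).map π = ⊥ := by
    rw [Subgroup.map_eq_bot_iff, QuotientGroup.ker_mk']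
  have htop : (⊤ : Subgroup G).map π = ⊤ :=
    Subgroup.map_top_of_surjective π (QuotientGroup.mk'_surjective _)
  have h : ⁅⁅(⊤ : Subgroup (G ⧸ L (i + 2))), (⊤ : Subgroup (G ⧸ L (i + 2)))⁆, (L i).map π⁆ = ⊥ := by
    have e : ⁅⁅(L i).map π, (⊤ : Subgroup (G ⧸ L (i + 2)))⁆,
        (⊤ : Subgroup (G ⧸ L (i + 2)))⁆ = ⊥ := by
      rw [← htop, ← Subgroup.map_commutator, ← Subgroup.map_commutator]
      exact h0
    refine Subgroup.commutator_commutator_eq_bot_of_rotate ?_ e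
    rw [Subgroup.commutator_comm (⊤ : Subgroup (G ⧸ L (i + 2))) ((L i).map π)]
    exact e
  rw [← htop, ← Subgroup.map_commutator, ← Subgroup.map_commutator, Subgroup.map_eq_bot_iff,
    QuotientGroup.ker_mk'] at h
  exact h

/-- Acting trivially on the abelianization forces trivial action on every graded piece. Writing f u
= c u and f v = d v, the commutator ⁅c u, d v⁆ agrees with ⁅u, v⁆ in the quotient, since there `c`
is central and `d` commutes with `u` and with ⁅u, v⁆. -/
theorem mem_lcsShift_one {f : MulAut G}
    (hf : ∀ x, f x * x⁻¹ ∈ (⊤ : Subgroup G).lowerCentralSeries 1) : f ∈ lcsShift G 1 := by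
  intro i
  induction i with
  | zero => exact fun x _ => hf x
  | succ i ih =>
    let N := (⊤ : Subgroup G).lowerCentralSeries (i + 1 + 1)
    let π := QuotientGroup.mk' N
    have hπ : ∀ x y : G, ⁅x, y⁆ ∈ N → Commute (π x) (π y) := fun x y h => by
      rw [← commutatorElement_eq_one_iff_commute, ← map_commutatorElement]
      exact (QuotientGroup.eq_one_iff _).2 h
    have hle : (⊤ : Subgroup G).lowerCentralSeries (i + 1) ≤
        (π.comp f.toMonoidHom).eqLocus π := by
      rw [Subgroup.lowerCentralSeries_succ, Subgroup.commutator_le]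
      intro u hu v _
      have hc := ih u hu
      have hd := hf v
      obtain ⟨c, hcdef⟩ : ∃ c, c = f u * u⁻¹ := ⟨_, rfl⟩
      obtain ⟨d, hddef⟩ : ∃ d, d = f v * v⁻¹ := ⟨_, rfl⟩
      rw [← hcdef] at hc
      rw [← hddef] at hd
      have hfu : f u = c * u := by rw [hcdef, inv_mul_cancel_right]
      have hfv : f v = d * v := by rw [hddef, inv_mul_cancel_right]
      have c1 : ∀ w, Commute (π c) (π w) := fun w =>
        hπ _ _ (Subgroup.commutator_mem_commutator hc trivial)
      have c2 : Commute (π d) (π u) :=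
        hπ _ _ (commutator_lowerCentralSeries_one_le i (Subgroup.commutator_mem_commutator hd hu))
      have c3 : Commute (π d) ⁅π u, π v⁆ := by
        rw [← map_commutatorElement]
        exact (hπ _ _ (Subgroup.commutator_mem_commutator
          (Subgroup.commutator_mem_commutator hu trivial) trivial)).symm
      change π (f ⁅u, v⁆) = π ⁅u, v⁆
      rw [map_commutatorElement, map_commutatorElement, map_commutatorElement, hfu, hfv,
        map_mul π c, map_mul π d]
      have e1 : ⁅π c * π u, π d * π v⁆ = ⁅π u, π d * π v⁆ := by
        have h1 := c1 u
        have h2 : Commute (π c) (π d * π v) := (c1 d).mul_right (c1 v)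
        have h3 : Commute (π c) (π u * (π d * π v) * (π u)⁻¹) :=
          (h1.mul_right h2).mul_right h1.inv_right
        rw [commutatorElement_def, commutatorElement_def, mul_inv_rev]
        calc π c * π u * (π d * π v) * ((π u)⁻¹ * (π c)⁻¹) * (π d * π v)⁻¹
            = π c * (π u * (π d * π v) * (π u)⁻¹) * (π c)⁻¹ * (π d * π v)⁻¹ := by group
          _ = _ := by rw [h3.eq, mul_inv_cancel_right]
      have e2 : ⁅π u, π d * π v⁆ = ⁅π u, π v⁆ := by
        rw [commutatorElement_def, ← mul_assoc, ← c2.eq, mul_inv_rev]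
        calc π d * π u * π v * (π u)⁻¹ * ((π v)⁻¹ * (π d)⁻¹)
            = π d * ⁅π u, π v⁆ * (π d)⁻¹ := by rw [commutatorElement_def]; group
          _ = _ := by rw [c3.eq, mul_inv_cancel_right]
      rw [e1, e2]
    intro x hx
    have : π (f x) = π x := hle hx
    rw [← div_eq_mul_inv]
    exact QuotientGroup.eq_iff_div_mem.1 this

theorem mem_ker_autQuotientLcs {k : ℕ} {f : MulAut G} : f ∈ (autQuotientLcs G (k + 1)).ker ↔
    ∀ x, f x * x⁻¹ ∈ (⊤ : Subgroup G).lowerCentralSeries k := by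
  have h : ∀ x : G, autQuotientLcs G (k + 1) f (x : G ⧸ lcsTerm G (k + 1)) = x ↔
      f x * x⁻¹ ∈ (⊤ : Subgroup G).lowerCentralSeries k := fun x => by
    rw [autQuotientLcs_apply_mk, QuotientGroup.eq_iff_div_mem, div_eq_mul_inv]
    rfl
  rw [MonoidHom.mem_ker]
  constructor
  · intro hf x
    rw [← h, hf]
    rfl
  · intro hf
    ext x
    induction x using QuotientGroup.induction_on with
    | H x => exact (h x).2 (hf x)

end JohnsonFiltration

/-! ### Comparing the two filtrations and the conclusion -/

namespace FreeAut

open FreeGroup (of lift)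
open scoped commutatorElement

variable {ι : Type*} [DecidableEq ι]

theorem magnusSubgroup_le_lcsShift_one : magnusSubgroup ι ≤ lcsShift (FreeGroup ι) 1 := by
  rw [magnusSubgroup, Subgroup.closure_le]
  intro f hf
  refine mem_lcsShift_one fun x => ?_
  have h : ∀ i, f (of i) * (of i)⁻¹ ∈ _root_.commutator (FreeGroup ι) := by
    intro i
    rcases hf with ⟨a, b, hab, rfl⟩ | ⟨a, b, c, hab, hac, rfl⟩
    · by_cases hi : i = a
      · subst hi
        have e : (of b : FreeGroup ι)⁻¹ * of i * of b * (of i)⁻¹ = ⁅(of b)⁻¹, of i⁆ := by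
          rw [commutatorElement_def, inv_inv]
        rw [conjHom_of_self (of_mem_avoiding hab.symm), e]
        exact Subgroup.commutator_mem_commutator trivial trivial
      · rw [conjHom_of_ne _ hi, mul_inv_cancel]; exact one_mem _
    · by_cases hi : i = a
      · subst hi
        rw [rightHom_of_self (commutatorElement_mem_avoiding hab.symm hac.symm)]
        exact (_root_.commutator (FreeGroup ι)).normal_of_characteristic.conj_mem _
          (Subgroup.commutator_mem_commutator (Subgroup.mem_top _) (Subgroup.mem_top _)) _
      · rw [rightHom_of_ne _ hi, mul_inv_cancel]; exact one_mem _
  have key : (QuotientGroup.mk' (_root_.commutator (FreeGroup ι))).comp f.toMonoidHom =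
      QuotientGroup.mk' (_root_.commutator (FreeGroup ι)) :=
    FreeGroup.ext_hom _ _ fun i => by
      have := h i
      rw [← div_eq_mul_inv, ← QuotientGroup.eq_iff_div_mem] at this
      exact this
  have := DFunLike.congr_fun key x
  rw [← div_eq_mul_inv]
  exact QuotientGroup.eq_iff_div_mem.1 this

theorem lowerCentralSeries_magnusSubgroup_le (k : ℕ) :
    (magnusSubgroup ι).lowerCentralSeries k ≤ lcsShift (FreeGroup ι) (k + 1) := by
  induction k with
  | zero => exact magnusSubgroup_le_lcsShift_one
  | succ k ih =>
    rw [Subgroup.lowerCentralSeries_succ]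
    exact (Subgroup.commutator_mono ih magnusSubgroup_le_lcsShift_one).trans
      (commutator_lcsShift_le _)

variable [Fintype ι]

/-- For `1 ≤ k` such automorphisms act trivially on the abelianization, so Magnus' theorem applies.
-/
theorem ker_autQuotientLcs_le_magnusSubgroup {k : ℕ} (hk : 1 ≤ k) :
    (autQuotientLcs (FreeGroup ι) (k + 1)).ker ≤ magnusSubgroup ι := by
  intro f hf
  rw [← ker_abHom, MonoidHom.mem_ker, abHom_eq_one_iff]
  intro i
  have h := Subgroup.lowerCentralSeries_antitone (⊤ : Subgroup (FreeGroup ι)) hk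
    (mem_ker_autQuotientLcs.1 hf (of i))
  have hle : _root_.commutator (FreeGroup ι) ≤
      (lift fun i => Multiplicative.ofAdd (Pi.single i (1 : ℤ) : ι → ℤ)).ker :=
    Abelianization.commutator_subset_ker _
  have h' : abVec (f (of i) * (of i)⁻¹) = 0 := hle h
  rwa [abVec_mul, abVec_inv, ← sub_eq_add_neg, sub_eq_zero] at h'

theorem fg_ker_autQuotientLcs {k : ℕ} (hk : 2 ≤ k) (hn : 6 * k - 4 ≤ Fintype.card ι) :
    (autQuotientLcs (FreeGroup ι) (k + 1)).ker.FG := by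
  set J := (autQuotientLcs (FreeGroup ι) (k + 1)).ker with hJ
  set L := (magnusSubgroup ι).lowerCentralSeries with hL
  -- The largest index i = k − 1 requires 6(k − 1) + 1 = 6k − 5 letters.
  have hfg : ∀ i < k, (L i).FG := fun i hi =>
    (Group.fg_iff_subgroup_fg _).1 (fg_lowerCentralSeries fun _ => by omega)
  have hlast : L (k - 1) ≤ J := fun f hf => by
    have := lowerCentralSeries_magnusSubgroup_le _ hf
    rw [Nat.sub_add_cancel (by omega)] at this
    refine mem_ker_autQuotientLcs.2 fun x => ?_
    simpa using this 0 x trivial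
  -- Ascend from the deepest term, which lies inside `J`, to the whole of Magnus' subgroup.
  have main : ∀ j < k, (J ⊓ L (k - 1 - j)).FG := by
    intro j
    induction j with
    | zero =>
      intro _
      rw [Nat.sub_zero, inf_eq_right.2 hlast]
      exact hfg _ (by omega)
    | succ j ih =>
      intro hj
      have hs : k - 1 - j = k - 1 - (j + 1) + 1 := by omega
      have ih := ih (by omega)
      rw [hs] at ih
      exact Subgroup.fg_inf_of_commutator_le
        ((magnusSubgroup ι).lowerCentralSeries_antitone (Nat.le_succ _)) (hfg _ (by omega))
        (Subgroup.commutator_mono le_rfl ((magnusSubgroup ι).lowerCentralSeries_le_self _)) ih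
  have h0 := main (k - 1) (by omega)
  rw [Nat.sub_self] at h0
  rwa [hL, Subgroup.lowerCentralSeries_zero,
    inf_eq_left.2 (ker_autQuotientLcs_le_magnusSubgroup (by omega))] at h0

end FreeAut

theorem theoremD (k n : ℕ) (hk : 2 ≤ k) (hn : 6 * k - 4 ≤ n) :
    Group.FG (JIA n k) :=
  (Group.fg_iff_subgroup_fg _).2 (FreeAut.fg_ker_autQuotientLcs hk (by simpa using hn))
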